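/- Let $N\ge 1$ be an integer and $b\in\mathbb{C}$ with $|b|=1$, $\mathrm{Re}\,b>0$, $\mathrm{Im}\,b>0$. Put $\mathbf q=e^{\frac{\pi i}{N}(1+b^2)}$, $q=e^{\frac{\pi i}{2N}(1+b^2)}$, $\tilde{\mathbf q}=e^{\frac{\pi i}{N}(1+b^{-2})}$, $\tilde q=e^{\frac{\pi i}{2N}(1+b^{-2})}$. **Algebra.** Let $U=U_{\mathbf q}(sl_2)\otimes U_{\tilde{\mathbf q}}(sl_2)$ be the unital $\mathbb C$-algebra generated by $E,F,K^{\pm1},\tilde E,\tilde F,\tilde K^{\pm1}$ with $KK^{-1}=K^{-1}K=1$, $KE=\mathbf q^2EK$, $KF=\mathbf q^{-2}FK$, $[E,F]=\frac{K-K^{-1}}{\mathbf q-\mathbf q^{-1}}$, the same relations for the tilded generators with $\tilde{\mathbf q}$, and with untilded and tilded generators commuting. The coproduct is $\Delta E=E\otimes K+1\otimes E$, $\Delta F=F\otimes 1+K^{-1}\otimes F$, $\Delta K^{\pm1}=K^{\pm1}\otimes K^{\pm1}$, the counit is $\varepsilon(E)=\varepsilon(F)=0$, $\varepsilon(K^{\pm1})=1$,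 and likewise for the tilded generators. **Representations.** On functions $f(\mu,m)$ of $\mu\in\mathbb C$, $m\in\mathbb Z/N\mathbb Z$ let $\mathbf y f=e^{\frac{2\pi i}{N}(-ib\mu-m)}f$, $\mathbf u f(\mu,m)=f(\mu+ib,m-1)$, $\tilde{\mathbf y}f=e^{\frac{2\pi i}{N}(-ib^{-1}\mu+m)}f$, $\tilde{\mathbf u}f(\mu,m)=f(\mu+ib^{-1},m+1)$, and $\mathbf u_{\alpha,\beta}=\mathbf q^{-\alpha\beta}\mathbf u^\alpha\mathbf y^\beta$, $\tilde{\mathbf u}_{\alpha,\beta}=\tilde{\mathbf q}^{-\alpha\beta}\tilde{\mathbf u}^\alpha\tilde{\mathbf y}^\beta$ for $\alpha,\beta\in\mathbb Z$. For $\lambda\in\mathbb C^\times$ the representation $\pi^\lambda$ of $U$ is given by $K^{\pm1}\mapsto\mathbf u_{\mp1,0}$, $F\mapsto-\frac{iq}{\mathbf q-\mathbf q^{-1}}\mathbf u_{0,1}$, $E\mapsto-\frac{iq^{-1}}{\mathbf q-\mathbf q^{-1}}[(\lambda+\lambda^{-1})\mathbf u_{0,-1}+\mathbf u_{1,-1}+\mathbf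 u_{-1,-1}]$, $\tilde K^{\pm1}\mapsto\tilde{\mathbf u}_{\mp1,0}$, $\tilde F\mapsto-\frac{i\tilde q^{-1}}{\tilde{\mathbf q}-\tilde{\mathbf q}^{-1}}\tilde{\mathbf u}_{0,1}$, $\tilde E\mapsto-\frac{i\tilde q}{\tilde{\mathbf q}-\tilde{\mathbf q}^{-1}}[(\bar\lambda+\bar\lambda^{-1})\tilde{\mathbf u}_{0,-1}+\tilde{\mathbf u}_{1,-1}+\tilde{\mathbf u}_{-1,-1}]$. **Domains.** Let $\mathcal H=L^2(\mathbb R)\otimes\mathbb C^N$ with $\langle f|g\rangle=\sum_{m\in\mathbb Z/N\mathbb Z}\int_{\mathbb R}\overline{f(\mu,m)}g(\mu,m)\,d\mu$. Let $\overline{\mathfrak D}\subset\mathcal H$ be the maximal common domain of all Laurent polynomials in $\mathbf u,\mathbf y,\tilde{\mathbf u},\tilde{\mathbf y}$: the functions $f(\mu,m)$ entire in $\mu$ such that, for all $a,R\in\mathbb R$, the $L^2(\mathbb R)$-norms of $x\mapsto e^{ax}f(x+i\eta,m)$ are bounded uniformly in $|\eta|\le R$ and $m$. Let $\overline{\mathfrak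 D}_2\subset\mathcal H\otimes\mathcal H$ be the analogous space of functions $f(\mu_1,m_1;\mu_2,m_2)$, entire in $(\mu_1,\mu_2)$, for which the $L^2(\mathbb R^2)$-norms of $e^{a_1x_1+a_2x_2}f(x_1+i\eta_1,m_1;x_2+i\eta_2,m_2)$ are bounded uniformly in $|\eta_1|,|\eta_2|\le R$ and $m_1,m_2$, for all $a_1,a_2,R\in\mathbb R$. It carries the topology of the seminorms $\|\mathbf u^{(1)}_{\alpha_1,\beta_1}\mathbf u^{(2)}_{\alpha_2,\beta_2}f\|_{\mathcal H\otimes\mathcal H}$, $\alpha_i,\beta_i\in\mathbb Z$, where the superscript says on which pair of variables an operator acts. Let $\mathfrak D_2\subset\overline{\mathfrak D}_2$ be the subspace of those $f$ such that for all $\vec\eta\in\mathbb R^2$ and $a>0$ there is $C$ with $|f(\vec x+i\vec\eta,\vec m)|\le Ce^{-a|\vec x|}$ for all $\vec x\in\mathbb R^2$ and $\vec m$. Both $\overline{\mathfrak D}_2$ and $\mathfrak D_2$ are stable under $\pi^{\lambda_1}\otimes\pi^{\lambda_2}$. A linear functional $\Psi$ on one of these spaces is an *invariant bilinear form* for $\pi^{\lambda_1}\otimes\pi^{\lambda_2}$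 if $\Psi[(\pi^{\lambda_1}\otimes\pi^{\lambda_2})(\Delta\xi)f]=\varepsilon(\xi)\Psi[f]$ for all $\xi\in U$ and all $f$ in the space. **The form.** Let $$\mathscr T f(\mu,m)=\frac1{N^2}\sum_{n\in\mathbb Z/N\mathbb Z}\int d\nu\, e^{\frac{2\pi i}N(\mu\nu-mn)}(-1)^{n^2}e^{\frac{\pi i}N(-\nu^2+n^2)}\sum_{m_1\in\mathbb Z/N\mathbb Z}\int d\mu_1\,e^{-\frac{2\pi i}N(\mu_1\nu-m_1n)}f(\mu_1,m_1),$$ $\sigma_1f(\mu,m)=f(\mu+\tfrac i2(b+b^{-1}),m)$, $\mathbf V=\sigma_1\mathscr T^{-1}$, so $\mathbf V^{-1}=\mathscr T\sigma_1^{-1}$. **Theorem.** Let $\lambda_1,\lambda_2\in\mathbb C^\times$. 1. If there is a nonzero linear functional on $\mathfrak D_2$, or a nonzero linear functional on $\overline{\mathfrak D}_2$, that is an invariant bilinear form for $\pi^{\lambda_1}\otimes\pi^{\lambda_2}$, then $\lambda_1=\lambda_2$ or $\lambda_1=\lambda_2^{-1}$. No continuity is assumed. 2. Conversely, let $\lambda_1=\lambda_2^{\pm1}$.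 There is a continuous linear functional $\Psi$ on $\overline{\mathfrak D}_2$ that is an invariant bilinear form for $\pi^{\lambda_1}\otimes\pi^{\lambda_2}$ and satisfies $\Psi[\phi\otimes\psi]=\langle\,\overline{\mathbf V^{-1}\phi}\,|\,\psi\rangle$ for all $\phi,\psi\in\overline{\mathfrak D}$. Its restriction to $\mathfrak D_2$ is nonzero, and every linear functional on $\mathfrak D_2$ (continuous or not) that is an invariant bilinear form is a complex multiple of this restriction. -/

import Mathlib

open Complex MeasureTheory Topology
open scoped ComplexConjugate NNReal ENNReal TensorProduct

noncomputable section

namespace QLorentz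

/-! ### Deformation parameters

The boolean index `t` distinguishes the holomorphic (`false`, untilded) and the
antiholomorphic (`true`, tilded) copy. -/

/-- `b` for the untilded copy, `b⁻¹` for the tilded copy. -/
def bPar (b : Circle) : Bool → ℂ
  | false => (b : ℂ)
  | true => (b : ℂ)⁻¹

/-- The sign with which the discrete variable enters: `1` untilded, `-1` tilded. -/
def sgn : Bool → ℤ
  | false => 1
  | true => -1

/-- The half-power parameter `q = exp(πi(1+b²)/(2N))`, `q̃ = exp(πi(1+b⁻²)/(2N))`. -/
def qHalf (N : ℕ) (b : Circle) (t : Bool) : ℂ :=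
  exp (Real.pi * I / (2 * N) * (1 + bPar b t ^ 2))

/-- The deformation parameter `𝐪 = exp(πi(1+b²)/N)`, `𝐪̃ = exp(πi(1+b⁻²)/N)`. -/
def qPar (N : ℕ) (b : Circle) (t : Bool) : ℂ :=
  exp (Real.pi * I / N * (1 + bPar b t ^ 2))

lemma qPar_ne_zero (N : ℕ) (b : Circle) (t : Bool) : qPar N b t ≠ 0 := exp_ne_zero _

lemma qHalf_ne_zero (N : ℕ) (b : Circle) (t : Bool) : qHalf N b t ≠ 0 := exp_ne_zero _

/-! ### The quantum Lorentz group -/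

/-- Names of the four generators of each copy of the quantum group. -/
inductive Gen
  | E
  | F
  | K
  | Kinv

/-- The free generator of copy `t` with name `g`. -/
abbrev fgen (t : Bool) (g : Gen) : FreeAlgebra ℂ (Bool × Gen) := FreeAlgebra.ι ℂ (t, g)

/-- Defining relations of `U_𝐪(sl₂) ⊗ U_𝐪̃(sl₂)`; the two copies commute. -/
inductive Rel (N : ℕ) (b : Circle) :
    FreeAlgebra ℂ (Bool × Gen) → FreeAlgebra ℂ (Bool × Gen) → Prop
  | K_Kinv (t : Bool) : Rel N b (fgen t .K * fgen t .Kinv) 1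
  | Kinv_K (t : Bool) : Rel N b (fgen t .Kinv * fgen t .K) 1
  | K_E (t : Bool) :
      Rel N b (fgen t .K * fgen t .E) (qPar N b t ^ 2 • (fgen t .E * fgen t .K))
  | K_F (t : Bool) :
      Rel N b (fgen t .K * fgen t .F) ((qPar N b t ^ 2)⁻¹ • (fgen t .F * fgen t .K))
  | E_F (t : Bool) :
      Rel N b (fgen t .E * fgen t .F - fgen t .F * fgen t .E)
        ((qPar N b t - (qPar N b t)⁻¹)⁻¹ • (fgen t .K - fgen t .Kinv))
  | comm (x y : Gen) :
      Rel N b (fgen false x * fgen true y) (fgen true y * fgen false x)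

/-- The quantum Lorentz group `U_𝐪(sl₂) ⊗ U_𝐪̃(sl₂)` as an associative unital algebra. -/
abbrev QLor (N : ℕ) (b : Circle) : Type := RingQuot (Rel N b)

/-- The generator of copy `t` with name `g` in the quantum Lorentz group. -/
def gen (N : ℕ) (b : Circle) (t : Bool) (g : Gen) : QLor N b :=
  RingQuot.mkAlgHom ℂ (Rel N b) (fgen t g)

/-- The family `v` of elements of an algebra satisfies the defining relations. -/
structure SatRel (N : ℕ) (b : Circle) {A : Type*} [Ring A] [Algebra ℂ A]
    (v : Bool → Gen → A) : Prop where
  K_Kinv : ∀ t, v t .K * v t .Kinv = 1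
  Kinv_K : ∀ t, v t .Kinv * v t .K = 1
  K_E : ∀ t, v t .K * v t .E = qPar N b t ^ 2 • (v t .E * v t .K)
  K_F : ∀ t, v t .K * v t .F = (qPar N b t ^ 2)⁻¹ • (v t .F * v t .K)
  E_F : ∀ t, v t .E * v t .F - v t .F * v t .E =
    (qPar N b t - (qPar N b t)⁻¹)⁻¹ • (v t .K - v t .Kinv)
  comm : ∀ x y, v false x * v true y = v true y * v false x

/-- The universal property of the quantum Lorentz group. -/
def liftQ {N : ℕ} {b : Circle} {A : Type*} [Ring A] [Algebra ℂ A]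
    (v : Bool → Gen → A) (hv : SatRel N b v) : QLor N b →ₐ[ℂ] A :=
  RingQuot.liftAlgHom ℂ ⟨FreeAlgebra.lift ℂ (fun p : Bool × Gen => v p.1 p.2), by
    intro x y h
    cases h with
    | K_Kinv t => simpa using hv.K_Kinv t
    | Kinv_K t => simpa using hv.Kinv_K t
    | K_E t => simpa using hv.K_E t
    | K_F t => simpa using hv.K_F t
    | E_F t => simpa using hv.E_F t
    | comm x y => simpa using hv.comm x y⟩

lemma liftQ_gen {N : ℕ} {b : Circle} {A : Type*} [Ring A] [Algebra ℂ A]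
    (v : Bool → Gen → A) (hv : SatRel N b v) (t : Bool) (g : Gen) :
    liftQ v hv (gen N b t g) = v t g := by
  simp [liftQ, gen, RingQuot.liftAlgHom_mkAlgHom_apply]

lemma satRel_gen (N : ℕ) (b : Circle) : SatRel N b (gen N b) where
  K_Kinv t := by simpa [gen] using RingQuot.mkAlgHom_rel ℂ (Rel.K_Kinv (N := N) (b := b) t)
  Kinv_K t := by simpa [gen] using RingQuot.mkAlgHom_rel ℂ (Rel.Kinv_K (N := N) (b := b) t)
  K_E t := by simpa [gen] using RingQuot.mkAlgHom_rel ℂ (Rel.K_E (N := N) (b := b) t)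
  K_F t := by simpa [gen] using RingQuot.mkAlgHom_rel ℂ (Rel.K_F (N := N) (b := b) t)
  E_F t := by simpa [gen] using RingQuot.mkAlgHom_rel ℂ (Rel.E_F (N := N) (b := b) t)
  comm x y := by simpa [gen] using RingQuot.mkAlgHom_rel ℂ (Rel.comm (N := N) (b := b) x y)

/-- A subalgebra containing the image of all generators contains the whole image. -/
lemma algHom_mem_of_gen {N : ℕ} {b : Circle} {A : Type*} [Ring A] [Algebra ℂ A]
    (f : QLor N b →ₐ[ℂ] A) (S : Subalgebra ℂ A) (h : ∀ t g, f (gen N b t g) ∈ S)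
    (ξ : QLor N b) : f ξ ∈ S := by
  obtain ⟨x, rfl⟩ := RingQuot.mkAlgHom_surjective ℂ (Rel N b) ξ
  induction x using FreeAlgebra.induction with
  | grade0 r => rw [AlgHom.commutes, AlgHom.commutes]; exact S.algebraMap_mem r
  | grade1 p => exact h p.1 p.2
  | mul x y hx hy => rw [map_mul, map_mul]; exact S.mul_mem hx hy
  | add x y hx hy => rw [map_add, map_add]; exact S.add_mem hx hy

/-- Values of the counit on generators. -/
def counitGen : Gen → ℂ
  | .E => 0
  | .F => 0
  | .K => 1
  | .Kinv => 1

/-- The counit `ε`. -/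
def counitQ (N : ℕ) (b : Circle) : QLor N b →ₐ[ℂ] ℂ :=
  liftQ (fun _ g => counitGen g)
    { K_Kinv := by intro t; simp [counitGen]
      Kinv_K := by intro t; simp [counitGen]
      K_E := by intro t; simp [counitGen]
      K_F := by intro t; simp [counitGen]
      E_F := by intro t; simp [counitGen]
      comm := by intro x y; exact mul_comm _ _ }

/-- Values of the coproduct on generators: `ΔE = E⊗K + 1⊗E`, `ΔF = F⊗1 + K⁻¹⊗F`,
`ΔK^{±1} = K^{±1}⊗K^{±1}`, for both copies. -/
def comulGen (N : ℕ) (b : Circle) (t : Bool) : Gen → QLor N b ⊗[ℂ] QLor N b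
  | .E => gen N b t .E ⊗ₜ gen N b t .K + 1 ⊗ₜ gen N b t .E
  | .F => gen N b t .F ⊗ₜ 1 + gen N b t .Kinv ⊗ₜ gen N b t .F
  | .K => gen N b t .K ⊗ₜ gen N b t .K
  | .Kinv => gen N b t .Kinv ⊗ₜ gen N b t .Kinv

lemma kinv_e {N : ℕ} {b : Circle} {A : Type*} [Ring A] [Algebra ℂ A]
    {v : Bool → Gen → A} (hv : SatRel N b v) (t : Bool) :
    v t .Kinv * v t .E = (qPar N b t ^ 2)⁻¹ • (v t .E * v t .Kinv) := by
  have h : v t .E * v t .Kinv = qPar N b t ^ 2 • (v t .Kinv * v t .E) := by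
    calc v t .E * v t .Kinv = v t .Kinv * (v t .K * v t .E) * v t .Kinv := by
          rw [← mul_assoc, hv.Kinv_K, one_mul]
      _ = qPar N b t ^ 2 • (v t .Kinv * v t .E * (v t .K * v t .Kinv)) := by
          rw [hv.K_E]; simp [mul_assoc]
      _ = _ := by rw [hv.K_Kinv, mul_one]
  rw [h, inv_smul_smul₀ (pow_ne_zero 2 (qPar_ne_zero N b t))]

/-- The coproduct `Δ`. -/
def comulQ (N : ℕ) (b : Circle) : QLor N b →ₐ[ℂ] QLor N b ⊗[ℂ] QLor N b :=
  liftQ (comulGen N b)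
    { K_Kinv := by
        intro t
        simp [comulGen, (satRel_gen N b).K_Kinv, Algebra.TensorProduct.one_def]
      Kinv_K := by
        intro t
        simp [comulGen, (satRel_gen N b).Kinv_K, Algebra.TensorProduct.one_def]
      K_E := by
        intro t
        simp [comulGen, mul_add, add_mul, (satRel_gen N b).K_E, TensorProduct.smul_tmul',
          TensorProduct.tmul_smul]
      K_F := by
        intro t
        simp [comulGen, mul_add, add_mul, (satRel_gen N b).K_F, TensorProduct.smul_tmul',
          TensorProduct.tmul_smul, (satRel_gen N b).K_Kinv, (satRel_gen N b).Kinv_K]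
      E_F := by
        intro t
        have hs := satRel_gen N b
        have h1 := hs.E_F t
        have h2 : ∀ x y z : QLor N b, x = y + z → x ⊗ₜ[ℂ] gen N b t .K
          = y ⊗ₜ[ℂ] gen N b t .K + z ⊗ₜ[ℂ] gen N b t .K := by
          rintro x y z rfl; rw [TensorProduct.add_tmul]
        have h3 : ∀ x y z : QLor N b, x = y + z → gen N b t .Kinv ⊗ₜ[ℂ] x
          = gen N b t .Kinv ⊗ₜ[ℂ] y + gen N b t .Kinv ⊗ₜ[ℂ] z := by
          rintro x y z rfl; rw [TensorProduct.tmul_add]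
        have h4 := h2 _ _ _ (sub_eq_iff_eq_add'.mp h1)
        have h5 := h3 _ _ _ (sub_eq_iff_eq_add'.mp h1)
        simp only [comulGen, mul_add, add_mul, Algebra.TensorProduct.tmul_mul_tmul, mul_one,
          one_mul, hs.K_F, kinv_e hs]
        rw [h4, h5]
        simp only [TensorProduct.smul_tmul', TensorProduct.tmul_smul, TensorProduct.sub_tmul,
          TensorProduct.tmul_sub, smul_sub]
        abel
      comm := by
        intro x y
        have hc := (satRel_gen N b).comm
        cases x <;> cases y <;>
          simp [comulGen, mul_add, add_mul, hc] <;> abel }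

/-! ### The operators `u`, `y` and the representations `π^λ` -/

/-- Functions of a complex variable `μ` and of `m ∈ ℤ/N` with values in `V`. -/
abbrev Fn (N : ℕ) (V : Type*) : Type _ := ℂ → ZMod N → V

section Operators

variable (N : ℕ) [NeZero N] (b : Circle) {V : Type*} [AddCommGroup V] [Module ℂ V]

/-- `u^α`: `(u f)(μ, m) = f(μ + ib, m - 1)`, `(ũ f)(μ, m) = f(μ + ib⁻¹, m + 1)`. -/
def uPow (t : Bool) (α : ℤ) : Module.End ℂ (Fn N V) where
  toFun f μ m := f (μ + α * (I * bPar b t)) (m - (α * sgn t : ℤ))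
  map_add' _ _ := rfl
  map_smul' _ _ := rfl

/-- The multiplier `y = exp((2πi/N)(-ibμ - m))`, `ỹ = exp((2πi/N)(-ib⁻¹μ + m))`;
here `ZMod.stdAddChar j = exp(2πij/N)`. -/
def yVal (t : Bool) (μ : ℂ) (m : ZMod N) : ℂ :=
  exp (2 * Real.pi * I / N * (-I * bPar b t * μ)) * ZMod.stdAddChar (-((sgn t : ZMod N) * m))

/-- `y^β`: multiplication by the power of the multiplier. -/
def yPow (t : Bool) (β : ℤ) : Module.End ℂ (Fn N V) where
  toFun f μ m := yVal N b t μ m ^ β • f μ m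
  map_add' f g := by funext μ m; simp
  map_smul' c f := by funext μ m; simp [smul_comm c]

/-- `u_{α,β} = 𝐪^{-αβ} u^α y^β`, and likewise for the tilded copy. -/
def uab (t : Bool) (α β : ℤ) : Module.End ℂ (Fn N V) :=
  qPar N b t ^ (-(α * β)) • (uPow N b t α * yPow N b t β)

lemma uPow_apply (t : Bool) (α : ℤ) (f : Fn N V) (μ : ℂ) (m : ZMod N) :
    uPow N b t α f μ m = f (μ + α * (I * bPar b t)) (m - (α * sgn t : ℤ)) := rfl

lemma yPow_apply (t : Bool) (β : ℤ) (f : Fn N V) (μ : ℂ) (m : ZMod N) :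
    yPow N b t β f μ m = yVal N b t μ m ^ β • f μ m := rfl

lemma yVal_ne_zero (t : Bool) (μ : ℂ) (m : ZMod N) : yVal N b t μ m ≠ 0 :=
  mul_ne_zero (exp_ne_zero _) (by rw [ZMod.stdAddChar_apply]; exact Circle.coe_ne_zero _)

lemma uab_apply (t : Bool) (α β : ℤ) (f : Fn N V) (μ : ℂ) (m : ZMod N) :
    uab N b t α β f μ m = (qPar N b t ^ (-(α * β)) *
      yVal N b t (μ + α * (I * bPar b t)) (m - (α * sgn t : ℤ)) ^ β) •
        f (μ + α * (I * bPar b t)) (m - (α * sgn t : ℤ)) := by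
  simp only [uab, LinearMap.smul_apply, Pi.smul_apply, Module.End.mul_apply, uPow_apply,
    yPow_apply, smul_smul]

lemma bPar_mul_bPar (t : Bool) : bPar b t * bPar b (!t) = 1 := by
  cases t <;> simp [bPar]

lemma yVal_shift (t : Bool) (γ : ℤ) (μ : ℂ) (m : ZMod N) :
    yVal N b t (μ + γ * (I * bPar b t)) (m - (γ * sgn t : ℤ)) =
      qPar N b t ^ (2 * γ) * yVal N b t μ m := by
  have h1 : -((sgn t : ZMod N) * (m - ((γ * sgn t : ℤ) : ZMod N))) =
      -((sgn t : ZMod N) * m) + ((γ : ℤ) : ZMod N) := by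
    have : (sgn t : ZMod N) * (sgn t : ZMod N) = 1 := by cases t <;> simp [sgn]
    push_cast
    linear_combination (γ : ZMod N) * this
  have hI : I * I = -1 := I_mul_I
  rw [yVal, yVal, qPar, h1, AddChar.map_add_eq_mul, ZMod.stdAddChar_coe, ← exp_int_mul,
    mul_comm (ZMod.stdAddChar _), ← mul_assoc (exp _), ← mul_assoc (exp _), ← exp_add, ← exp_add]
  congr 2
  push_cast
  linear_combination (-2 * Real.pi * I / N * bPar b t ^ 2 * γ) * hI

lemma yVal_shift_other (t : Bool) (γ : ℤ) (μ : ℂ) (m : ZMod N) :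
    yVal N b t (μ + γ * (I * bPar b (!t))) (m - (γ * sgn (!t) : ℤ)) = yVal N b t μ m := by
  have h1 : -((sgn t : ZMod N) * (m - ((γ * sgn (!t) : ℤ) : ZMod N))) =
      -((sgn t : ZMod N) * m) + ((-γ : ℤ) : ZMod N) := by
    have : (sgn t : ZMod N) * (sgn (!t) : ZMod N) = -1 := by cases t <;> simp [sgn]
    push_cast
    linear_combination (γ : ZMod N) * this
  have hI : I * I = -1 := I_mul_I
  have hb := bPar_mul_bPar b t
  rw [yVal, yVal, h1, AddChar.map_add_eq_mul, ZMod.stdAddChar_coe,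
    mul_comm (ZMod.stdAddChar _), ← mul_assoc, ← exp_add]
  congr 2
  push_cast
  linear_combination (-2 * Real.pi * I / N * γ * (bPar b t * bPar b (!t))) * hI
    + (2 * Real.pi * I / N * γ) * hb

/-- The quantum torus relation `u_{α,β} u_{γ,δ} = 𝐪^{αδ-βγ} u_{α+γ,β+δ}`. -/
lemma uab_mul (t : Bool) (α β γ δ : ℤ) :
    uab N b t α β * uab N b t γ δ =
      (qPar N b t ^ (α * δ - β * γ) • uab N b t (α + γ) (β + δ) : Module.End ℂ (Fn N V)) := by
  refine LinearMap.ext fun f => ?_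
  funext μ m
  have hq := qPar_ne_zero N b t
  have e1 : μ + α * (I * bPar b t) + γ * (I * bPar b t) =
      μ + ((α + γ : ℤ) : ℂ) * (I * bPar b t) := by push_cast; ring
  have e2 : m - ((α * sgn t : ℤ) : ZMod N) - ((γ * sgn t : ℤ) : ZMod N) =
      m - (((α + γ) * sgn t : ℤ) : ZMod N) := by push_cast; ring
  simp only [LinearMap.smul_apply, Pi.smul_apply, Module.End.mul_apply, uab_apply, smul_smul]
  rw [yVal_shift N b t α μ m, yVal_shift N b t γ, yVal_shift N b t α μ m,
    yVal_shift N b t (α + γ), e1, e2]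
  congr 1
  have hy := yVal_ne_zero N b t μ m
  simp only [mul_zpow, ← zpow_mul]
  have : ∀ (a c d e k l : ℂ), a * (c * d) * (e * (k * (l * d))) = (a * c * e * k * l) * (d * d) := by
    intros; ring
  calc _ = (qPar N b t ^ (-(α * β)) * qPar N b t ^ (2 * α * β) * qPar N b t ^ (-(γ * δ)) *
          qPar N b t ^ (2 * γ * δ) * qPar N b t ^ (2 * α * δ)) *
          (yVal N b t μ m ^ β * yVal N b t μ m ^ δ) := by ring
    _ = qPar N b t ^ (α * δ - β * γ + -((α + γ) * (β + δ)) + 2 * (α + γ) * (β + δ)) *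
          yVal N b t μ m ^ (β + δ) := by
        rw [← zpow_add₀ hq, ← zpow_add₀ hq, ← zpow_add₀ hq, ← zpow_add₀ hq, ← zpow_add₀ hy]
        congr 2
        ring
    _ = _ := by rw [zpow_add₀ hq, zpow_add₀ hq]; ring

lemma uab_zero (t : Bool) : (uab N b t 0 0 : Module.End ℂ (Fn N V)) = 1 := by
  refine LinearMap.ext fun f => ?_
  funext μ m
  simp [uab_apply]

lemma uab_commute (α β γ δ : ℤ) :
    uab N b false α β * uab N b true γ δ =
      (uab N b true γ δ * uab N b false α β : Module.End ℂ (Fn N V)) := by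
  refine LinearMap.ext fun f => ?_
  funext μ m
  have e1 : μ + α * (I * bPar b false) + γ * (I * bPar b true) =
      μ + γ * (I * bPar b true) + α * (I * bPar b false) := by ring
  have e2 : m - ((α * sgn false : ℤ) : ZMod N) - ((γ * sgn true : ℤ) : ZMod N) =
      m - ((γ * sgn true : ℤ) : ZMod N) - ((α * sgn false : ℤ) : ZMod N) := by ring
  have h1 := yVal_shift_other N b false γ
  have h2 := yVal_shift_other N b true α
  simp only [Bool.not_false, Bool.not_true] at h1 h2
  simp only [Module.End.mul_apply, uab_apply, smul_smul]
  rw [e1, e2, h2]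
  rw [← e1, ← e2, h1]
  congr 1
  ring

/-- `λ + λ⁻¹` for the untilded copy and its complex conjugate for the tilded copy. -/
def lamPar (lam : ℂˣ) : Bool → ℂ
  | false => (lam : ℂ) + (lam : ℂ)⁻¹
  | true => conj (lam : ℂ) + (conj (lam : ℂ))⁻¹

/-- The operators representing the generators:
`K = u_{-1,0}`, `K⁻¹ = u_{1,0}`, `F = -(iq/(𝐪-𝐪⁻¹)) u_{0,1}`,
`E = -(iq⁻¹/(𝐪-𝐪⁻¹)) [(λ+λ⁻¹) u_{0,-1} + u_{1,-1} + u_{-1,-1}]`, and for the tilded copy the same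
with `𝐪̃`, `λ̄`, `ũ` and `q` replaced by `q̃⁻¹`. -/
def repGen (lam : ℂˣ) (t : Bool) : Gen → Module.End ℂ (Fn N V)
  | .K => uab N b t (-1) 0
  | .Kinv => uab N b t 1 0
  | .F => (-(I * qHalf N b t ^ sgn t / (qPar N b t - (qPar N b t)⁻¹))) • uab N b t 0 1
  | .E => (-(I * qHalf N b t ^ (-sgn t) / (qPar N b t - (qPar N b t)⁻¹))) •
      (lamPar lam t • uab N b t 0 (-1) + uab N b t 1 (-1) + uab N b t (-1) (-1))

lemma repGen_mem_adjoin (lam : ℂˣ) (t : Bool) (g : Gen) :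
    (repGen N b lam t g : Module.End ℂ (Fn N V)) ∈ Algebra.adjoin ℂ
      (Set.range fun p : ℤ × ℤ => (uab N b t p.1 p.2 : Module.End ℂ (Fn N V))) := by
  have hu : ∀ α β : ℤ, (uab N b t α β : Module.End ℂ (Fn N V)) ∈ Algebra.adjoin ℂ
      (Set.range fun p : ℤ × ℤ => (uab N b t p.1 p.2 : Module.End ℂ (Fn N V))) :=
    fun α β => Algebra.subset_adjoin ⟨(α, β), rfl⟩
  cases g with
  | K => exact hu _ _
  | Kinv => exact hu _ _
  | F => exact Subalgebra.smul_mem _ (hu _ _) _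
  | E =>
    exact Subalgebra.smul_mem _ (add_mem (add_mem (Subalgebra.smul_mem _ (hu _ _) _)
      (hu _ _)) (hu _ _)) _

lemma satRel_repGen (lam : ℂˣ) :
    SatRel N b (repGen N b lam : Bool → Gen → Module.End ℂ (Fn N V)) where
  K_Kinv t := by simp [repGen, uab_mul, uab_zero]
  Kinv_K t := by simp [repGen, uab_mul, uab_zero]
  K_E t := by
    have hq := qPar_ne_zero N b t
    simp only [repGen, mul_add, add_mul, mul_smul_comm, smul_mul_assoc, uab_mul, smul_add,
      smul_smul]
    norm_num
    match_scalars <;> field_simp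
  K_F t := by
    have hq := qPar_ne_zero N b t
    simp only [repGen, mul_smul_comm, smul_mul_assoc, uab_mul, smul_smul]
    norm_num
    match_scalars
    field_simp
  E_F t := by
    have hq := qPar_ne_zero N b t
    have hh : qHalf N b t ^ sgn t * qHalf N b t ^ (-sgn t) = 1 := by
      rw [← zpow_add₀ (qHalf_ne_zero N b t)]; simp
    have hd : (qPar N b t - (qPar N b t)⁻¹)⁻¹ * (qPar N b t - (qPar N b t)⁻¹)⁻¹ *
        (qPar N b t - (qPar N b t)⁻¹) = (qPar N b t - (qPar N b t)⁻¹)⁻¹ := by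
      by_cases h : qPar N b t - (qPar N b t)⁻¹ = 0
      · simp [h]
      · rw [mul_assoc, inv_mul_cancel₀ h, mul_one]
    simp only [repGen, mul_add, add_mul, mul_smul_comm, smul_mul_assoc, uab_mul, smul_add,
      smul_smul, div_eq_mul_inv]
    norm_num
    generalize (qPar N b t - (qPar N b t)⁻¹)⁻¹ = D at *
    generalize qHalf N b t ^ sgn t = x at *
    have hx : x * x⁻¹ = 1 := mul_inv_cancel₀ (left_ne_zero_of_mul_eq_one hh)
    have hI : I * I = -1 := I_mul_I
    match_scalars
    · ring
    · linear_combination (x * x⁻¹ * D * D * (qPar N b t - (qPar N b t)⁻¹)) * hI -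
        (D * D * (qPar N b t - (qPar N b t)⁻¹)) * hx - hd
    · linear_combination -(x * x⁻¹ * D * D * (qPar N b t - (qPar N b t)⁻¹)) * hI +
        (D * D * (qPar N b t - (qPar N b t)⁻¹)) * hx + hd
  comm x y := by
    have h := uab_commute N b (V := V)
    have key : ∀ A B : Module.End ℂ (Fn N V), A ∈ Algebra.adjoin ℂ
        (Set.range fun p : ℤ × ℤ => (uab N b false p.1 p.2 : Module.End ℂ (Fn N V))) →
        B ∈ Algebra.adjoin ℂ
        (Set.range fun p : ℤ × ℤ => (uab N b true p.1 p.2 : Module.End ℂ (Fn N V))) →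
        A * B = B * A := by
      intro A B hA hB
      refine Algebra.commute_of_mem_adjoin_of_forall_mem_commute hB ?_
      rintro _ ⟨p, rfl⟩
      refine (Algebra.commute_of_mem_adjoin_of_forall_mem_commute hA ?_).symm
      rintro _ ⟨p', rfl⟩
      exact (h _ _ _ _).symm
    exact key _ _ (repGen_mem_adjoin N b lam false x) (repGen_mem_adjoin N b lam true y)

/-- The representation `π^λ` of the quantum Lorentz group by operators on functions. -/
def rep (lam : ℂˣ) : QLor N b →ₐ[ℂ] Module.End ℂ (Fn N V) :=
  liftQ (repGen N b lam) (satRel_repGen N b lam)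

/-- The subalgebra of operators preserving the subspace `S`. -/
def stab {M : Type*} [AddCommGroup M] [Module ℂ M] (S : Submodule ℂ M) :
    Subalgebra ℂ (Module.End ℂ M) where
  carrier := {T | ∀ f ∈ S, T f ∈ S}
  mul_mem' hA hB f hf := hA _ (hB f hf)
  add_mem' hA hB f hf := S.add_mem (hA f hf) (hB f hf)
  algebraMap_mem' c f hf := by
    simpa [Module.algebraMap_end_apply] using S.smul_mem c hf

lemma rep_mem (lam : ℂˣ) (A : Subalgebra ℂ (Module.End ℂ (Fn N V)))
    (hA : ∀ t α β, uab N b t α β ∈ A) (ξ : QLor N b) : rep N b lam ξ ∈ A := by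
  refine algHom_mem_of_gen _ A (fun t g => ?_) ξ
  rw [rep, liftQ_gen]
  refine (Algebra.adjoin_le ?_ : Algebra.adjoin ℂ _ ≤ A) (repGen_mem_adjoin N b lam t g)
  rintro _ ⟨p, rfl⟩
  exact hA _ _ _

end Operators

/-! ### Tensor product representations -/

section Tensor

variable (N : ℕ) [NeZero N] (b : Circle)

/-- Functions of `(μ₁, m₁, μ₂, m₂)`. -/
abbrev Fn2 (N : ℕ) : Type := Fn N (Fn N ℂ)

/-- An operator on functions of `(μ, m)` acting on the second pair of variables. -/
def slot2 (N : ℕ) : Module.End ℂ (Fn N ℂ) →ₐ[ℂ] Module.End ℂ (Fn2 N) where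
  toFun T :=
    { toFun := fun f μ m => T (f μ m)
      map_add' := fun f g => by funext μ m; simp
      map_smul' := fun c f => by funext μ m; simp }
  map_one' := rfl
  map_mul' _ _ := rfl
  map_zero' := rfl
  map_add' _ _ := rfl
  commutes' _ := rfl

lemma slot2_apply (T : Module.End ℂ (Fn N ℂ)) (f : Fn2 N) (μ : ℂ) (m : ZMod N) :
    slot2 N T f μ m = T (f μ m) := rfl

/-- `u_{α,β}` acting on the first pair of variables. -/
def uab1 (t : Bool) (α β : ℤ) : Module.End ℂ (Fn2 N) := uab N b t α β

/-- `u_{α,β}` acting on the second pair of variables. -/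
def uab2 (t : Bool) (α β : ℤ) : Module.End ℂ (Fn2 N) := slot2 N (uab N b t α β)

lemma rep_commute_slot2 (lam : ℂˣ) (ξ : QLor N b) (T : Module.End ℂ (Fn N ℂ)) :
    Commute (rep N b lam ξ : Module.End ℂ (Fn2 N)) (slot2 N T) := by
  have h := rep_mem N b (V := Fn N ℂ) lam (Subalgebra.centralizer ℂ {slot2 N T}) (by
    intro t α β
    rw [Subalgebra.mem_centralizer_iff]
    rintro _ rfl
    refine LinearMap.ext fun f => ?_
    funext μ m
    simp only [Module.End.mul_apply, slot2_apply, uab_apply, map_smul]) ξ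
  rw [Subalgebra.mem_centralizer_iff] at h
  exact (h _ rfl).symm

/-- The representation `π^{λ₁} ⊗ π^{λ₂}` of `U ⊗ U`, where `U` is the quantum Lorentz group,
on functions of `(μ₁, m₁, μ₂, m₂)`. -/
def tensorRep (lam₁ lam₂ : ℂˣ) : QLor N b ⊗[ℂ] QLor N b →ₐ[ℂ] Module.End ℂ (Fn2 N) :=
  Algebra.TensorProduct.lift (rep N b lam₁) ((slot2 N).comp (rep N b lam₂))
    (fun ξ ζ => by exact rep_commute_slot2 N b lam₁ ξ (rep N b lam₂ ζ))

lemma tensorRep_tmul (lam₁ lam₂ : ℂˣ) (ξ ζ : QLor N b) :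
    tensorRep N b lam₁ lam₂ (ξ ⊗ₜ ζ) =
      (rep N b lam₁ ξ : Module.End ℂ (Fn2 N)) * slot2 N (rep N b lam₂ ζ) :=
  Algebra.TensorProduct.lift_tmul _ _ _ _ _

lemma tensorRep_mem (lam₁ lam₂ : ℂˣ) (A : Subalgebra ℂ (Module.End ℂ (Fn2 N)))
    (h1 : ∀ t α β, uab1 N b t α β ∈ A) (h2 : ∀ t α β, uab2 N b t α β ∈ A)
    (ξ : QLor N b ⊗[ℂ] QLor N b) : tensorRep N b lam₁ lam₂ ξ ∈ A := by
  induction ξ using TensorProduct.induction_on with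
  | zero => rw [map_zero]; exact A.zero_mem
  | add x y hx hy => rw [map_add]; exact A.add_mem hx hy
  | tmul x y =>
    rw [tensorRep_tmul]
    refine A.mul_mem (rep_mem N b lam₁ A h1 x) ?_
    exact rep_mem N b lam₂ (A.comap (slot2 N)) h2 y

/-! ### The domains -/

/-- The restriction of `f` to `Im μ = η`, multiplied by `e^{aμ}`, for one pair of variables. -/
def line1 {N : ℕ} (f : Fn N ℂ) (a η : ℝ) (m : ZMod N) (x : ℝ) : ℂ :=
  Real.exp (a * x) • f (x + η * I) m

/-- The restriction of `f` to `Im μ₁ = η₁`, `Im μ₂ = η₂`, multiplied by `e^{a₁μ₁ + a₂μ₂}`. -/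
def line2 {N : ℕ} (f : Fn2 N) (a₁ a₂ η₁ η₂ : ℝ) (m₁ m₂ : ZMod N) (x : ℝ × ℝ) : ℂ :=
  Real.exp (a₁ * x.1 + a₂ * x.2) • f (x.1 + η₁ * I) m₁ (x.2 + η₂ * I) m₂

lemma line1_continuous {N : ℕ} {f : Fn N ℂ} (hf : ∀ m, Differentiable ℂ fun μ => f μ m)
    (a η : ℝ) (m : ZMod N) : Continuous (line1 f a η m) := by
  have h := (hf m).continuous
  have h2 : Continuous fun x : ℝ => f (x + η * I) m :=
    h.comp (f := fun x : ℝ => (x + η * I : ℂ)) (by fun_prop)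
  have h3 : Continuous fun x : ℝ => Real.exp (a * x) := by fun_prop
  exact h3.smul h2

lemma line2_continuous {N : ℕ} {f : Fn2 N}
    (hf : ∀ m₁ m₂, Differentiable ℂ fun z : ℂ × ℂ => f z.1 m₁ z.2 m₂)
    (a₁ a₂ η₁ η₂ : ℝ) (m₁ m₂ : ZMod N) : Continuous (line2 f a₁ a₂ η₁ η₂ m₁ m₂) := by
  have h := (hf m₁ m₂).continuous
  have h2 : Continuous fun x : ℝ × ℝ => f (x.1 + η₁ * I) m₁ (x.2 + η₂ * I) m₂ :=
    h.comp (f := fun x : ℝ × ℝ => ((x.1 + η₁ * I, x.2 + η₂ * I) : ℂ × ℂ)) (by fun_prop)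
  have h3 : Continuous fun x : ℝ × ℝ => Real.exp (a₁ * x.1 + a₂ * x.2) := by fun_prop
  exact h3.smul h2

/-- The maximal common domain in `L²(ℝ) ⊗ ℂ^N` of all Laurent polynomials in `u, y, ũ, ỹ`, each
vector being identified with its analytic continuation: functions entire in `μ` such that
`e^{aμ} f(μ + iη, m)` is square integrable for all real `a`, `η`, locally uniformly in `η`. -/
def Dbar (N : ℕ) : Submodule ℂ (Fn N ℂ) where
  carrier := {f | (∀ m, Differentiable ℂ fun μ => f μ m) ∧
    ∀ a R : ℝ, ∃ C : ℝ≥0, ∀ η : ℝ, |η| ≤ R → ∀ m, eLpNorm (line1 f a η m) 2 volume ≤ C}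
  add_mem' := by
    rintro f g ⟨hf, hf'⟩ ⟨hg, hg'⟩
    refine ⟨fun m => (hf m).add (hg m), fun a R => ?_⟩
    obtain ⟨C, hC⟩ := hf' a R
    obtain ⟨D, hD⟩ := hg' a R
    refine ⟨C + D, fun η hη m => ?_⟩
    have e : line1 (f + g) a η m = line1 f a η m + line1 g a η m := by
      funext x; simp [line1]
    rw [e, ENNReal.coe_add]
    exact (eLpNorm_add_le (line1_continuous hf _ _ _).aestronglyMeasurable
      (line1_continuous hg _ _ _).aestronglyMeasurable (by norm_num)).trans
      (add_le_add (hC η hη m) (hD η hη m))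
  zero_mem' := by
    refine ⟨fun m => differentiable_const 0, fun a R => ⟨0, fun η _ m => ?_⟩⟩
    have e : line1 (0 : Fn N ℂ) a η m = 0 := by funext x; simp [line1]
    simp [e]
  smul_mem' := by
    rintro c f ⟨hf, hf'⟩
    refine ⟨fun m => (hf m).const_smul c, fun a R => ?_⟩
    obtain ⟨C, hC⟩ := hf' a R
    refine ⟨‖c‖₊ * C, fun η hη m => ?_⟩
    have e : line1 (c • f) a η m = c • line1 f a η m := by
      funext x; simp [line1]; ring
    rw [e, eLpNorm_const_smul, ENNReal.coe_mul]
    exact mul_le_mul_right (hC η hη m) _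

/-- The maximal common domain in `(L²(ℝ) ⊗ ℂ^N) ⊗ (L²(ℝ) ⊗ ℂ^N)` of all Laurent polynomials in
the operators `u, y, ũ, ỹ` acting on either tensor factor. -/
def Dbar2 (N : ℕ) : Submodule ℂ (Fn2 N) where
  carrier := {f | (∀ m₁ m₂, Differentiable ℂ fun z : ℂ × ℂ => f z.1 m₁ z.2 m₂) ∧
    ∀ a₁ a₂ R : ℝ, ∃ C : ℝ≥0, ∀ η₁ η₂ : ℝ, |η₁| ≤ R → |η₂| ≤ R →
      ∀ m₁ m₂, eLpNorm (line2 f a₁ a₂ η₁ η₂ m₁ m₂) 2 volume ≤ C}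
  add_mem' := by
    rintro f g ⟨hf, hf'⟩ ⟨hg, hg'⟩
    refine ⟨fun m₁ m₂ => (hf m₁ m₂).add (hg m₁ m₂), fun a₁ a₂ R => ?_⟩
    obtain ⟨C, hC⟩ := hf' a₁ a₂ R
    obtain ⟨D, hD⟩ := hg' a₁ a₂ R
    refine ⟨C + D, fun η₁ η₂ h₁ h₂ m₁ m₂ => ?_⟩
    have e : line2 (f + g) a₁ a₂ η₁ η₂ m₁ m₂ = line2 f a₁ a₂ η₁ η₂ m₁ m₂ + line2 g a₁ a₂ η₁ η₂ m₁ m₂ := by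
      funext x; simp [line2]
    rw [e, ENNReal.coe_add]
    exact (eLpNorm_add_le (line2_continuous hf _ _ _ _ _ _).aestronglyMeasurable
      (line2_continuous hg _ _ _ _ _ _).aestronglyMeasurable (by norm_num)).trans
      (add_le_add (hC η₁ η₂ h₁ h₂ m₁ m₂) (hD η₁ η₂ h₁ h₂ m₁ m₂))
  zero_mem' := by
    refine ⟨fun m₁ m₂ => differentiable_const 0, fun a₁ a₂ R => ⟨0, fun η₁ η₂ _ _ m₁ m₂ => ?_⟩⟩
    have e : line2 (0 : Fn2 N) a₁ a₂ η₁ η₂ m₁ m₂ = 0 := by funext x; simp [line2]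
    simp [e]
  smul_mem' := by
    rintro c f ⟨hf, hf'⟩
    refine ⟨fun m₁ m₂ => (hf m₁ m₂).const_smul c, fun a₁ a₂ R => ?_⟩
    obtain ⟨C, hC⟩ := hf' a₁ a₂ R
    refine ⟨‖c‖₊ * C, fun η₁ η₂ h₁ h₂ m₁ m₂ => ?_⟩
    have e : line2 (c • f) a₁ a₂ η₁ η₂ m₁ m₂ = c • line2 f a₁ a₂ η₁ η₂ m₁ m₂ := by
      funext x; simp [line2]; ring
    rw [e, eLpNorm_const_smul, ENNReal.coe_mul]
    exact mul_le_mul_right (hC η₁ η₂ h₁ h₂ m₁ m₂) _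

/-- The subspace of `Dbar2` of functions with
`|f(μ⃗ + iη⃗, m⃗)| ≤ C e^{-a|μ⃗|}` for all `a > 0`, where `C` may depend on `η⃗` and `a`. -/
def D2 (N : ℕ) : Submodule ℂ (Fn2 N) where
  carrier := {f | f ∈ Dbar2 N ∧ ∀ η₁ η₂ a : ℝ, 0 < a → ∃ C : ℝ, ∀ (x₁ x₂ : ℝ) (m₁ m₂ : ZMod N),
    ‖f (x₁ + η₁ * I) m₁ (x₂ + η₂ * I) m₂‖ ≤ C * Real.exp (-a * Real.sqrt (x₁ ^ 2 + x₂ ^ 2))}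
  add_mem' := by
    rintro f g ⟨hf, hf'⟩ ⟨hg, hg'⟩
    refine ⟨add_mem hf hg, fun η₁ η₂ a ha => ?_⟩
    obtain ⟨C, hC⟩ := hf' η₁ η₂ a ha
    obtain ⟨D, hD⟩ := hg' η₁ η₂ a ha
    refine ⟨C + D, fun x₁ x₂ m₁ m₂ => ?_⟩
    rw [add_mul]
    exact (norm_add_le _ _).trans (add_le_add (hC _ _ _ _) (hD _ _ _ _))
  zero_mem' := ⟨zero_mem _, fun η₁ η₂ a _ => ⟨0, fun _ _ _ _ => by simp⟩⟩
  smul_mem' := by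
    rintro c f ⟨hf, hf'⟩
    refine ⟨Submodule.smul_mem _ c hf, fun η₁ η₂ a ha => ?_⟩
    obtain ⟨C, hC⟩ := hf' η₁ η₂ a ha
    refine ⟨‖c‖ * C, fun x₁ x₂ m₁ m₂ => ?_⟩
    rw [mul_assoc]
    simp only [Pi.smul_apply, norm_smul]
    exact mul_le_mul_of_nonneg_left (hC _ _ _ _) (norm_nonneg c)

lemma exists_norm_bound (κ : ZMod N → ZMod N → ℂ) :
    ∃ K : ℝ, 0 ≤ K ∧ ∀ m₁ m₂, ‖κ m₁ m₂‖ ≤ K := by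
  refine ⟨∑ p : ZMod N × ZMod N, ‖κ p.1 p.2‖, Finset.sum_nonneg fun _ _ => norm_nonneg _,
    fun m₁ m₂ => ?_⟩
  exact Finset.single_le_sum (f := fun p : ZMod N × ZMod N => ‖κ p.1 p.2‖)
    (fun _ _ => norm_nonneg _) (Finset.mem_univ (m₁, m₂))

/-- `Dbar2` is preserved by complex translations and by exponential multipliers. -/
lemma mem_Dbar2_of {f g : Fn2 N} (hf : f ∈ Dbar2 N) (κ : ZMod N → ZMod N → ℂ)
    (c₁ c₂ d₁ d₂ : ℂ) (s₁ s₂ : ZMod N → ZMod N)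
    (hg : ∀ μ₁ m₁ μ₂ m₂, g μ₁ m₁ μ₂ m₂ =
      κ m₁ m₂ * exp (c₁ * μ₁ + c₂ * μ₂) * f (μ₁ + d₁) (s₁ m₁) (μ₂ + d₂) (s₂ m₂)) :
    g ∈ Dbar2 N := by
  obtain ⟨K, hK0, hK⟩ := exists_norm_bound N κ
  have hgd : ∀ m₁ m₂, Differentiable ℂ fun z : ℂ × ℂ => g z.1 m₁ z.2 m₂ := by
    intro m₁ m₂
    simp only [hg]
    have h := hf.1 (s₁ m₁) (s₂ m₂)
    have h2 : Differentiable ℂ fun z : ℂ × ℂ => f (z.1 + d₁) (s₁ m₁) (z.2 + d₂) (s₂ m₂) :=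
      h.comp (f := fun z : ℂ × ℂ => ((z.1 + d₁, z.2 + d₂) : ℂ × ℂ)) (by fun_prop)
    exact Differentiable.mul (by fun_prop) h2
  refine ⟨hgd, fun a₁ a₂ R => ?_⟩
  obtain ⟨C, hC⟩ := hf.2 (a₁ + c₁.re) (a₂ + c₂.re) (R + |d₁.im| + |d₂.im|)
  set B : ℝ := |c₁.im| * R + |c₂.im| * R - (a₁ + c₁.re) * d₁.re - (a₂ + c₂.re) * d₂.re with hB
  refine ⟨(K * Real.exp B).toNNReal * C, fun η₁ η₂ h₁ h₂ m₁ m₂ => ?_⟩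
  have hle : ∀ x : ℝ × ℝ, ‖line2 g a₁ a₂ η₁ η₂ m₁ m₂ x‖ ≤ (K * Real.exp B) *
      ‖(line2 f (a₁ + c₁.re) (a₂ + c₂.re) (η₁ + d₁.im) (η₂ + d₂.im) (s₁ m₁) (s₂ m₂) ∘
        fun x => x + (d₁.re, d₂.re)) x‖ := by
    intro x
    have e1 : ((x.1 + d₁.re : ℝ) : ℂ) + ((η₁ + d₁.im : ℝ) : ℂ) * I = x.1 + η₁ * I + d₁ := by
      conv_rhs => rw [← re_add_im d₁]
      push_cast; ring
    have e2 : ((x.2 + d₂.re : ℝ) : ℂ) + ((η₂ + d₂.im : ℝ) : ℂ) * I = x.2 + η₂ * I + d₂ := by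
      conv_rhs => rw [← re_add_im d₂]
      push_cast; ring
    simp only [line2, Function.comp, Prod.fst_add, Prod.snd_add, e1, e2, hg, norm_smul, norm_mul,
      norm_exp, Real.norm_eq_abs, Real.abs_exp]
    have e3 : (c₁ * (x.1 + η₁ * I) + c₂ * (x.2 + η₂ * I)).re =
        c₁.re * x.1 - c₁.im * η₁ + (c₂.re * x.2 - c₂.im * η₂) := by simp
    rw [e3]
    set F := ‖f (x.1 + η₁ * I + d₁) (s₁ m₁) (x.2 + η₂ * I + d₂) (s₂ m₂)‖
    have hexp : Real.exp (a₁ * x.1 + a₂ * x.2) *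
        Real.exp (c₁.re * x.1 - c₁.im * η₁ + (c₂.re * x.2 - c₂.im * η₂)) ≤
        Real.exp B * Real.exp ((a₁ + c₁.re) * (x.1 + d₁.re) + (a₂ + c₂.re) * (x.2 + d₂.re)) := by
      rw [← Real.exp_add, ← Real.exp_add, Real.exp_le_exp, hB]
      have k1 : -(c₁.im * η₁) ≤ |c₁.im| * R :=
        (neg_le_abs _).trans (by rw [abs_mul]; exact mul_le_mul_of_nonneg_left h₁ (abs_nonneg _))
      have k2 : -(c₂.im * η₂) ≤ |c₂.im| * R :=
        (neg_le_abs _).trans (by rw [abs_mul]; exact mul_le_mul_of_nonneg_left h₂ (abs_nonneg _))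
      linarith
    calc _ = ‖κ m₁ m₂‖ * (Real.exp (a₁ * x.1 + a₂ * x.2) *
        Real.exp (c₁.re * x.1 - c₁.im * η₁ + (c₂.re * x.2 - c₂.im * η₂))) * F := by ring
      _ ≤ K * (Real.exp B *
          Real.exp ((a₁ + c₁.re) * (x.1 + d₁.re) + (a₂ + c₂.re) * (x.2 + d₂.re))) * F := by
        gcongr
        exact hK _ _
      _ = _ := by ring
  have hmeas := (line2_continuous hf.1 (a₁ + c₁.re) (a₂ + c₂.re) (η₁ + d₁.im) (η₂ + d₂.im)
    (s₁ m₁) (s₂ m₂)).aestronglyMeasurable (μ := (volume : Measure (ℝ × ℝ)))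
  have h3 := eLpNorm_le_mul_eLpNorm_of_ae_le_mul (p := 2) (μ := volume)
    (Filter.Eventually.of_forall hle)
  rw [eLpNorm_comp_measurePreserving hmeas
    (measurePreserving_add_right (volume : Measure (ℝ × ℝ)) (d₁.re, d₂.re))] at h3
  refine h3.trans ?_
  rw [ENNReal.coe_mul]
  refine mul_le_mul' le_rfl (hC _ _ ?_ ?_ _ _)
  · exact (abs_add_le _ _).trans (by linarith [abs_nonneg d₂.im])
  · exact (abs_add_le _ _).trans (by linarith [abs_nonneg d₁.im])

lemma mem_D2_of {f g : Fn2 N} (hf : f ∈ D2 N) (κ : ZMod N → ZMod N → ℂ)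
    (c₁ c₂ d₁ d₂ : ℂ) (s₁ s₂ : ZMod N → ZMod N)
    (hg : ∀ μ₁ m₁ μ₂ m₂, g μ₁ m₁ μ₂ m₂ =
      κ m₁ m₂ * exp (c₁ * μ₁ + c₂ * μ₂) * f (μ₁ + d₁) (s₁ m₁) (μ₂ + d₂) (s₂ m₂)) :
    g ∈ D2 N := by
  refine ⟨mem_Dbar2_of N hf.1 κ c₁ c₂ d₁ d₂ s₁ s₂ hg, fun η₁ η₂ a ha => ?_⟩
  obtain ⟨K, hK0, hK⟩ := exists_norm_bound N κ
  set a' : ℝ := a + |c₁.re| + |c₂.re| with ha'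
  have ha'0 : 0 < a' := by positivity
  obtain ⟨C, hC⟩ := hf.2 (η₁ + d₁.im) (η₂ + d₂.im) a' ha'0
  set r : ℝ := Real.sqrt (d₁.re ^ 2 + d₂.re ^ 2) with hr
  refine ⟨K * Real.exp (-(c₁.im * η₁) - c₂.im * η₂ + a' * r) * C, fun x₁ x₂ m₁ m₂ => ?_⟩
  have e1 : ((x₁ + d₁.re : ℝ) : ℂ) + ((η₁ + d₁.im : ℝ) : ℂ) * I = x₁ + η₁ * I + d₁ := by
    conv_rhs => rw [← re_add_im d₁]
    push_cast; ring
  have e2 : ((x₂ + d₂.re : ℝ) : ℂ) + ((η₂ + d₂.im : ℝ) : ℂ) * I = x₂ + η₂ * I + d₂ := by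
    conv_rhs => rw [← re_add_im d₂]
    push_cast; ring
  have h := hC (x₁ + d₁.re) (x₂ + d₂.re) (s₁ m₁) (s₂ m₂)
  rw [e1, e2] at h
  have e3 : (c₁ * (x₁ + η₁ * I) + c₂ * (x₂ + η₂ * I)).re =
      c₁.re * x₁ - c₁.im * η₁ + (c₂.re * x₂ - c₂.im * η₂) := by simp
  rw [hg, norm_mul, norm_mul, norm_exp, e3]
  have hC0 : 0 ≤ C := by
    by_contra hneg
    have := (norm_nonneg _).trans h
    have h2 := mul_neg_of_neg_of_pos (not_le.mp hneg)
      (Real.exp_pos (-a' * Real.sqrt ((x₁ + d₁.re) ^ 2 + (x₂ + d₂.re) ^ 2)))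
    linarith
  set ρ := Real.sqrt (x₁ ^ 2 + x₂ ^ 2) with hρ
  set ρ' := Real.sqrt ((x₁ + d₁.re) ^ 2 + (x₂ + d₂.re) ^ 2) with hρ'
  have htri : ρ ≤ ρ' + r := by
    rw [hρ, hρ', hr, ← norm_add_mul_I, ← norm_add_mul_I, ← norm_add_mul_I]
    have : (x₁ + x₂ * I : ℂ) = (((x₁ + d₁.re : ℝ) : ℂ) + ((x₂ + d₂.re : ℝ) : ℂ) * I) -
        (d₁.re + d₂.re * I) := by push_cast; ring
    rw [this]
    exact norm_sub_le _ _
  have hx1 : |x₁| ≤ ρ := Real.abs_le_sqrt (by nlinarith [sq_nonneg x₂])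
  have hx2 : |x₂| ≤ ρ := Real.abs_le_sqrt (by nlinarith [sq_nonneg x₁])
  have k1 : c₁.re * x₁ ≤ |c₁.re| * ρ :=
    (le_abs_self _).trans (by rw [abs_mul]; exact mul_le_mul_of_nonneg_left hx1 (abs_nonneg _))
  have k2 : c₂.re * x₂ ≤ |c₂.re| * ρ :=
    (le_abs_self _).trans (by rw [abs_mul]; exact mul_le_mul_of_nonneg_left hx2 (abs_nonneg _))
  calc _ ≤ K * Real.exp (c₁.re * x₁ - c₁.im * η₁ + (c₂.re * x₂ - c₂.im * η₂)) *
        (C * Real.exp (-a' * ρ')) := by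
        gcongr
        exact hK _ _
    _ = K * C * Real.exp (c₁.re * x₁ - c₁.im * η₁ + (c₂.re * x₂ - c₂.im * η₂) + -a' * ρ') := by
        rw [Real.exp_add _ (-a' * ρ')]; ring
    _ ≤ K * C * Real.exp (-(c₁.im * η₁) - c₂.im * η₂ + a' * r + -a * ρ) := by
        have h5 := mul_le_mul_of_nonneg_left htri ha'0.le
        have e4 : a' * ρ = a * ρ + |c₁.re| * ρ + |c₂.re| * ρ := by rw [ha']; ring
        refine mul_le_mul_of_nonneg_left (Real.exp_le_exp.mpr ?_) (mul_nonneg hK0 hC0)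
        linarith
    _ = _ := by rw [Real.exp_add _ (-a * ρ)]; ring

lemma yVal_zpow (t : Bool) (β : ℤ) (μ : ℂ) (m : ZMod N) :
    yVal N b t μ m ^ β = ZMod.stdAddChar (-((sgn t : ZMod N) * m)) ^ β *
      exp (β * (2 * Real.pi / N * bPar b t) * μ) := by
  have hI : I * I = -1 := I_mul_I
  rw [yVal, mul_zpow, mul_comm, ← exp_int_mul]
  congr 2
  linear_combination (-2 * β * Real.pi / N * bPar b t * μ) * hI

lemma uab1_form (t : Bool) (α β : ℤ) :
    ∃ (κ : ZMod N → ZMod N → ℂ) (c₁ c₂ d₁ d₂ : ℂ) (s₁ s₂ : ZMod N → ZMod N),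
      ∀ (f : Fn2 N) (μ₁ : ℂ) (m₁ : ZMod N) (μ₂ : ℂ) (m₂ : ZMod N),
        uab1 N b t α β f μ₁ m₁ μ₂ m₂ =
          κ m₁ m₂ * exp (c₁ * μ₁ + c₂ * μ₂) * f (μ₁ + d₁) (s₁ m₁) (μ₂ + d₂) (s₂ m₂) := by
  refine ⟨fun m₁ _ => qPar N b t ^ (-(α * β)) *
    (ZMod.stdAddChar (-((sgn t : ZMod N) * (m₁ - ((α * sgn t : ℤ) : ZMod N)))) ^ β *
      exp (β * (2 * Real.pi / N * bPar b t) * (α * (I * bPar b t)))),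
    β * (2 * Real.pi / N * bPar b t), 0, α * (I * bPar b t), 0,
    fun m => m - ((α * sgn t : ℤ) : ZMod N), fun m => m, fun f μ₁ m₁ μ₂ m₂ => ?_⟩
  rw [uab1, uab_apply, yVal_zpow, mul_add, exp_add]
  simp only [Pi.smul_apply, smul_eq_mul, add_zero, zero_mul]
  ring

lemma uab2_form (t : Bool) (α β : ℤ) :
    ∃ (κ : ZMod N → ZMod N → ℂ) (c₁ c₂ d₁ d₂ : ℂ) (s₁ s₂ : ZMod N → ZMod N),
      ∀ (f : Fn2 N) (μ₁ : ℂ) (m₁ : ZMod N) (μ₂ : ℂ) (m₂ : ZMod N),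
        uab2 N b t α β f μ₁ m₁ μ₂ m₂ =
          κ m₁ m₂ * exp (c₁ * μ₁ + c₂ * μ₂) * f (μ₁ + d₁) (s₁ m₁) (μ₂ + d₂) (s₂ m₂) := by
  refine ⟨fun _ m₂ => qPar N b t ^ (-(α * β)) *
    (ZMod.stdAddChar (-((sgn t : ZMod N) * (m₂ - ((α * sgn t : ℤ) : ZMod N)))) ^ β *
      exp (β * (2 * Real.pi / N * bPar b t) * (α * (I * bPar b t)))),
    0, β * (2 * Real.pi / N * bPar b t), 0, α * (I * bPar b t),
    fun m => m, fun m => m - ((α * sgn t : ℤ) : ZMod N), fun f μ₁ m₁ μ₂ m₂ => ?_⟩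
  rw [uab2, slot2_apply, uab_apply, yVal_zpow, mul_add, exp_add]
  simp only [smul_eq_mul, add_zero, zero_mul, zero_add]
  ring

lemma uab1_mem_Dbar2 (t : Bool) (α β : ℤ) : uab1 N b t α β ∈ stab (Dbar2 N) := by
  obtain ⟨κ, c₁, c₂, d₁, d₂, s₁, s₂, h⟩ := uab1_form N b t α β
  exact fun f hf => mem_Dbar2_of N hf κ c₁ c₂ d₁ d₂ s₁ s₂ (h f)

lemma uab2_mem_Dbar2 (t : Bool) (α β : ℤ) : uab2 N b t α β ∈ stab (Dbar2 N) := by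
  obtain ⟨κ, c₁, c₂, d₁, d₂, s₁, s₂, h⟩ := uab2_form N b t α β
  exact fun f hf => mem_Dbar2_of N hf κ c₁ c₂ d₁ d₂ s₁ s₂ (h f)

lemma uab1_mem_D2 (t : Bool) (α β : ℤ) : uab1 N b t α β ∈ stab (D2 N) := by
  obtain ⟨κ, c₁, c₂, d₁, d₂, s₁, s₂, h⟩ := uab1_form N b t α β
  exact fun f hf => mem_D2_of N hf κ c₁ c₂ d₁ d₂ s₁ s₂ (h f)

lemma uab2_mem_D2 (t : Bool) (α β : ℤ) : uab2 N b t α β ∈ stab (D2 N) := by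
  obtain ⟨κ, c₁, c₂, d₁, d₂, s₁, s₂, h⟩ := uab2_form N b t α β
  exact fun f hf => mem_D2_of N hf κ c₁ c₂ d₁ d₂ s₁ s₂ (h f)

/-- `π^{λ₁} ⊗ π^{λ₂}` on `Dbar2`. -/
def repDbar2 (lam₁ lam₂ : ℂˣ) (ξ : QLor N b ⊗[ℂ] QLor N b) : Module.End ℂ (Dbar2 N) :=
  (tensorRep N b lam₁ lam₂ ξ).restrict (tensorRep_mem N b lam₁ lam₂ (stab (Dbar2 N))
    (uab1_mem_Dbar2 N b) (uab2_mem_Dbar2 N b) ξ)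

/-- `π^{λ₁} ⊗ π^{λ₂}` on `D2`. -/
def repD2 (lam₁ lam₂ : ℂˣ) (ξ : QLor N b ⊗[ℂ] QLor N b) : Module.End ℂ (D2 N) :=
  (tensorRep N b lam₁ lam₂ ξ).restrict (tensorRep_mem N b lam₁ lam₂ (stab (D2 N))
    (uab1_mem_D2 N b) (uab2_mem_D2 N b) ξ)

/-- Invariance of a linear functional `Ψ` on a space on which `U ⊗ U` acts by `ρ`:
`Ψ[ρ(Δξ) f] = ε(ξ) Ψ[f]` for all `ξ` in `U` and all `f`. -/
def IsInvariant {N : ℕ} {b : Circle} {M : Type*} [AddCommGroup M] [Module ℂ M]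
    (ρ : QLor N b ⊗[ℂ] QLor N b → Module.End ℂ M) (Ψ : M →ₗ[ℂ] ℂ) : Prop :=
  ∀ (ξ : QLor N b) (f : M), Ψ (ρ (comulQ N b ξ) f) = counitQ N b ξ * Ψ f

/-! ### The Fréchet topology -/

lemma memLp_of_mem_Dbar2 {f : Fn2 N} (hf : f ∈ Dbar2 N) (m₁ m₂ : ZMod N) :
    MemLp (fun x : ℝ × ℝ => f x.1 m₁ x.2 m₂) 2 volume := by
  have e : (fun x : ℝ × ℝ => f x.1 m₁ x.2 m₂) = line2 f 0 0 0 0 m₁ m₂ := by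
    funext x; simp [line2]
  rw [e]
  obtain ⟨C, hC⟩ := hf.2 0 0 0
  exact ⟨(line2_continuous hf.1 _ _ _ _ _ _).aestronglyMeasurable,
    (hC 0 0 (by simp) (by simp) m₁ m₂).trans_lt ENNReal.coe_lt_top⟩

/-- The embedding of `Dbar2` into the Hilbert space `L²(ℝ²) ⊗ ℂ^{N²}`. -/
def toL2 : Dbar2 N →ₗ[ℂ]
    PiLp 2 (fun _ : ZMod N × ZMod N => Lp ℂ 2 (volume : Measure (ℝ × ℝ))) where
  toFun f := WithLp.toLp 2 fun m => (memLp_of_mem_Dbar2 N f.2 m.1 m.2).toLp _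
  map_add' _ _ := rfl
  map_smul' _ _ := rfl

/-- The seminorm `‖u_{α₁,β₁} ⊗ u_{α₂,β₂} f‖` with the Hilbert space norm, indexed by
`((α₁, β₁), (α₂, β₂))`. -/
def frechetSeminorm : SeminormFamily ℂ (Dbar2 N) ((ℤ × ℤ) × (ℤ × ℤ)) := fun p =>
  (normSeminorm ℂ (PiLp 2 fun _ : ZMod N × ZMod N => Lp ℂ 2 (volume : Measure (ℝ × ℝ)))).comp
    (toL2 N ∘ₗ ((uab1 N b false p.1.1 p.1.2).restrict (uab1_mem_Dbar2 N b false p.1.1 p.1.2)) ∘ₗ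
      ((uab2 N b false p.2.1 p.2.2).restrict (uab2_mem_Dbar2 N b false p.2.1 p.2.2)))

/-- The Fréchet topology of `Dbar2`. -/
abbrev frechetTopology : TopologicalSpace (Dbar2 N) :=
  (frechetSeminorm N b).moduleFilterBasis.topology

/-! ### The bilinear form -/

/-- The element `φ ⊗ ψ`. -/
def tensorFn {N : ℕ} (φ ψ : Fn N ℂ) : Fn2 N := fun μ₁ m₁ μ₂ m₂ => φ μ₁ m₁ * ψ μ₂ m₂

lemma tensorFn_mem {φ ψ : Fn N ℂ} (hφ : φ ∈ Dbar N) (hψ : ψ ∈ Dbar N) :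
    tensorFn φ ψ ∈ Dbar2 N := by
  refine ⟨fun m₁ m₂ => ?_, fun a₁ a₂ R => ?_⟩
  · exact ((hφ.1 m₁).comp differentiable_fst).mul ((hψ.1 m₂).comp differentiable_snd)
  · obtain ⟨C, hC⟩ := hφ.2 a₁ R
    obtain ⟨D, hD⟩ := hψ.2 a₂ R
    refine ⟨C * D, fun η₁ η₂ h₁ h₂ m₁ m₂ => ?_⟩
    have e : eLpNorm (line2 (tensorFn φ ψ) a₁ a₂ η₁ η₂ m₁ m₂) 2 volume =
        eLpNorm (line1 φ a₁ η₁ m₁) 2 volume * eLpNorm (line1 ψ a₂ η₂ m₂) 2 volume := by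
      have m1 := (line1_continuous hφ.1 a₁ η₁ m₁).measurable
      have m2 := (line1_continuous hψ.1 a₂ η₂ m₂).measurable
      have e0 : line2 (tensorFn φ ψ) a₁ a₂ η₁ η₂ m₁ m₂ =
          fun x => line1 φ a₁ η₁ m₁ x.1 * line1 ψ a₂ η₂ m₂ x.2 := by
        funext x
        simp only [line2, line1, tensorFn, Real.exp_add, real_smul, ofReal_mul]
        ring
      rw [e0]
      simp only [eLpNorm_eq_lintegral_rpow_enorm_toReal (two_ne_zero) (ENNReal.ofNat_ne_top),
        enorm_mul, ENNReal.mul_rpow_of_nonneg _ _ (ENNReal.toReal_nonneg)]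
      rw [Measure.volume_eq_prod, lintegral_prod_mul (m1.enorm.pow_const _).aemeasurable
        (m2.enorm.pow_const _).aemeasurable, ENNReal.mul_rpow_of_nonneg _ _ (by norm_num)]
    rw [e, ENNReal.coe_mul]
    exact mul_le_mul' (hC η₁ h₁ m₁) (hD η₂ h₂ m₂)

/-- The unitary transformation
`𝒯 f(μ,m) = N⁻² ∑_{n,m₁} ∫∫ dν dμ₁ e^{(2πi/N)(μν-mn)} (-1)^{n²} e^{(πi/N)(-ν²+n²)}
  e^{-(2πi/N)(μ₁ν-m₁n)} f(μ₁,m₁)`. -/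
def opT (f : ℝ → ZMod N → ℂ) (μ : ℝ) (m : ZMod N) : ℂ :=
  1 / (N : ℂ) ^ 2 * ∑ n : ZMod N, ∫ ν : ℝ,
    exp (2 * Real.pi * I / N * (μ * ν)) * ZMod.stdAddChar (-(m * n)) *
      ((-1) ^ (n.val ^ 2) * exp (Real.pi * I / N * (-(ν : ℂ) ^ 2 + (n.val : ℂ) ^ 2))) *
      ∑ m₁ : ZMod N, ∫ μ₁ : ℝ,
        exp (-(2 * Real.pi * I / N) * (μ₁ * ν)) * ZMod.stdAddChar (m₁ * n) * f μ₁ m₁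

/-- The inverse of the affine shift `σ₁ f(μ,m) = f(μ + (i/2)(b + b⁻¹), m)`, evaluated at real
`μ`. -/
def shiftInv {N : ℕ} (b : Circle) (f : Fn N ℂ) (μ : ℝ) (m : ZMod N) : ℂ :=
  f (μ - I / 2 * ((b : ℂ) + (b : ℂ)⁻¹)) m

/-- `V⁻¹ = 𝒯 σ₁⁻¹`, the inverse of `V = σ₁ 𝒯⁻¹`. -/
def VInv (φ : Fn N ℂ) : ℝ → ZMod N → ℂ := opT N (shiftInv b φ)

/-- The inner product `⟨f | g⟩ = ∑_m ∫ conj f(μ,m) g(μ,m) dμ` of `L²(ℝ) ⊗ ℂ^N`. -/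
def innerH (f g : ℝ → ZMod N → ℂ) : ℂ := ∑ m : ZMod N, ∫ μ : ℝ, conj (f μ m) * g μ m

/-- The bilinear form `Ψ_λ[φ ⊗ ψ] = ⟨conj (V⁻¹ φ) | ψ⟩`. -/
def psiForm (φ ψ : Fn N ℂ) : ℂ :=
  innerH N (fun μ m => conj (VInv N b φ μ m)) (fun μ m => ψ μ m)

lemma D2_le_Dbar2 : D2 N ≤ Dbar2 N := fun _ h => h.1

end Tensor

end QLorentz

end

noncomputable section

namespace QLorentz

/-! ### Entire functions decaying in strips -/

/-! The proof conjugates the tensor product representation by one explicit multiplier and then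
classifies the functionals invariant under all shifts.

Let `kerG` be the Gaussian `exp (πi/N (μ₂ - μ₁ - Q)²)`, with `Q = (i/2)(b + b⁻¹)`, divided by the
quadratic character `gq` of `m₂ - m₁`. Completing the square in the continuous and in the discrete
variable shows that multiplication by this kernel sends `u_{α,β} ⊗ u_{γ,δ}` to `(-𝐪)^n u_{α,β+n} ⊗
u_{γ,δ-n}` with `n = α - γ` (`opG_opW`). Write a functional as `Φ = Φ₁ ∘ G`, where `G` is this
multiplication, a bijection of `D2`. Then `ΔF` becomes `(1 - u₁) y₁` up to a nonzero factor, so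
invariance under `F` is invariance of `Φ₁` under the shift `u₁`; `ΔK⁻¹` then gives invariance under
`u₂`. For such `Φ₁` the terms of `ΔE` without `λ` cancel in pairs, and what remains is a nonzero
constant times `(λ₂ + λ₂⁻¹ - λ₁ - λ₁⁻¹) Φ₁ ∘ y₂⁻¹`, conjugated for the tilded copy
(`apply_repD2_E`). Since `y₂` is invertible, a nonzero form forces `λ₁ = λ₂^{±1}`; conversely, for
such parameters every shift invariant `Φ₁` gives an invariant form.

It remains to see that a shift invariant functional is a multiple of the total integral, without
continuity (`eq_totalInt_of_shiftInv`). This is algebraic: a function whose integral along one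
variable vanishes is a finite sum of differences `g(z + d) - g(z)` inside the same space. Two shifts
fixing the discrete variable are used, `u ũ` with `d = 2i Re b` and `u^N` with `d = iNb`. For the
imaginary shift `iβ` alone, the moments `∫ e^{2πkx/β} F(x) dx`, `k ∈ ℤ`, are obstructions, and the
only ones: when they vanish, a solution is the convolution with `1/(1 + e^{2πx/β})`, a residue
formula verifies the equation, and the vanishing moments give the decay. The moments with `k ≠ 0`
are removed beforehand by a difference for the second shift, which is possible because its real part
is nonzero (`exists_sub_add_sub`).

Two analytic points complete the argument. By the mean value property the `L²` conditions already
imply rapid decay in strips, so `Dbar2` and `D2` coincide. The operator `V⁻¹` is a Gaussian Fourier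
multiplier composed with a complex translation; computing the Gaussian integral and the quadratic
Gauss sum identifies its integral kernel with a nonzero multiple of `kerG` (`VInv_eq`). Hence the
form in the theorem is, up to that constant, the total integral of `kerG * f`, and Cauchy–Schwarz
gives its continuity. -/

/-- Entire functions of one variable decaying faster than any exponential, uniformly in
horizontal strips. -/
structure Rapid1 (g : ℂ → ℂ) : Prop where
  diff : Differentiable ℂ g
  bound : ∀ a R : ℝ, ∃ C : ℝ, ∀ z : ℂ, |z.im| ≤ R → ‖g z‖ ≤ C * Real.exp (-a * |z.re|)

/-- Entire functions of two variables decaying faster than any exponential, uniformly in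
horizontal strips. -/
structure Rapid2 (F : ℂ × ℂ → ℂ) : Prop where
  diff : Differentiable ℂ F
  bound : ∀ a R : ℝ, ∃ C : ℝ, ∀ z : ℂ × ℂ, |z.1.im| ≤ R → |z.2.im| ≤ R →
    ‖F z‖ ≤ C * Real.exp (-a * (|z.1.re| + |z.2.re|))

/-- Entire functions growing at most exponentially in horizontal strips. -/
structure Mild2 (A : ℂ × ℂ → ℂ) : Prop where
  diff : Differentiable ℂ A
  bound : ∀ R : ℝ, ∃ C c : ℝ, ∀ z : ℂ × ℂ, |z.1.im| ≤ R → |z.2.im| ≤ R →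
    ‖A z‖ ≤ C * Real.exp (c * (|z.1.re| + |z.2.re|))

lemma Rapid2.add {F H : ℂ × ℂ → ℂ} (hF : Rapid2 F) (hH : Rapid2 H) :
    Rapid2 fun z => F z + H z := by
  refine ⟨hF.diff.add hH.diff, fun a R => ?_⟩
  obtain ⟨C, hC⟩ := hF.bound a R
  obtain ⟨D, hD⟩ := hH.bound a R
  refine ⟨C + D, fun z h1 h2 => (norm_add_le _ _).trans ?_⟩
  rw [add_mul]
  exact add_le_add (hC z h1 h2) (hD z h1 h2)

lemma Rapid2.mul_mild {F A : ℂ × ℂ → ℂ} (hF : Rapid2 F) (hA : Mild2 A) :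
    Rapid2 fun z => A z * F z := by
  refine ⟨hA.diff.mul hF.diff, fun a R => ?_⟩
  obtain ⟨C, c, hC⟩ := hA.bound R
  -- Decay at the larger rate `a + c` pays for the growth exponent `c` of `A`.
  obtain ⟨D, hD⟩ := hF.bound (a + c) R
  refine ⟨C * D, fun z h1 h2 => ?_⟩
  rw [norm_mul]
  have h := mul_le_mul (hC z h1 h2) (hD z h1 h2) (norm_nonneg _)
    ((norm_nonneg _).trans (hC z h1 h2))
  refine h.trans (le_of_eq ?_)
  rw [mul_mul_mul_comm, ← Real.exp_add]
  congr 2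
  ring

lemma Mild2.mul {A B : ℂ × ℂ → ℂ} (hA : Mild2 A) (hB : Mild2 B) :
    Mild2 fun z => A z * B z := by
  refine ⟨hA.diff.mul hB.diff, fun R => ?_⟩
  obtain ⟨C, c, hC⟩ := hA.bound R
  obtain ⟨D, d, hD⟩ := hB.bound R
  refine ⟨C * D, c + d, fun z h1 h2 => ?_⟩
  rw [norm_mul]
  have h := mul_le_mul (hC z h1 h2) (hD z h1 h2) (norm_nonneg _)
    ((norm_nonneg _).trans (hC z h1 h2))
  refine h.trans (le_of_eq ?_)
  rw [mul_mul_mul_comm, ← Real.exp_add]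
  congr 2
  ring

lemma Mild2.const (c : ℂ) : Mild2 fun _ => c :=
  ⟨differentiable_const c, fun _ => ⟨‖c‖, 0, fun z _ _ => by simp⟩⟩

lemma Rapid2.const_mul {F : ℂ × ℂ → ℂ} (hF : Rapid2 F) (c : ℂ) : Rapid2 fun z => c * F z :=
  hF.mul_mild (Mild2.const c)

lemma Rapid2.sub {F H : ℂ × ℂ → ℂ} (hF : Rapid2 F) (hH : Rapid2 H) :
    Rapid2 fun z => F z - H z := by
  simpa [sub_eq_add_neg] using hF.add (hH.const_mul (-1))

/-- The exponential of a linear form. -/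
lemma Mild2.exp_linear (c₁ c₂ : ℂ) : Mild2 fun z => exp (c₁ * z.1 + c₂ * z.2) := by
  refine ⟨by fun_prop, fun R => ⟨Real.exp (|c₁.im| * R + |c₂.im| * R), |c₁.re| + |c₂.re|,
    fun z h1 h2 => ?_⟩⟩
  rw [norm_exp, ← Real.exp_add, Real.exp_le_exp]
  simp only [add_re, mul_re]
  have k : ∀ x y : ℝ, -(x * y) ≤ |x| * |y| := fun x y => by
    rw [← abs_mul]; exact neg_le_abs _
  have k' : ∀ x y : ℝ, x * y ≤ |x| * |y| := fun x y => by
    rw [← abs_mul]; exact le_abs_self _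
  nlinarith [k c₁.im z.1.im, k c₂.im z.2.im, k' c₁.re z.1.re, k' c₂.re z.2.re,
    mul_le_mul_of_nonneg_left h1 (abs_nonneg c₁.im), mul_le_mul_of_nonneg_left h2 (abs_nonneg c₂.im),
    mul_nonneg (abs_nonneg c₁.re) (abs_nonneg z.2.re),
    mul_nonneg (abs_nonneg c₂.re) (abs_nonneg z.1.re)]

lemma Rapid2.shift {F : ℂ × ℂ → ℂ} (hF : Rapid2 F) (d₁ d₂ : ℂ) :
    Rapid2 fun z => F (z.1 + d₁, z.2 + d₂) := by
  refine ⟨hF.diff.comp (f := fun z : ℂ × ℂ => (z.1 + d₁, z.2 + d₂)) (by fun_prop), fun a R => ?_⟩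
  -- The rate `|a|` makes the real translation cost only a constant factor whatever the sign of `a`;
  -- the strip is widened to contain the translated points.
  obtain ⟨C, hC⟩ := hF.bound |a| (R + |d₁.im| + |d₂.im|)
  refine ⟨C * Real.exp (|a| * (|d₁.re| + |d₂.re|)), fun z h1 h2 => ?_⟩
  have h := hC (z.1 + d₁, z.2 + d₂)
    (by simp only [add_im]; linarith [abs_add_le z.1.im d₁.im, abs_nonneg d₂.im])
    (by simp only [add_im]; linarith [abs_add_le z.2.im d₂.im, abs_nonneg d₁.im])
  have hC0 : 0 ≤ C := by
    by_contra hneg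
    have := (norm_nonneg _).trans h
    nlinarith [Real.exp_pos (-|a| * (|(z.1 + d₁).re| + |(z.2 + d₂).re|))]
  refine h.trans ?_
  rw [mul_assoc, ← Real.exp_add]
  refine mul_le_mul_of_nonneg_left (Real.exp_le_exp.mpr ?_) hC0
  simp only [add_re]
  have e1 : |z.1.re| ≤ |z.1.re + d₁.re| + |d₁.re| := by
    simpa using abs_sub (z.1.re + d₁.re) d₁.re
  have e2 : |z.2.re| ≤ |z.2.re + d₂.re| + |d₂.re| := by
    simpa using abs_sub (z.2.re + d₂.re) d₂.re
  have e3 : a * (|z.1.re| + |z.2.re|) ≤ |a| * (|z.1.re| + |z.2.re|) :=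
    mul_le_mul_of_nonneg_right (le_abs_self a) (by positivity)
  nlinarith [abs_nonneg a]

lemma Rapid2.swap {F : ℂ × ℂ → ℂ} (hF : Rapid2 F) : Rapid2 fun z => F (z.2, z.1) := by
  refine ⟨hF.diff.comp (f := fun z : ℂ × ℂ => (z.2, z.1)) (by fun_prop), fun a R => ?_⟩
  obtain ⟨C, hC⟩ := hF.bound a R
  refine ⟨C, fun z h1 h2 => ?_⟩
  have := hC (z.2, z.1) h2 h1
  rwa [add_comm] at this

lemma Rapid2.slice {F : ℂ × ℂ → ℂ} (hF : Rapid2 F) (w : ℂ) : Rapid1 fun z => F (w, z) := by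
  refine ⟨hF.diff.comp (f := fun z : ℂ => (w, z)) (by fun_prop), fun a R => ?_⟩
  obtain ⟨C, hC⟩ := hF.bound a (max R |w.im|)
  refine ⟨C * Real.exp (-a * |w.re|), fun z hz => ?_⟩
  refine (hC (w, z) (le_max_right _ _) (hz.trans (le_max_left _ _))).trans (le_of_eq ?_)
  rw [mul_assoc, ← Real.exp_add]
  congr 2
  ring

lemma Rapid2.slice_left {F : ℂ × ℂ → ℂ} (hF : Rapid2 F) (z : ℂ) : Rapid1 fun w => F (w, z) :=
  hF.swap.slice z

lemma Rapid1.tensor {g h : ℂ → ℂ} (hg : Rapid1 g) (hh : Rapid1 h) :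
    Rapid2 fun z => g z.1 * h z.2 := by
  refine ⟨(hg.diff.comp differentiable_fst).mul (hh.diff.comp differentiable_snd), fun a R => ?_⟩
  obtain ⟨C, hC⟩ := hg.bound a R
  obtain ⟨D, hD⟩ := hh.bound a R
  refine ⟨C * D, fun z h1 h2 => ?_⟩
  rw [norm_mul]
  refine (mul_le_mul (hC _ h1) (hD _ h2) (norm_nonneg _)
    ((norm_nonneg _).trans (hC _ h1))).trans (le_of_eq ?_)
  rw [mul_mul_mul_comm, ← Real.exp_add]
  congr 2
  ring

lemma Rapid1.gaussian : Rapid1 fun z => exp (-Real.pi * z ^ 2) := by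
  refine ⟨by fun_prop, fun a R => ⟨Real.exp (Real.pi * R ^ 2 + a ^ 2), fun z hz => ?_⟩⟩
  rw [norm_exp, ← Real.exp_add, Real.exp_le_exp]
  have e : (-(Real.pi : ℂ) * z ^ 2).re = -Real.pi * (z.re ^ 2 - z.im ^ 2) := by
    simp [pow_two]
  rw [e]
  have h1 : z.im ^ 2 ≤ R ^ 2 := by
    rw [← sq_abs z.im]; exact pow_le_pow_left₀ (abs_nonneg _) hz 2
  have h2 := Real.pi_gt_three
  have h3 : z.re ^ 2 = |z.re| ^ 2 := (sq_abs _).symm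
  have h4 : a * |z.re| ≤ a ^ 2 + |z.re| ^ 2 := by nlinarith [sq_nonneg (a - |z.re|), sq_nonneg (a + |z.re|)]
  nlinarith [sq_nonneg |z.re|]

/-! ### Integrals over horizontal lines: integrability, parameters, contour shifts -/

/-- The contour shift below uses the majorant `(1 + x²)⁻¹`, since it must also cover functions like
`β² / (z² + β²)`; this lemma brings rapidly decaying functions under it. -/
lemma exp_neg_abs_le (x : ℝ) : Real.exp (-|x|) ≤ 2 * (1 + x ^ 2)⁻¹ := by
  have h := Real.quadratic_le_exp_of_nonneg (abs_nonneg x)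
  rw [sq_abs] at h
  rw [Real.exp_neg, ← div_eq_mul_inv, inv_eq_one_div, div_le_div_iff₀ (Real.exp_pos _) (by positivity)]
  nlinarith [abs_nonneg x]

lemma integrable_exp_neg_abs : Integrable fun x : ℝ => Real.exp (-|x|) := by
  refine (integrable_inv_one_add_sq.const_mul 2).mono' (by fun_prop)
    (Filter.Eventually.of_forall fun x => ?_)
  rw [Real.norm_eq_abs, Real.abs_exp]
  exact exp_neg_abs_le x

lemma Rapid1.integrable {g : ℂ → ℂ} (hg : Rapid1 g) (d : ℂ) :
    Integrable fun x : ℝ => g (x + d) := by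
  obtain ⟨C, hC⟩ := hg.bound 1 |d.im|
  have hint : Integrable fun x : ℝ => C * Real.exp (-|x + d.re|) :=
    ((integrable_exp_neg_abs).comp_add_right d.re).const_mul C
  refine hint.mono' ?_ (Filter.Eventually.of_forall fun x => ?_)
  · exact (hg.diff.continuous.comp (by fun_prop)).aestronglyMeasurable
  · simpa using hC (x + d) (by simp)

/-- Holomorphic dependence of a superposition of translates on its parameters. -/
lemma differentiable_integral_translates {F : ℂ × ℂ → ℂ} (hF : Differentiable ℂ F)
    {ν : Measure ℝ} {κ : ℝ → ℂ} {d : ℝ → ℂ} (hκ : AEStronglyMeasurable κ ν) (hd : Continuous d)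
    (hB : ∀ p₀ : ℂ × ℂ, ∃ B : ℝ → ℝ, Integrable B ν ∧
      ∀ᵐ x ∂ν, ∀ p ∈ Metric.ball p₀ 2, ‖κ x * F (p.1, p.2 + d x)‖ ≤ B x) :
    Differentiable ℂ fun p : ℂ × ℂ => ∫ x, κ x * F (p.1, p.2 + d x) ∂ν := by
  intro p₀
  obtain ⟨B, hBi, hB⟩ := hB p₀
  have hmeas : ∀ p : ℂ × ℂ, AEStronglyMeasurable (fun x => κ x * F (p.1, p.2 + d x)) ν := fun p =>
    hκ.mul (hF.continuous.comp (f := fun x => (p.1, p.2 + d x)) (by fun_prop)).aestronglyMeasurable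
  have hF' : Measurable fun x => fderiv ℂ F (p₀.1, p₀.2 + d x) :=
    (measurable_fderiv ℂ F).comp (by fun_prop)
  have hder : ∀ (x : ℝ) (p : ℂ × ℂ), HasFDerivAt (fun p : ℂ × ℂ => κ x * F (p.1, p.2 + d x))
      (κ x • fderiv ℂ F (p.1, p.2 + d x)) p := by
    intro x p
    have h1 : HasFDerivAt (fun p : ℂ × ℂ => (p.1, p.2 + d x)) (ContinuousLinearMap.id ℂ (ℂ × ℂ)) p := by
      have := (hasFDerivAt_id (𝕜 := ℂ) p).add_const ((0 : ℂ), d x)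
      refine this.congr_of_eventuallyEq (Filter.Eventually.of_forall fun q => ?_)
      ext <;> simp
    have h2 := (hF (p.1, p.2 + d x)).hasFDerivAt.comp p h1
    simpa using h2.const_mul (κ x)
  refine (hasFDerivAt_integral_of_dominated_of_fderiv_le (bound := B)
    (Metric.ball_mem_nhds p₀ one_pos) (Filter.Eventually.of_forall hmeas) ?_ ?_ ?_ hBi
    (Filter.Eventually.of_forall fun x p _ => hder x p)).differentiableAt
  · exact hBi.mono' (hmeas p₀) (hB.mono fun x h => h p₀ (Metric.mem_ball_self two_pos))
  · exact hκ.smul hF'.aestronglyMeasurable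
  · refine hB.mono fun x hx p hp => ?_
    have hB0 : 0 ≤ B x := (norm_nonneg _).trans (hx p₀ (Metric.mem_ball_self two_pos))
    refine ContinuousLinearMap.opNorm_le_bound _ hB0 fun v => ?_
    rcases eq_or_ne v 0 with rfl | hv
    · simp
    have hv' : 0 < ‖v‖ := norm_pos_iff.mpr hv
    -- Cauchy's estimate along the complex line `p + t v`: on the circle `|t| = 1/‖v‖` the point
    -- moves by at most `1`, so it stays in the ball of radius `2` where the majorant `B` is valid.
    -- Thus `B` dominates the derivative as well.
    have hline : ∀ t : ℂ, HasDerivAt (fun t : ℂ => p + t • v) v t := fun t => by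
      simpa using ((hasDerivAt_id t).smul_const v).const_add p
    have hd1 : ∀ t : ℂ, DifferentiableAt ℂ
        (fun t : ℂ => κ x * F ((p + t • v).1, (p + t • v).2 + d x)) t := fun t =>
      (HasFDerivAt.comp_hasDerivAt (l := fun p : ℂ × ℂ => κ x * F (p.1, p.2 + d x)) t
        (hder x (p + t • v)) (hline t)).differentiableAt
    have hd0 : deriv (fun t : ℂ => κ x * F ((p + t • v).1, (p + t • v).2 + d x)) 0 =
        (κ x • fderiv ℂ F (p.1, p.2 + d x)) v := by
      have h := HasFDerivAt.comp_hasDerivAt (l := fun p : ℂ × ℂ => κ x * F (p.1, p.2 + d x)) 0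
        (hder x (p + (0 : ℂ) • v)) (hline 0)
      rw [zero_smul, add_zero] at h
      exact h.deriv
    rw [← hd0]
    have h := norm_deriv_le_of_forall_mem_sphere_norm_le (c := (0 : ℂ)) (R := ‖v‖⁻¹) (C := B x)
      (inv_pos.mpr hv') (Differentiable.diffContOnCl hd1) (fun t ht => hx _ ?_)
    · rwa [div_inv_eq_mul] at h
    · have ht' : ‖t‖ = ‖v‖⁻¹ := by simpa using ht
      have h3 : dist (p + t • v) p ≤ 1 := by
        rw [dist_eq_norm, add_sub_cancel_left, norm_smul, ht', inv_mul_cancel₀ hv'.ne']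
      calc dist (p + t • v) p₀ ≤ dist (p + t • v) p + dist p p₀ := dist_triangle _ _ _
        _ < 1 + 1 := add_lt_add_of_le_of_lt h3 hp
        _ = 2 := by norm_num

/-- Superpositions over a line of translates of a rapidly decaying function. -/
lemma Rapid2.differentiable_integral {F : ℂ × ℂ → ℂ} (hF : Rapid2 F) {κ : ℝ → ℂ}
    (hκ : Continuous κ) {K : ℝ} (hK : ∀ x, ‖κ x‖ ≤ K) (d : ℂ) :
    Differentiable ℂ fun p : ℂ × ℂ => ∫ x : ℝ, κ x * F (p.1, p.2 + (x + d)) := by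
  refine differentiable_integral_translates hF.diff hκ.aestronglyMeasurable
    (d := fun x : ℝ => (x : ℂ) + d) (by fun_prop) fun p₀ => ?_
  set r : ℝ := |p₀.2.re| + |d.re| + 2 with hr
  obtain ⟨C, hC⟩ := hF.bound 1 (|p₀.1.im| + |p₀.2.im| + |d.im| + 2)
  have hC0 : 0 ≤ C := by
    have h := (norm_nonneg _).trans (hC 0 (by simp; positivity) (by simp; positivity))
    simpa using h
  have hK0 : 0 ≤ K := (norm_nonneg _).trans (hK 0)
  refine ⟨fun x => K * (C * Real.exp r) * Real.exp (-|x|), integrable_exp_neg_abs.const_mul _,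
    Filter.Eventually.of_forall fun x p hp => ?_⟩
  have hp' : ‖p - p₀‖ < 2 := by rwa [← dist_eq_norm]
  have h1 : ‖p.1 - p₀.1‖ < 2 := (norm_fst_le (p - p₀)).trans_lt hp'
  have h2 : ‖p.2 - p₀.2‖ < 2 := (norm_snd_le (p - p₀)).trans_lt hp'
  have i1 : |p.1.im - p₀.1.im| < 2 := (abs_im_le_norm (p.1 - p₀.1)).trans_lt h1
  have i2 : |p.2.im - p₀.2.im| < 2 := (abs_im_le_norm (p.2 - p₀.2)).trans_lt h2
  have r2 : |p.2.re - p₀.2.re| < 2 := (abs_re_le_norm (p.2 - p₀.2)).trans_lt h2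
  have h := hC (p.1, p.2 + (x + d)) (by
      have := abs_sub_abs_le_abs_sub p.1.im p₀.1.im
      have := abs_nonneg p₀.2.im
      have := abs_nonneg d.im
      simp only; linarith) (by
      have e : (p.2 + (x + d)).im = (p.2.im - p₀.2.im) + (p₀.2.im + d.im) := by simp; ring
      have := abs_add_le (p.2.im - p₀.2.im) (p₀.2.im + d.im)
      have := abs_add_le p₀.2.im d.im
      have := abs_nonneg p₀.1.im
      simp only [e]; linarith)
  rw [norm_mul]
  simp only [mul_assoc]
  refine mul_le_mul (hK x) (h.trans ?_) (norm_nonneg _) hK0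
  rw [← Real.exp_add]
  refine mul_le_mul_of_nonneg_left (Real.exp_le_exp.mpr ?_) hC0
  have e : x = (p.2 + (x + d)).re - (p.2.re - p₀.2.re) - p₀.2.re - d.re := by simp
  have q1 := abs_sub ((p.2 + (x + d)).re - (p.2.re - p₀.2.re) - p₀.2.re) d.re
  have q2 := abs_sub ((p.2 + (x + d)).re - (p.2.re - p₀.2.re)) p₀.2.re
  have q3 := abs_sub ((p.2 + (x + d)).re) (p.2.re - p₀.2.re)
  rw [← e] at q1
  have := abs_nonneg p.1.re
  simp only
  linarith

/-- Contour shift for functions holomorphic in a strip up to countably many points. -/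
lemma integral_line_eq_of_bound {g : ℂ → ℂ} {η₁ η₂ C : ℝ} (s : Set ℂ) (hs : s.Countable)
    (hc : ContinuousOn g (im ⁻¹' Set.uIcc η₁ η₂))
    (hd : ∀ z, z.im ∈ Set.Ioo (min η₁ η₂) (max η₁ η₂) → z ∉ s → DifferentiableAt ℂ g z)
    (hb : ∀ z, z.im ∈ Set.uIcc η₁ η₂ → ‖g z‖ ≤ C * (1 + z.re ^ 2)⁻¹) :
    ∫ x : ℝ, g (x + η₁ * I) = ∫ x : ℝ, g (x + η₂ * I) := by
  have hint : ∀ η ∈ Set.uIcc η₁ η₂, Integrable fun x : ℝ => g (x + η * I) := by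
    intro η hη
    refine (integrable_inv_one_add_sq.const_mul C).mono' ?_ (Filter.Eventually.of_forall fun x => ?_)
    · refine (hc.comp_continuous (f := fun x : ℝ => (x + η * I : ℂ)) (by fun_prop)
        fun x => ?_).aestronglyMeasurable
      simpa using hη
    · simpa using hb (x + η * I) (by simpa using hη)
  have h1 := intervalIntegral_tendsto_integral (hint η₁ Set.left_mem_uIcc)
    Filter.tendsto_neg_atTop_atBot Filter.tendsto_id
  have h2 := intervalIntegral_tendsto_integral (hint η₂ Set.right_mem_uIcc)
    Filter.tendsto_neg_atTop_atBot Filter.tendsto_id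
  -- The vertical sides `Re z = ±T` of the rectangle are treated together through the sign `σ`; both
  -- contributions are `O(T⁻²)`.
  have hv : ∀ σ : ℝ, σ ^ 2 = 1 → Filter.Tendsto (fun T : ℝ => ∫ y in η₁..η₂, g ((σ * T : ℝ) + y * I))
      Filter.atTop (𝓝 0) := by
    intro σ hσ
    have hlim : Filter.Tendsto (fun T : ℝ => C * (1 + T ^ 2)⁻¹ * |η₂ - η₁|) Filter.atTop (𝓝 0) := by
      have h3 : Filter.Tendsto (fun T : ℝ => 1 + T ^ 2) Filter.atTop Filter.atTop :=
        Filter.tendsto_atTop_add_const_left _ _ (Filter.tendsto_pow_atTop two_ne_zero)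
      simpa using ((h3.inv_tendsto_atTop.const_mul C).mul_const |η₂ - η₁|)
    refine squeeze_zero_norm (fun T => ?_) hlim
    refine intervalIntegral.norm_integral_le_of_norm_le_const fun y hy => ?_
    have := hb ((σ * T : ℝ) + y * I) (by simpa using Set.uIoc_subset_uIcc hy)
    simpa [mul_pow, hσ] using this
  have hrect : ∀ T : ℝ, (∫ x in (-T)..T, g (x + η₁ * I)) - (∫ x in (-T)..T, g (x + η₂ * I)) +
      I * (∫ y in η₁..η₂, g (((1 : ℝ) * T : ℝ) + y * I)) -
      I * (∫ y in η₁..η₂, g (((-1 : ℝ) * T : ℝ) + y * I)) = 0 := by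
    intro T
    have := integral_boundary_rect_eq_zero_of_differentiable_on_off_countable g
      (-T + η₁ * I) (T + η₂ * I) s hs (hc.mono fun z hz => by
        have := hz.2; simpa using this)
      (fun z hz => hd z (by have := hz.1.2; simpa using this) hz.2)
    simpa using this
  have hlim := ((h1.sub h2).add ((hv 1 (by norm_num)).const_mul I)).sub
    ((hv (-1) (by norm_num)).const_mul I)
  have h0 : (fun T : ℝ => (∫ x in (-T)..T, g (x + η₁ * I)) - (∫ x in (-T)..T, g (x + η₂ * I)) +
      I * (∫ y in η₁..η₂, g (((1 : ℝ) * T : ℝ) + y * I)) -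
      I * (∫ y in η₁..η₂, g (((-1 : ℝ) * T : ℝ) + y * I))) = fun _ => 0 := funext hrect
  have h3 := tendsto_nhds_unique hlim (by simp only [id]; rw [h0]; exact tendsto_const_nhds)
  simpa [sub_eq_zero] using h3

/-- The imaginary part of `d` is removed by Cauchy's theorem, the real part by translation
invariance of Lebesgue measure. -/
lemma Rapid1.integral_shift {g : ℂ → ℂ} (hg : Rapid1 g) (d : ℂ) :
    ∫ x : ℝ, g (x + d) = ∫ x : ℝ, g x := by
  obtain ⟨C, hC⟩ := hg.bound 1 |d.im|
  have hC0 : 0 ≤ C := by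
    have h := (norm_nonneg _).trans (hC 0 (by simp))
    simpa using h
  have h := integral_line_eq_of_bound (g := g) (η₁ := d.im) (η₂ := 0) (C := C * 2) ∅
    Set.countable_empty hg.diff.continuous.continuousOn (fun z _ _ => hg.diff z) (fun z hz => by
      have hz' : |z.im| ≤ |d.im| := by
        rcases Set.mem_uIcc.mp hz with h | h
        · rw [abs_of_nonpos h.2, abs_of_nonpos (h.1.trans h.2)]; linarith [h.1]
        · rw [abs_of_nonneg h.1, abs_of_nonneg (h.1.trans h.2)]; linarith [h.2]
      refine (hC z hz').trans ?_
      rw [mul_assoc]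
      refine mul_le_mul_of_nonneg_left ?_ hC0
      simpa using exp_neg_abs_le z.re)
  simp only [ofReal_zero, zero_mul, add_zero] at h
  rw [← h, ← integral_add_right_eq_self (fun x : ℝ => g (x + d.im * I)) d.re]
  refine integral_congr_ae (Filter.Eventually.of_forall fun x => ?_)
  simp only [ofReal_add]
  congr 1
  conv_lhs => rw [← re_add_im d]
  ring

/-! ### The difference equation in the imaginary direction -/

/-- The kernel `1 / (1 + e^{2πx/β})`. -/
def fermi (β x : ℝ) : ℝ := (1 + Real.exp (2 * Real.pi / β * x))⁻¹

lemma fermi_pos (β x : ℝ) : 0 < fermi β x := by unfold fermi; positivity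

lemma fermi_le_one (β x : ℝ) : fermi β x ≤ 1 :=
  inv_le_one_of_one_le₀ (by linarith [Real.exp_pos (2 * Real.pi / β * x)])

lemma continuous_fermi (β : ℝ) : Continuous (fermi β) :=
  Continuous.inv₀ (by fun_prop) fun x => by positivity

lemma norm_fermi_le (β x : ℝ) : ‖(fermi β x : ℂ)‖ ≤ 1 := by
  rw [norm_real, Real.norm_of_nonneg (fermi_pos β x).le]
  exact fermi_le_one β x

/-- The zeros of `1 - e^{2πz/β}` are the points `inβ`, and only the origin lies in the open strip of
half-width `β`. -/
lemma exp_two_pi_div_ne_one {β : ℝ} (hβ : 0 < β) {z : ℂ} (hz : z ≠ 0) (him : |z.im| < β) :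
    1 - exp (2 * Real.pi / β * z) ≠ 0 := by
  intro h
  obtain ⟨n, hn⟩ := exp_eq_one_iff.mp (sub_eq_zero.mp h).symm
  have hπ : (Real.pi : ℂ) ≠ 0 := by exact_mod_cast Real.pi_ne_zero
  have hβ' : (β : ℂ) ≠ 0 := by exact_mod_cast hβ.ne'
  have hz' : z = n * β * I := by
    field_simp at hn
    linear_combination hn
  have h2 : |(n : ℝ)| * β < 1 * β := by
    have : z.im = n * β := by rw [hz']; simp
    rw [this, abs_mul, abs_of_pos hβ] at him
    linarith
  have h3 : |(n : ℝ)| < 1 := lt_of_mul_lt_mul_right h2 hβ.le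
  have h4 : |n| < 1 := by exact_mod_cast h3
  have h5 : n = 0 := Int.abs_lt_one_iff.mp h4
  exact hz (by rw [hz', h5]; simp)

/-- On both lines `Im z = ±β/2` one has `e^{2πz/β} = -e^{2πx/β}`, so `fermi` is the restriction of
`1 / (1 - e^{2πz/β})` to either of them. The only pole between the lines is simple, at the origin,
and the zero of `F` cancels it; Cauchy's theorem then equates the two integrals. -/
lemma integral_fermi_of_zero {β C : ℝ} (hβ : 0 < β) {F : ℂ → ℂ} (h0 : F 0 = 0)
    (hF : ∀ z : ℂ, |z.im| < β → DifferentiableAt ℂ F z)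
    (hb : ∀ z : ℂ, |z.im| ≤ β / 2 → ‖F z‖ ≤ C * (1 + z.re ^ 2)⁻¹) :
    ∫ x : ℝ, fermi β x * F (x + (β / 2 : ℝ) * I) =
      ∫ x : ℝ, fermi β x * F (x + (-(β / 2) : ℝ) * I) := by
  set D : ℂ → ℂ := fun z => 1 - exp (2 * Real.pi / β * z) with hD
  have hDd : Differentiable ℂ D := by fun_prop
  have hD0 : D 0 = 0 := by simp [hD]
  -- The quotient of slopes is `F / D` with the removable singularity filled in. Continuity at `0`
  -- suffices, because the contour shift tolerates a countable exceptional set.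
  set G : ℂ → ℂ := fun z => dslope F 0 z / dslope D 0 z with hG
  have hπ : (Real.pi : ℂ) ≠ 0 := by exact_mod_cast Real.pi_ne_zero
  have hβ' : (β : ℂ) ≠ 0 := by exact_mod_cast hβ.ne'
  have hGz : ∀ z, z ≠ 0 → G z = F z / D z := by
    intro z hz
    simp only [hG, dslope_of_ne _ hz, slope_def_field, h0, hD0, sub_zero]
    rw [div_div_div_cancel_right₀ hz]
  have hne : ∀ z : ℂ, |z.im| < β → dslope D 0 z ≠ 0 := by
    intro z hz
    rcases eq_or_ne z 0 with rfl | hz0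
    · rw [dslope_same]
      have : HasDerivAt D (-(2 * Real.pi / β)) 0 := by
        have h := (((hasDerivAt_id (0 : ℂ)).const_mul (2 * Real.pi / β : ℂ)).cexp).const_sub 1
        simpa using h
      rw [this.deriv]
      exact neg_ne_zero.mpr (div_ne_zero (mul_ne_zero two_ne_zero hπ) hβ')
    · rw [dslope_of_ne _ hz0, slope_def_field, hD0, sub_zero, sub_zero]
      exact div_ne_zero (exp_two_pi_div_ne_one hβ hz0 hz) hz0
  have hcont : ∀ z : ℂ, |z.im| < β → ContinuousAt G z := by
    intro z hz
    refine ContinuousAt.div ?_ ?_ (hne z hz)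
    · rcases eq_or_ne z 0 with rfl | hz0
      · exact continuousAt_dslope_same.mpr (hF 0 (by simpa using hβ))
      · exact (continuousAt_dslope_of_ne hz0).mpr (hF z hz).continuousAt
    · rcases eq_or_ne z 0 with rfl | hz0
      · exact continuousAt_dslope_same.mpr (hDd 0)
      · exact (continuousAt_dslope_of_ne hz0).mpr (hDd z).continuousAt
  have hconv : ∀ z : ℂ, z.im ∈ Set.uIcc (β / 2) (-(β / 2)) ↔ |z.im| ≤ β / 2 := by
    intro z
    rw [Set.uIcc_of_ge (by linarith), Set.mem_Icc, abs_le]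
  -- uniform bound in the strip
  obtain ⟨M, hM⟩ : ∃ M : ℝ, ∀ z : ℂ, |z.re| ≤ 1 → |z.im| ≤ β / 2 → ‖G z‖ ≤ M := by
    have hK : IsCompact (Set.Icc (-1 : ℝ) 1 ×ℂ Set.Icc (-(β / 2)) (β / 2)) :=
      isCompact_Icc.reProdIm isCompact_Icc
    obtain ⟨M, hM⟩ := hK.exists_bound_of_continuousOn (f := G) fun z hz =>
      (hcont z (lt_of_le_of_lt (abs_le.mpr hz.2) (by linarith))).continuousWithinAt
    exact ⟨M, fun z h1 h2 => hM z ⟨abs_le.mp h1, abs_le.mp h2⟩⟩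
  -- With `p = 2π/β`, this bounds `|D|` from below for `|Re z| ≥ 1`: on the left directly, on the
  -- right because `e^p - 1 ≥ 1 - e^{-p}`.
  set m : ℝ := 1 - Real.exp (-(2 * Real.pi / β)) with hm
  have hm0 : 0 < m := by
    have : Real.exp (-(2 * Real.pi / β)) < 1 := by
      rw [← Real.exp_zero]
      exact Real.exp_lt_exp.mpr (neg_lt_zero.mpr (by positivity))
    linarith
  have hDm : ∀ z : ℂ, 1 ≤ |z.re| → m ≤ ‖D z‖ := by
    intro z hz
    have hn : ‖exp (2 * Real.pi / β * z)‖ = Real.exp (2 * Real.pi / β * z.re) := by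
      rw [norm_exp]
      congr 1
      rw [show (2 * Real.pi / β * z : ℂ) = ((2 * Real.pi / β : ℝ) : ℂ) * z by push_cast; ring,
        re_ofReal_mul]
    have hp : 0 < 2 * Real.pi / β := by positivity
    rcases le_abs.mp hz with h | h
    · have h1 : Real.exp (2 * Real.pi / β) ≤ Real.exp (2 * Real.pi / β * z.re) :=
        Real.exp_le_exp.mpr (by nlinarith)
      have h2 := norm_sub_norm_le (exp (2 * Real.pi / β * z)) 1
      rw [hn, norm_one, norm_sub_rev] at h2
      have h3 : 2 ≤ Real.exp (2 * Real.pi / β) + Real.exp (-(2 * Real.pi / β)) := by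
        have := Real.one_le_cosh (2 * Real.pi / β)
        rw [Real.cosh_eq] at this
        linarith
      simp only [hD, hm]
      linarith
    · have h1 : Real.exp (2 * Real.pi / β * z.re) ≤ Real.exp (-(2 * Real.pi / β)) :=
        Real.exp_le_exp.mpr (by nlinarith)
      have h2 := norm_sub_norm_le 1 (exp (2 * Real.pi / β * z))
      rw [hn, norm_one] at h2
      simp only [hD, hm]
      linarith
  have hM0 : 0 ≤ M := (norm_nonneg _).trans (hM 0 (by simp) (by simp; linarith))
  have hC0 : 0 ≤ C := by
    have := (norm_nonneg _).trans (hb 0 (by simp; linarith))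
    simpa using this
  -- The summand `C / m` handles `|Re z| ≥ 1`; the summand `M * 2` handles `|Re z| ≤ 1`, where `1 ≤
  -- 2 (1 + x²)⁻¹`.
  have key := integral_line_eq_of_bound (g := G) (η₁ := β / 2) (η₂ := -(β / 2))
    (C := C / m + M * 2) {0} (Set.countable_singleton 0)
    (fun z hz => (hcont z (lt_of_le_of_lt ((hconv z).mp hz) (by linarith))).continuousWithinAt)
    (fun z hz hz0 => by
      have hz' : |z.im| < β := by
        rw [min_eq_right (by linarith), max_eq_left (by linarith)] at hz
        exact abs_lt.mpr ⟨by linarith [hz.1], by linarith [hz.2]⟩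
      have hz0' : z ≠ 0 := hz0
      have : G =ᶠ[𝓝 z] fun z => F z / D z := by
        filter_upwards [isOpen_ne.mem_nhds hz0'] with y hy using hGz y hy
      exact ((hF z hz').div (hDd z) (exp_two_pi_div_ne_one hβ hz0' hz')).congr_of_eventuallyEq this)
    (fun z hz => by
      have hz' := (hconv z).mp hz
      rcases le_total 1 |z.re| with h | h
      · have hz0 : z ≠ 0 := by
          rintro rfl; simp at h; linarith
        rw [hGz z hz0, norm_div, add_mul]
        have h1 : ‖F z‖ / ‖D z‖ ≤ C / m * (1 + z.re ^ 2)⁻¹ := by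
          rw [div_mul_eq_mul_div]
          exact div_le_div₀ (by positivity) (hb z hz') hm0 (hDm z h)
        have h2 : 0 ≤ M * 2 * (1 + z.re ^ 2)⁻¹ := by positivity
        linarith
      · have h1 : z.re ^ 2 ≤ 1 := by rw [← sq_abs]; exact pow_le_one₀ (abs_nonneg _) h
        have h2 : 1 ≤ 2 * (1 + z.re ^ 2)⁻¹ := by
          rw [← div_eq_mul_inv, one_le_div (by positivity)]; linarith
        have h3 : 0 ≤ C / m * (1 + z.re ^ 2)⁻¹ := by positivity
        have h4 := mul_le_mul_of_nonneg_left h2 hM0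
        have h5 := hM z h hz'
        linarith)
  have hval : ∀ (x σ : ℝ), σ ^ 2 = 1 → G (x + (σ * (β / 2) : ℝ) * I) =
      fermi β x * F (x + (σ * (β / 2) : ℝ) * I) := by
    intro x σ hσ
    have hz0 : (x + (σ * (β / 2) : ℝ) * I : ℂ) ≠ 0 := by
      intro h
      have := congrArg im h
      simp at this
      rcases this with h | h
      · rw [h] at hσ; norm_num at hσ
      · exact hβ.ne' h
    rw [hGz _ hz0, div_eq_mul_inv, mul_comm]
    congr 1
    have he : exp (2 * Real.pi / β * (x + (σ * (β / 2) : ℝ) * I)) =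
        -(Real.exp (2 * Real.pi / β * x) : ℝ) := by
      have e1 : (2 * Real.pi / β * (x + (σ * (β / 2) : ℝ) * I) : ℂ) =
          (2 * Real.pi / β * x : ℝ) + σ * (Real.pi * I) := by
        push_cast; field_simp
      rw [e1, exp_add, ofReal_exp]
      rcases mul_self_eq_one_iff.mp ((sq σ).symm.trans hσ) with h | h
      · rw [h]; simp [exp_pi_mul_I]
      · rw [h]; simp [exp_neg, exp_pi_mul_I]
    simp only [hD, he, fermi]
    push_cast
    ring
  have h1 : ∀ x : ℝ, G (x + (β / 2 : ℝ) * I) = fermi β x * F (x + (β / 2 : ℝ) * I) := fun x => by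
    simpa using hval x 1 (by norm_num)
  have h2 : ∀ x : ℝ, G (x + (-(β / 2) : ℝ) * I) = fermi β x * F (x + (-(β / 2) : ℝ) * I) :=
    fun x => by simpa using hval x (-1) (by norm_num)
  simpa only [h1, h2] using key

/-- The function `β² / (z² + β²)`, normalised to `1` at the origin. -/
def lorentzFn (β : ℝ) (z : ℂ) : ℂ := β ^ 2 / (z ^ 2 + β ^ 2)

/-- The residue constant of the kernel `fermi`. -/
def fermiConst (β : ℝ) : ℂ :=
  ∫ x : ℝ, fermi β x * (lorentzFn β (x + (β / 2 : ℝ) * I) - lorentzFn β (x + (-(β / 2) : ℝ) * I))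

lemma lorentzFn_re_le {β : ℝ} {z : ℂ} :
    z.re ^ 2 - z.im ^ 2 + β ^ 2 ≤ ‖z ^ 2 + β ^ 2‖ := by
  refine le_trans (le_of_eq ?_) (re_le_norm _)
  rw [← ofReal_pow, add_re, ofReal_re, sq z, mul_re]
  ring

lemma lorentzFn_denom_ne_zero {β : ℝ} {z : ℂ} (hz : |z.im| < β) :
    z ^ 2 + (β : ℂ) ^ 2 ≠ 0 := by
  rw [← norm_pos_iff]
  refine lt_of_lt_of_le ?_ lorentzFn_re_le
  have : z.im ^ 2 < β ^ 2 := by rw [← sq_abs]; exact pow_lt_pow_left₀ hz (abs_nonneg _) two_ne_zero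
  nlinarith [sq_nonneg z.re]

lemma norm_lorentzFn_le {β : ℝ} (hβ : 0 < β) {z : ℂ} (hz : |z.im| ≤ β / 2) :
    ‖lorentzFn β z‖ ≤ (β ^ 2 + 2) * (1 + z.re ^ 2)⁻¹ := by
  have h := lorentzFn_re_le (β := β) (z := z)
  have h2 : z.im ^ 2 ≤ (β / 2) ^ 2 := by rw [← sq_abs]; exact pow_le_pow_left₀ (abs_nonneg _) hz 2
  have h3 : 0 < ‖z ^ 2 + (β : ℂ) ^ 2‖ := by nlinarith [sq_nonneg z.re, sq_pos_of_pos hβ]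
  rw [lorentzFn, norm_div, ← div_eq_mul_inv, div_le_div_iff₀ h3 (by positivity), norm_pow, norm_real,
    Real.norm_eq_abs, sq_abs]
  have h4 : (β ^ 2 + 2) * (z.re ^ 2 - z.im ^ 2 + β ^ 2) ≤ (β ^ 2 + 2) * ‖z ^ 2 + (β : ℂ) ^ 2‖ :=
    mul_le_mul_of_nonneg_left h (by positivity)
  nlinarith [sq_nonneg z.re, sq_nonneg β, sq_nonneg (β ^ 2)]

lemma exp_le_of_Rapid1 {φ : ℂ → ℂ} (hφ : Rapid1 φ) (R : ℝ) (hR : 0 ≤ R) :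
    ∃ C : ℝ, 0 ≤ C ∧ ∀ z : ℂ, |z.im| ≤ R → ‖φ z‖ ≤ C * (1 + z.re ^ 2)⁻¹ := by
  obtain ⟨C, hC⟩ := hφ.bound 1 R
  have hC0 : 0 ≤ C := by
    have h := (norm_nonneg _).trans (hC 0 (by simpa using hR))
    simpa using h
  refine ⟨C * 2, by positivity, fun z hz => (hC z hz).trans ?_⟩
  rw [mul_assoc]
  refine mul_le_mul_of_nonneg_left ?_ hC0
  simpa using exp_neg_abs_le z.re

lemma integrable_fermi_mul {β : ℝ} {g : ℝ → ℂ} (hg : Integrable g) :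
    Integrable fun x => (fermi β x : ℂ) * g x :=
  hg.bdd_mul (c := 1) (continuous_ofReal.comp (continuous_fermi β)).aestronglyMeasurable
    (Filter.Eventually.of_forall (norm_fermi_le β))

lemma integrable_lorentzFn {β : ℝ} (hβ : 0 < β) {η : ℝ} (hη : |η| ≤ β / 2) :
    Integrable fun x : ℝ => lorentzFn β (x + η * I) := by
  refine (integrable_inv_one_add_sq.const_mul (β ^ 2 + 2)).mono' ?_
    (Filter.Eventually.of_forall fun x => ?_)
  · refine Continuous.aestronglyMeasurable ?_
    unfold lorentzFn
    refine Continuous.div (by fun_prop) (by fun_prop) fun x => lorentzFn_denom_ne_zero ?_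
    simpa using lt_of_le_of_lt hη (by linarith)
  · simpa using norm_lorentzFn_le hβ (z := x + η * I) (by simpa using hη)

lemma differentiableAt_lorentzFn {β : ℝ} {z : ℂ} (hz : |z.im| < β) :
    DifferentiableAt ℂ (lorentzFn β) z := by
  unfold lorentzFn
  exact DifferentiableAt.div (by fun_prop) (by fun_prop) (lorentzFn_denom_ne_zero hz)

lemma lorentzFn_zero {β : ℝ} (hβ : 0 < β) : lorentzFn β 0 = 1 := by
  have hβ' : (β : ℂ) ≠ 0 := by exact_mod_cast hβ.ne'
  simp [lorentzFn, hβ']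

/-- The residue formula for the kernel `fermi`. -/
lemma integral_fermi_sub {β : ℝ} (hβ : 0 < β) {φ : ℂ → ℂ} (hφ : Rapid1 φ) :
    ∫ x : ℝ, fermi β x * (φ (x + (β / 2 : ℝ) * I) - φ (x + (-(β / 2) : ℝ) * I)) =
      fermiConst β * φ 0 := by
  obtain ⟨C, hC0, hC⟩ := exp_le_of_Rapid1 hφ (β / 2) (by positivity)
  -- Subtracting `φ 0 * lorentzFn β` creates the required zero at the origin. The poles `±iβ` of
  -- `lorentzFn` lie outside the open strip where holomorphy is needed.
  have h1 := integral_fermi_of_zero (C := C + ‖φ 0‖ * (β ^ 2 + 2)) hβ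
    (F := fun z => φ z - φ 0 * lorentzFn β z)
    (by rw [lorentzFn_zero hβ, mul_one, sub_self])
    (fun z hz => (hφ.diff z).sub ((differentiableAt_lorentzFn hz).const_mul _))
    (fun z hz => by
      refine (norm_sub_le _ _).trans ?_
      rw [norm_mul, add_mul, mul_assoc]
      exact add_le_add (hC z hz) (mul_le_mul_of_nonneg_left (norm_lorentzFn_le hβ hz)
        (norm_nonneg _)))
  have hp : |β / 2| ≤ β / 2 := (abs_of_pos (by positivity)).le
  have hn : |-(β / 2)| ≤ β / 2 := by rw [abs_neg]; exact hp
  have i1 := fun η : ℝ => integrable_fermi_mul (β := β) (hφ.integrable (η * I))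
  have i2 := fun (η : ℝ) (hη : |η| ≤ β / 2) =>
    (integrable_fermi_mul (β := β) (integrable_lorentzFn hβ hη)).const_mul (φ 0)
  have e : ∀ η : ℝ, |η| ≤ β / 2 → ∫ x : ℝ, (fermi β x : ℂ) * (φ (x + η * I) - φ 0 * lorentzFn β (x + η * I))
      = (∫ x : ℝ, fermi β x * φ (x + η * I)) - φ 0 * ∫ x : ℝ, fermi β x * lorentzFn β (x + η * I) := by
    intro η hη
    rw [← integral_const_mul, ← integral_sub (i1 η) (i2 η hη)]
    congr 1
    funext x
    ring
  rw [e _ hp, e _ hn] at h1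
  rw [fermiConst]
  simp only [mul_sub]
  have e1 := integral_sub (i1 (β / 2)) (i1 (-(β / 2)))
  have e2 := integral_sub (integrable_fermi_mul (β := β) (integrable_lorentzFn hβ hp))
    (integrable_fermi_mul (β := β) (integrable_lorentzFn hβ hn))
  rw [e1, e2]
  linear_combination h1

/-- Positivity replaces the evaluation of the residue. The difference of the two Lorentz functions
is `-2iβ³ x / n(x)`, odd in `x`; averaging the integrand over `x` and `-x` brings in `fermi β x -
fermi β (-x)`, whose sign is opposite to that of `x`. The real factor therefore has a strictly
negative integral. -/
lemma fermiConst_ne_zero {β : ℝ} (hβ : 0 < β) : fermiConst β ≠ 0 := by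
  -- The product of the two denominators `(x ± iβ/2)² + β²`.
  set n : ℝ → ℝ := fun x => (x ^ 2 + 3 / 4 * β ^ 2) ^ 2 + β ^ 2 * x ^ 2 with hn
  have hn0 : ∀ x, 0 < n x := fun x => by simp only [hn]; positivity
  have hn' : ∀ x, n (-x) = n x := fun x => by simp [hn]
  set r : ℝ → ℝ := fun x => fermi β x * (x / n x) with hr
  have hrc : Continuous r := (continuous_fermi β).mul
    (continuous_id.div (by fun_prop) fun x => (hn0 x).ne')
  have e : ∀ x : ℝ, fermi β x * (lorentzFn β (x + (β / 2 : ℝ) * I) -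
      lorentzFn β (x + (-(β / 2) : ℝ) * I)) = (-2 * I * β ^ 3) * (r x : ℂ) := by
    intro x
    have h1 := lorentzFn_denom_ne_zero (β := β) (z := x + (β / 2 : ℝ) * I)
      (by
        simp only [add_im, ofReal_im, mul_im, ofReal_re, I_im, I_re, mul_one, mul_zero, add_zero,
          zero_add]
        rw [abs_of_pos (half_pos hβ)]
        exact half_lt_self hβ)
    have h2 := lorentzFn_denom_ne_zero (β := β) (z := x + (-(β / 2) : ℝ) * I)
      (by
        simp only [add_im, ofReal_im, mul_im, ofReal_re, I_im, I_re, mul_one, mul_zero, add_zero,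
          zero_add, abs_neg]
        rw [abs_of_pos (half_pos hβ)]
        exact half_lt_self hβ)
    have h3 : (n x : ℂ) = ((x + (β / 2 : ℝ) * I) ^ 2 + β ^ 2) * ((x + (-(β / 2) : ℝ) * I) ^ 2 + β ^ 2) := by
      simp only [hn]
      push_cast
      linear_combination (-(β ^ 4 : ℂ) / 2 + (x : ℂ) ^ 2 * β ^ 2 / 2 - β ^ 4 / 16 * (I ^ 2 - 1)) * I_sq
    simp only [hr, lorentzFn]
    rw [div_sub_div _ _ h1 h2, ← h3]
    push_cast
    ring
  have hint : Integrable r := by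
    have h := ((integrable_fermi_mul (β := β) (integrable_lorentzFn hβ (η := β / 2)
      (abs_of_pos (by positivity)).le)).sub (integrable_fermi_mul (β := β)
      (integrable_lorentzFn hβ (η := -(β / 2)) (by rw [abs_neg, abs_of_pos (by positivity)]))))
    have h2 : Integrable fun x : ℝ => (-2 * I * β ^ 3) * (r x : ℂ) := by
      refine h.congr (Filter.Eventually.of_forall fun x => ?_)
      simp only [← e, mul_sub, Pi.sub_apply]
    have h3 := h2.const_mul (-2 * I * (β : ℂ) ^ 3)⁻¹
    have hc : (-2 * I * (β : ℂ) ^ 3) ≠ 0 := by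
      have : (β : ℂ) ≠ 0 := by exact_mod_cast hβ.ne'
      simp [this]
    simp only [← mul_assoc, inv_mul_cancel₀ hc, one_mul] at h3
    simpa using h3.re
  have hneg : ∫ x, -(r x + r (-x)) ≠ 0 := by
    have hs : ∀ x, -(r x + r (-x)) = fermi β x * fermi β (-x) *
        ((x / n x) * (Real.exp (2 * Real.pi / β * x) - Real.exp (-(2 * Real.pi / β * x)))) := by
      intro x
      simp only [hr, hn', fermi, mul_neg]
      have := Real.exp_pos (2 * Real.pi / β * x)
      have := Real.exp_pos (-(2 * Real.pi / β * x))
      have := hn0 x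
      field_simp
      ring
    have hnn : ∀ x, 0 ≤ -(r x + r (-x)) := by
      intro x
      rw [hs]
      refine mul_nonneg (mul_nonneg (fermi_pos _ _).le (fermi_pos _ _).le) ?_
      have hp : 0 < 2 * Real.pi / β := by positivity
      rcases le_total 0 x with h | h
      · exact mul_nonneg (div_nonneg h (hn0 x).le) (sub_nonneg.mpr (Real.exp_le_exp.mpr (by nlinarith)))
      · exact mul_nonneg_of_nonpos_of_nonpos (div_nonpos_of_nonpos_of_nonneg h (hn0 x).le)
          (sub_nonpos.mpr (Real.exp_le_exp.mpr (by nlinarith)))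
    intro h0
    have hi : Integrable fun x => -(r x + r (-x)) := (hint.add hint.comp_neg).neg
    rw [integral_eq_zero_iff_of_nonneg hnn hi] at h0
    have hc : Continuous fun x => -(r x + r (-x)) := by fun_prop
    have h1 := congrFun ((Continuous.ae_eq_iff_eq volume hc continuous_const).mp h0) 1
    rw [hs] at h1
    have h2 : Real.exp (-(2 * Real.pi / β * 1)) < Real.exp (2 * Real.pi / β * 1) :=
      Real.exp_lt_exp.mpr (by have : 0 < 2 * Real.pi / β := by positivity
                              linarith)
    have h3 : 0 < fermi β 1 * fermi β (-1) *
        ((1 / n 1) * (Real.exp (2 * Real.pi / β * 1) - Real.exp (-(2 * Real.pi / β * 1)))) :=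
      mul_pos (mul_pos (fermi_pos _ _) (fermi_pos _ _))
        (mul_pos (div_pos one_pos (hn0 1)) (sub_pos.mpr h2))
    exact h3.ne' h1
  rw [fermiConst]
  simp only [e]
  rw [integral_const_mul, integral_complex_ofReal]
  refine mul_ne_zero ?_ fun h => hneg ?_
  · have : (β : ℂ) ≠ 0 := by exact_mod_cast hβ.ne'
    simp [this]
  · have h' : ∫ x, r x = 0 := by exact_mod_cast h
    rw [integral_neg, integral_add hint hint.comp_neg, integral_neg_eq_self r, h']
    simp

/-! ### Exponential moments and the two-generator difference equation -/

lemma Rapid2.mul_exp_right {F : ℂ × ℂ → ℂ} (hF : Rapid2 F) (c : ℂ) :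
    Rapid2 fun z => exp (c * z.2) * F z := by
  simpa using hF.mul_mild (Mild2.exp_linear 0 c)

lemma Rapid2.nonneg_bound {F : ℂ × ℂ → ℂ} (hF : Rapid2 F) (a R : ℝ) :
    ∃ C : ℝ, 0 ≤ C ∧ ∀ z : ℂ × ℂ, |z.1.im| ≤ R → |z.2.im| ≤ R →
      ‖F z‖ ≤ C * Real.exp (-a * (|z.1.re| + |z.2.re|)) := by
  obtain ⟨C, hC⟩ := hF.bound a R
  exact ⟨max C 0, le_max_right _ _, fun z h1 h2 => (hC z h1 h2).trans
    (mul_le_mul_of_nonneg_right (le_max_left _ _) (Real.exp_pos _).le)⟩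

/-- The moment `∫ e^{(2πk/β)x} g(x) dx`. -/
def moment (β : ℝ) (k : ℤ) (g : ℂ → ℂ) : ℂ := ∫ x : ℝ, exp (2 * Real.pi / β * k * x) * g x

lemma Rapid1.mul_exp {g : ℂ → ℂ} (hg : Rapid1 g) (c : ℂ) : Rapid1 fun z => exp (c * z) * g z := by
  -- Tensoring with the Gaussian, which equals `1` at the origin, and slicing there reduces the
  -- claim to its two-variable version.
  have h := ((Rapid1.gaussian.tensor hg).mul_exp_right c).slice 0
  simpa using h

/-- For `d = βI` the factor is `e^{-2πik} = 1`: every difference for the shift by `βI` has vanishing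
moments. This is why the moments are the obstructions to solving that difference equation. -/
lemma Rapid1.moment_shift {g : ℂ → ℂ} (hg : Rapid1 g) (β : ℝ) (k : ℤ) (d : ℂ) :
    moment β k (fun z => g (z + d)) = exp (-(2 * Real.pi / β * k * d)) * moment β k g := by
  unfold moment
  rw [← (hg.mul_exp (2 * Real.pi / β * k)).integral_shift d, ← integral_const_mul]
  congr 1
  funext x
  rw [← mul_assoc, ← exp_add]
  congr 2
  ring

/-- Superposition of translates with the kernel `fermi`. -/
def fermiConv (β : ℝ) (F : ℂ × ℂ → ℂ) (z : ℂ × ℂ) : ℂ :=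
  ∫ x : ℝ, fermi β x * F (z.1, z.2 + (x + (-(β / 2) : ℝ) * I))

/-- Since `fermi β x * (1 + e^{2πx/β}) = 1`, the integrals for `J` and `J + 1` add up to a multiple
of a moment, that is, to zero. Hence the kernel `fermi` may be multiplied by any `e^{2πJx/β}` at the
cost of a sign only, which makes decay at any rate and in either direction available. -/
lemma norm_fermiConv_eq {β : ℝ} {F : ℂ × ℂ → ℂ} (hF : Rapid2 F)
    (hm : ∀ w k, moment β k (fun z => F (w, z)) = 0) (z : ℂ × ℂ) (J : ℤ) :
    ‖∫ x : ℝ, (fermi β x : ℂ) * (exp (2 * Real.pi / β * J * x) *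
      F (z.1, z.2 + (x + (-(β / 2) : ℝ) * I)))‖ = ‖fermiConv β F z‖ := by
  set d : ℂ := z.2 + (-(β / 2) : ℝ) * I with hd
  have hg : Rapid1 fun y => F (z.1, y + d) := by simpa using (hF.shift 0 d).slice z.1
  set N : ℤ → ℂ := fun J => ∫ x : ℝ, (fermi β x : ℂ) * (exp (2 * Real.pi / β * J * x) *
      F (z.1, x + d)) with hN
  have hint : ∀ J : ℤ, Integrable fun x : ℝ => (fermi β x : ℂ) * (exp (2 * Real.pi / β * J * x) *
      F (z.1, x + d)) := fun J => integrable_fermi_mul (by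
    simpa using (hg.mul_exp (2 * Real.pi / β * J)).integrable 0)
  have hstep : ∀ J : ℤ, N (J + 1) = -N J := by
    intro J
    rw [← add_eq_zero_iff_eq_neg, hN]
    simp only
    rw [← integral_add (hint _) (hint _)]
    have h0 := (hF.slice z.1).moment_shift β J d
    rw [hm, mul_zero, moment] at h0
    rw [← h0]
    congr 1
    funext x
    have e1 : exp (2 * Real.pi / β * ((J + 1 : ℤ) : ℂ) * x) =
        exp (2 * Real.pi / β * J * x) * (Real.exp (2 * Real.pi / β * x) : ℝ) := by
      rw [ofReal_exp, ← exp_add]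
      push_cast
      congr 1
      ring
    have e2 : (fermi β x : ℂ) * (1 + (Real.exp (2 * Real.pi / β * x) : ℝ)) = 1 := by
      rw [← ofReal_one, ← ofReal_add, ← ofReal_mul, fermi, inv_mul_cancel₀ (by positivity)]
    rw [e1]
    linear_combination (exp (2 * Real.pi / β * J * x) * F (z.1, x + d)) * e2
  have hnorm : ∀ J : ℤ, ‖N J‖ = ‖N 0‖ := by
    intro J
    induction J using Int.induction_on with
    | zero => rfl
    | succ n ih => rw [hstep, norm_neg, ih]
    | pred n ih =>
      have := hstep (-n - 1)
      rw [sub_add_cancel] at this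
      rw [← ih, this, norm_neg]
  have e : ∀ x : ℝ, z.2 + (x + (-(β / 2) : ℝ) * I) = x + d := fun x => by rw [hd]; ring
  simp only [fermiConv, e]
  rw [show (∫ x : ℝ, (fermi β x : ℂ) * (exp (2 * Real.pi / β * J * x) * F (z.1, x + d))) = N J from
    rfl, hnorm J, hN]
  simp

/-- If all exponential moments vanish, the convolution with `fermi` decays rapidly. -/
lemma Rapid2.fermiConv {β : ℝ} (hβ : 0 < β) {F : ℂ × ℂ → ℂ} (hF : Rapid2 F)
    (hm : ∀ w k, moment β k (fun z => F (w, z)) = 0) : Rapid2 (fermiConv β F) := by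
  refine ⟨hF.differentiable_integral (κ := fun x => (fermi β x : ℂ))
    (continuous_ofReal.comp (continuous_fermi β)) (norm_fermi_le β) _, fun a R => ?_⟩
  obtain ⟨n, hn⟩ := exists_nat_ge (|a| * β / (2 * Real.pi))
  set q : ℝ := 2 * Real.pi / β * n with hq
  have hq0 : 0 ≤ q := by positivity
  have haq : |a| ≤ q := by
    rw [div_le_iff₀ (by positivity)] at hn
    rw [hq, div_mul_eq_mul_div, le_div_iff₀ hβ]
    linarith
  -- The rate `q` absorbs the factor `e^{2πJ(x + Re z₂)/β}` and the extra `1` leaves an integrable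
  -- `e^{-|x + Re z₂|}`. The strip grows by `β / 2`, the displacement of the line of integration.
  obtain ⟨C, hC0, hC⟩ := hF.nonneg_bound (q + 1) (R + β / 2)
  refine ⟨C * ∫ x : ℝ, Real.exp (-|x|), fun z h1 h2 => ?_⟩
  -- The sign of `J` follows that of `Re z₂`, so that recentring at `x + Re z₂` produces the factor
  -- `e^{-q |Re z₂|}`.
  obtain ⟨J, hJ⟩ : ∃ J : ℤ, 2 * Real.pi / β * J * z.2.re = q * |z.2.re| ∧
      |2 * Real.pi / β * J| ≤ q := by
    rcases le_total 0 z.2.re with h | h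
    · exact ⟨n, by rw [abs_of_nonneg h, hq]; push_cast; ring, by
        push_cast; rw [abs_of_nonneg hq0]⟩
    · exact ⟨-n, by rw [abs_of_nonpos h, hq]; push_cast; ring, by
        push_cast; rw [mul_neg, abs_neg, abs_of_nonneg hq0]⟩
  rw [← norm_fermiConv_eq hF hm z J, mul_assoc, ← integral_mul_const, ← integral_const_mul,
    ← integral_add_right_eq_self (fun x : ℝ => C * (Real.exp (-|x|) * _)) z.2.re]
  refine norm_integral_le_of_norm_le ((((integrable_exp_neg_abs).mul_const _).const_mul
    C).comp_add_right z.2.re) (Filter.Eventually.of_forall fun x => ?_)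
  have hb := hC (z.1, z.2 + (x + (-(β / 2) : ℝ) * I)) (by simp only; linarith) (by
    have e : (z.2 + (x + (-(β / 2) : ℝ) * I)).im = z.2.im + -(β / 2) := by simp
    simp only [e]
    refine (abs_add_le _ _).trans ?_
    rw [abs_neg, abs_of_pos (half_pos hβ)]
    linarith)
  have hre : (z.2 + (x + (-(β / 2) : ℝ) * I)).re = x + z.2.re := by simp; ring
  simp only [hre] at hb
  have hexp : ‖exp (2 * Real.pi / β * J * x)‖ = Real.exp (2 * Real.pi / β * J * x) := by
    rw [norm_exp]
    congr 1
    have : (2 * Real.pi / β * J * x : ℂ) = ((2 * Real.pi / β * J * x : ℝ) : ℂ) := by push_cast; rfl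
    rw [this, ofReal_re]
  rw [norm_mul, norm_mul, hexp]
  calc _ ≤ 1 * (Real.exp (2 * Real.pi / β * J * x) *
        (C * Real.exp (-(q + 1) * (|z.1.re| + |x + z.2.re|)))) := by
        gcongr
        exact norm_fermi_le β x
    _ = C * Real.exp (2 * Real.pi / β * J * x + -(q + 1) * (|z.1.re| + |x + z.2.re|)) := by
        rw [Real.exp_add]; ring
    _ ≤ C * Real.exp (-|x + z.2.re| + -a * (|z.1.re| + |z.2.re|)) := by
        refine mul_le_mul_of_nonneg_left (Real.exp_le_exp.mpr ?_) hC0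
        have k1 : 2 * Real.pi / β * J * x =
            2 * Real.pi / β * J * (x + z.2.re) - q * |z.2.re| := by rw [← hJ.1]; ring
        have k2 : 2 * Real.pi / β * J * (x + z.2.re) ≤ q * |x + z.2.re| :=
          (le_abs_self _).trans (by rw [abs_mul]; exact mul_le_mul_of_nonneg_right hJ.2 (abs_nonneg _))
        have k3 := le_abs_self a
        have k4 := mul_le_mul_of_nonneg_right (k3.trans haq) (abs_nonneg z.1.re)
        have k5 := mul_le_mul_of_nonneg_right (k3.trans haq) (abs_nonneg z.2.re)
        have k6 := abs_nonneg z.1.re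
        linarith
    _ = _ := by rw [Real.exp_add]

/-- A rapidly decaying function with vanishing exponential moments is a difference. -/
lemma exists_sub_eq_of_moments {β : ℝ} (hβ : 0 < β) {F : ℂ × ℂ → ℂ} (hF : Rapid2 F)
    (hm : ∀ w k, moment β k (fun z => F (w, z)) = 0) :
    ∃ g, Rapid2 g ∧ ∀ w z, F (w, z) = g (w, z + β * I) - g (w, z) := by
  -- `fermiConv` integrates along the line lowered by `β/2`, so its translate by `βI` uses the line
  -- raised by `β/2`. Their difference is the left side of the residue formula, hence the
  -- normalisation.
  refine ⟨fun z => (fermiConst β)⁻¹ * QLorentz.fermiConv β F z,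
    (hF.fermiConv hβ hm).const_mul _, fun w z => ?_⟩
  have hg : Rapid1 fun y => F (w, y + z) := by simpa using (hF.shift 0 z).slice w
  have h := integral_fermi_sub hβ hg
  rw [zero_add] at h
  rw [← mul_sub, eq_inv_mul_iff_mul_eq₀ (fermiConst_ne_zero hβ), ← h]
  simp only [mul_sub, QLorentz.fermiConv]
  rw [integral_sub (integrable_fermi_mul (hg.integrable _)) (integrable_fermi_mul (hg.integrable _))]
  congr 2
  · funext x
    congr 3
    push_cast
    ring
  · funext x
    congr 3
    ring

/-! ### Correction of the moments with nonzero index -/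

/-- Fourier coefficients of the kernel inverting the shift by `ω` on exponential moments. -/
def kerCoeff (β : ℝ) (ω : ℂ) (k : ℤ) : ℂ :=
  (exp (-(2 * Real.pi / β * k * ω)) - 1)⁻¹ * exp (2 * Real.pi / β * k * (-ω.re / 2 : ℝ))

lemma norm_exp_moment (β : ℝ) (k : ℤ) (z : ℂ) :
    ‖exp (2 * Real.pi / β * k * z)‖ = Real.exp (2 * Real.pi / β * k * z.re) := by
  rw [norm_exp]
  congr 1
  rw [show (2 * Real.pi / β * k * z : ℂ) = ((2 * Real.pi / β * k : ℝ) : ℂ) * z by push_cast; ring,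
    re_ofReal_mul]

/-- With `t = 2π Re ω / β < 0`, the inverse factor is of size `e^{kt}` for `k → +∞` but only bounded
for `k → -∞`. The second factor has size `e^{-kt/2}`, so the translation by `-Re ω / 2` splits the
gain evenly and both tails decay like `e^{|k|t/2}`. -/
lemma norm_kerCoeff_le {β : ℝ} (hβ : 0 < β) {ω : ℂ} (hω : ω.re < 0) (n : ℕ) (σ : ℤ)
    (hσ : σ = 1 ∨ σ = -1) :
    ‖kerCoeff β ω (σ * n)‖ ≤ (1 - Real.exp (2 * Real.pi / β * ω.re))⁻¹ *
      Real.exp (Real.pi / β * ω.re) ^ n := by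
  set t : ℝ := 2 * Real.pi / β * ω.re with ht
  have ht0 : t < 0 := mul_neg_of_pos_of_neg (by positivity) hω
  have h1 : Real.exp t < 1 := by rw [← Real.exp_zero]; exact Real.exp_lt_exp.mpr ht0
  have e0 : Real.exp (Real.pi / β * ω.re) ^ n = Real.exp (t / 2 * n) := by
    rw [← Real.exp_nat_mul]; congr 1; rw [ht]; ring
  rw [e0]
  -- For `k = 0` the coefficient is zero, because the inverse of zero is zero; the mean value is
  -- thus deliberately left uncorrected.
  rcases Nat.eq_zero_or_pos n with rfl | hn
  · simp only [kerCoeff, Nat.cast_zero, mul_zero, Int.cast_zero, zero_mul, neg_zero, exp_zero,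
      sub_self, inv_zero, norm_zero, Real.exp_zero, mul_one]
    exact inv_nonneg.mpr (by linarith)
  have hn1 : (1 : ℝ) ≤ n := by exact_mod_cast hn
  have hQ : ‖exp (-(2 * Real.pi / β * (σ * n : ℤ) * ω))‖ = Real.exp (-(σ * n) * t) := by
    have := norm_exp_moment β (-(σ * n)) ω
    rw [show (-(2 * Real.pi / β * (σ * n : ℤ) * ω) : ℂ) =
      2 * Real.pi / β * ((-(σ * n) : ℤ) : ℂ) * ω by push_cast; ring, this, ht]
    congr 1
    push_cast
    ring
  have hn2 : Real.exp (n * t) ≤ Real.exp t := Real.exp_le_exp.mpr (by nlinarith)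
  rw [kerCoeff, norm_mul, norm_inv, norm_exp_moment, ofReal_re]
  have hpos : 0 < 1 - Real.exp t := by linarith
  rcases hσ with rfl | rfl
  · have h2 := norm_sub_norm_le (exp (-(2 * Real.pi / β * (1 * n : ℤ) * ω))) 1
    rw [hQ, norm_one] at h2
    have h3 : (1 - Real.exp t) * Real.exp (-n * t) ≤ Real.exp (-n * t) - 1 := by
      have : Real.exp t * Real.exp (-n * t) ≥ 1 := by
        rw [← Real.exp_add]; exact Real.one_le_exp (by nlinarith)
      linarith
    have h4 : (1 - Real.exp t) * Real.exp (-n * t) ≤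
        ‖exp (-(2 * Real.pi / β * (1 * n : ℤ) * ω)) - 1‖ := by
      refine h3.trans (le_trans (le_of_eq ?_) h2)
      simp
    calc _ ≤ ((1 - Real.exp t) * Real.exp (-n * t))⁻¹ * Real.exp (-(n * t) / 2) := by
          refine mul_le_mul (inv_anti₀ (by positivity) h4) (le_of_eq ?_) (Real.exp_pos _).le
            (by positivity)
          congr 1
          rw [ht]
          push_cast
          ring
      _ = _ := by
          rw [mul_inv, ← Real.exp_neg, mul_assoc, ← Real.exp_add]
          congr 2
          ring
  · have h2 := norm_sub_norm_le 1 (exp (-(2 * Real.pi / β * (-1 * n : ℤ) * ω)))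
    rw [hQ, norm_one, norm_sub_rev] at h2
    have h4 : 1 - Real.exp t ≤ ‖exp (-(2 * Real.pi / β * (-1 * n : ℤ) * ω)) - 1‖ := by
      refine le_trans ?_ h2
      push_cast
      simp only [neg_mul, one_mul, neg_neg]
      linarith
    refine mul_le_mul (inv_anti₀ hpos h4) (le_of_eq ?_) (Real.exp_pos _).le (by positivity)
    congr 1
    rw [ht]
    push_cast
    ring

lemma summable_kerCoeff {β : ℝ} (hβ : 0 < β) {ω : ℂ} (hω : ω.re < 0) :
    Summable fun k : ℤ => ‖kerCoeff β ω k‖ := by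
  have hr : Real.exp (Real.pi / β * ω.re) < 1 := by
    rw [← Real.exp_zero]
    exact Real.exp_lt_exp.mpr (mul_neg_of_pos_of_neg (by positivity) hω)
  have hs := (summable_geometric_of_lt_one (Real.exp_pos _).le hr).mul_left
    (1 - Real.exp (2 * Real.pi / β * ω.re))⁻¹
  refine Summable.of_nat_of_neg (hs.of_nonneg_of_le (fun _ => norm_nonneg _) fun n => ?_)
    (hs.of_nonneg_of_le (fun _ => norm_nonneg _) fun n => ?_)
  · simpa using norm_kerCoeff_le hβ hω n 1 (Or.inl rfl)
  · simpa using norm_kerCoeff_le hβ hω n (-1) (Or.inr rfl)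

/-- The periodic kernel inverting the shift by `ω` on exponential moments. -/
def kerFn (β : ℝ) (ω : ℂ) (s : ℝ) : ℂ :=
  ∑' k : ℤ, kerCoeff β ω k * exp (2 * Real.pi * I * k * s)

lemma norm_kerFn_term (β : ℝ) (ω : ℂ) (k : ℤ) (s : ℝ) :
    ‖kerCoeff β ω k * exp (2 * Real.pi * I * k * s)‖ = ‖kerCoeff β ω k‖ := by
  rw [norm_mul, show (2 * Real.pi * I * k * s : ℂ) = ((2 * Real.pi * k * s : ℝ) : ℂ) * I by
    push_cast; ring, norm_exp_ofReal_mul_I, mul_one]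

lemma continuous_kerFn {β : ℝ} (hβ : 0 < β) {ω : ℂ} (hω : ω.re < 0) :
    Continuous (kerFn β ω) :=
  continuous_tsum (fun k => by fun_prop) (summable_kerCoeff hβ hω)
    fun k s => (norm_kerFn_term β ω k s).le

lemma norm_kerFn_le {β : ℝ} (hβ : 0 < β) {ω : ℂ} (hω : ω.re < 0) (s : ℝ) :
    ‖kerFn β ω s‖ ≤ ∑' k : ℤ, ‖kerCoeff β ω k‖ := by
  refine tsum_of_norm_bounded (summable_kerCoeff hβ hω).hasSum fun k =>
    (norm_kerFn_term β ω k s).le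

lemma integral_exp_period (j : ℤ) :
    ∫ s in Set.Ioc (0 : ℝ) 1, exp (2 * Real.pi * I * j * s) = if j = 0 then 1 else 0 := by
  rw [← intervalIntegral.integral_of_le zero_le_one]
  split_ifs with h
  · simp [h]
  · have hc : (2 * Real.pi * I * j : ℂ) ≠ 0 := by
      simp [Real.pi_ne_zero, h]
    rw [integral_exp_mul_complex hc]
    have : exp (2 * Real.pi * I * j) = 1 := exp_eq_one_iff.mpr ⟨j, by ring⟩
    simp [this]

/-- Absolute summability of the coefficients permits termwise integration, and orthogonality of the
characters on a period leaves one term. -/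
lemma integral_kerFn_mul_exp {β : ℝ} (hβ : 0 < β) {ω : ℂ} (hω : ω.re < 0) (k : ℤ) :
    ∫ s in Set.Ioc (0 : ℝ) 1, kerFn β ω s * exp (-(2 * Real.pi * I * k * s)) = kerCoeff β ω k := by
  have hn : ∀ (j : ℤ) (s : ℝ), ‖kerCoeff β ω j * exp (2 * Real.pi * I * j * s) *
      exp (-(2 * Real.pi * I * k * s))‖ = ‖kerCoeff β ω j‖ := by
    intro j s
    rw [norm_mul, norm_kerFn_term, show (-(2 * Real.pi * I * k * s) : ℂ) =
      ((-(2 * Real.pi * k * s) : ℝ) : ℂ) * I by push_cast; ring, norm_exp_ofReal_mul_I, mul_one]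
  have h := hasSum_integral_of_summable_integral_norm (μ := volume.restrict (Set.Ioc (0 : ℝ) 1))
    (F := fun (j : ℤ) (s : ℝ) => kerCoeff β ω j * exp (2 * Real.pi * I * j * s) *
      exp (-(2 * Real.pi * I * k * s)))
    (fun j => (Continuous.integrableOn_Icc (by fun_prop)).mono_set Set.Ioc_subset_Icc_self)
    (by simp only [hn]; simpa using summable_kerCoeff hβ hω)
  simp only [tsum_mul_right] at h
  have h2 : ∀ j : ℤ, ∫ s in Set.Ioc (0 : ℝ) 1, kerCoeff β ω j * exp (2 * Real.pi * I * j * s) *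
      exp (-(2 * Real.pi * I * k * s)) = if j = k then kerCoeff β ω k else 0 := by
    intro j
    have e : ∀ s : ℝ, kerCoeff β ω j * exp (2 * Real.pi * I * j * s) *
      exp (-(2 * Real.pi * I * k * s)) = kerCoeff β ω j * exp (2 * Real.pi * I * (j - k : ℤ) * s) := by
      intro s
      rw [mul_assoc, ← exp_add]
      congr 2
      push_cast
      ring
    simp only [e, integral_const_mul, integral_exp_period, sub_eq_zero]
    split_ifs with hjk
    · rw [hjk, mul_one]
    · rw [mul_zero]
  simp only [h2] at h
  exact h.unique (hasSum_ite_eq k _)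

/-- Superposition of the translates by `βsI - Re ω / 2`, `s ∈ (0,1]`, with the kernel `kerFn`. -/
def kerConv (β : ℝ) (ω : ℂ) (F : ℂ × ℂ → ℂ) (z : ℂ × ℂ) : ℂ :=
  ∫ s in Set.Ioc (0 : ℝ) 1, kerFn β ω s * F (z.1, z.2 + (β * s * I + (-ω.re / 2 : ℝ)))

lemma kerConv_shift_bound {β : ℝ} (hβ : 0 < β) {ω : ℂ} {F : ℂ × ℂ → ℂ} (hF : Rapid2 F)
    (a R : ℝ) : ∃ C : ℝ, 0 ≤ C ∧ ∀ z : ℂ × ℂ, |z.1.im| ≤ R → |z.2.im| ≤ R → ∀ s ∈ Set.Ioc (0 : ℝ) 1,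
      ‖F (z.1, z.2 + (β * s * I + (-ω.re / 2 : ℝ)))‖ ≤
        C * Real.exp (-a * (|z.1.re| + |z.2.re|)) := by
  obtain ⟨C, hC0, hC⟩ := (hF.shift 0 (-ω.re / 2 : ℝ)).nonneg_bound a (R + β)
  refine ⟨C, hC0, fun z h1 h2 s hs => ?_⟩
  have h := hC (z.1, z.2 + β * s * I) (by simp only; linarith) (by
    have e : (z.2 + β * s * I).im = z.2.im + β * s := by simp
    simp only [e]
    refine (abs_add_le _ _).trans ?_
    rw [abs_of_nonneg (mul_nonneg hβ.le hs.1.le)]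
    have := mul_le_mul_of_nonneg_left hs.2 hβ.le
    linarith)
  have e : (z.2 + β * s * I).re = z.2.re := by simp
  simp only [e, add_zero, add_assoc] at h
  exact h

lemma Rapid2.kerConv {β : ℝ} (hβ : 0 < β) {ω : ℂ} (hω : ω.re < 0) {F : ℂ × ℂ → ℂ}
    (hF : Rapid2 F) : Rapid2 (kerConv β ω F) := by
  set K := ∑' k : ℤ, ‖kerCoeff β ω k‖
  have hK := norm_kerFn_le hβ hω
  have hK0 : 0 ≤ K := (norm_nonneg _).trans (hK 0)
  constructor
  · refine differentiable_integral_translates hF.diff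
      (continuous_kerFn hβ hω).aestronglyMeasurable
      (d := fun s : ℝ => (β * s * I + (-ω.re / 2 : ℝ) : ℂ)) (by fun_prop) fun p₀ => ?_
    obtain ⟨C, hC0, hC⟩ := kerConv_shift_bound (ω := ω) hβ hF 0 (|p₀.1.im| + |p₀.2.im| + 2)
    refine ⟨fun _ => K * C, integrable_const _, ?_⟩
    filter_upwards [ae_restrict_mem measurableSet_Ioc] with s hs p hp
    have hp' : ‖p - p₀‖ < 2 := by rwa [← dist_eq_norm]
    have i1 : |p.1.im - p₀.1.im| < 2 :=
      (abs_im_le_norm (p.1 - p₀.1)).trans_lt ((norm_fst_le (p - p₀)).trans_lt hp')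
    have i2 : |p.2.im - p₀.2.im| < 2 :=
      (abs_im_le_norm (p.2 - p₀.2)).trans_lt ((norm_snd_le (p - p₀)).trans_lt hp')
    have h := hC p (by
      have := abs_sub_abs_le_abs_sub p.1.im p₀.1.im
      have := abs_nonneg p₀.2.im
      linarith) (by
      have := abs_sub_abs_le_abs_sub p.2.im p₀.2.im
      have := abs_nonneg p₀.1.im
      linarith) s hs
    simp only [neg_zero, zero_mul, Real.exp_zero, mul_one] at h
    rw [norm_mul]
    exact mul_le_mul (hK s) h (norm_nonneg _) hK0
  · intro a R
    obtain ⟨C, hC0, hC⟩ := kerConv_shift_bound (ω := ω) hβ hF a R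
    refine ⟨K * C, fun z h1 h2 => ?_⟩
    have h := norm_setIntegral_le_of_norm_le_const (μ := volume) (s := Set.Ioc (0 : ℝ) 1)
      (f := fun s : ℝ => kerFn β ω s * F (z.1, z.2 + (β * s * I + (-ω.re / 2 : ℝ))))
      (C := K * C * Real.exp (-a * (|z.1.re| + |z.2.re|))) (by simp) (fun s hs => by
        rw [norm_mul]
        exact (mul_le_mul (hK s) (hC z h1 h2 s hs) (norm_nonneg _) hK0).trans
          (le_of_eq (mul_assoc _ _ _).symm))
    exact h.trans (by simp)

/-- Translating by `βsI` multiplies the `k`-th moment by `e^{-2πiks}`, so the integral over `s`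
extracts the `k`-th Fourier coefficient of `kerFn`. The real translation by `-Re ω / 2` contributes
the inverse of the second factor of `kerCoeff`, leaving only the first. -/
lemma moment_kerConv {β : ℝ} (hβ : 0 < β) {ω : ℂ} (hω : ω.re < 0) {F : ℂ × ℂ → ℂ}
    (hF : Rapid2 F) (w : ℂ) (k : ℤ) :
    moment β k (fun z => kerConv β ω F (w, z)) =
      (exp (-(2 * Real.pi / β * k * ω)) - 1)⁻¹ * moment β k fun z => F (w, z) := by
  have hβ' : (β : ℂ) ≠ 0 := by exact_mod_cast hβ.ne'
  set K := ∑' k : ℤ, ‖kerCoeff β ω k‖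
  have hK := norm_kerFn_le hβ hω
  have hK0 : 0 ≤ K := (norm_nonneg _).trans (hK 0)
  set d : ℝ → ℂ := fun s => β * s * I + (-ω.re / 2 : ℝ) with hd
  have hker := continuous_kerFn hβ hω
  have hFc := hF.diff.continuous
  have hsw : ∫ x : ℝ, (∫ s in Set.Ioc (0 : ℝ) 1, exp (2 * Real.pi / β * k * x) *
        (kerFn β ω s * F (w, x + d s))) =
      ∫ s in Set.Ioc (0 : ℝ) 1, (∫ x : ℝ, exp (2 * Real.pi / β * k * x) *
        (kerFn β ω s * F (w, x + d s))) := by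
    refine integral_integral_swap ?_
    obtain ⟨C, hC0, hC⟩ := kerConv_shift_bound (ω := ω) hβ hF (|2 * Real.pi / β * k| + 1) |w.im|
    refine Integrable.mono' (g := fun p : ℝ × ℝ => K * C * Real.exp (-|p.1|))
      ((integrable_exp_neg_abs.const_mul (K * C)).comp_fst _) ?_ ?_
    · refine Continuous.aestronglyMeasurable ?_
      have h1 : Continuous fun p : ℝ × ℝ => F (w, p.1 + d p.2) :=
        hFc.comp (f := fun p : ℝ × ℝ => (w, (p.1 : ℂ) + d p.2)) (by fun_prop)
      exact (by fun_prop : Continuous fun p : ℝ × ℝ => exp (2 * Real.pi / β * k * p.1)).mul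
        ((hker.comp continuous_snd).mul h1)
    · have hae : ∀ᵐ p : ℝ × ℝ ∂((volume : Measure ℝ).prod (volume.restrict (Set.Ioc (0 : ℝ) 1))),
          p.2 ∈ Set.Ioc (0 : ℝ) 1 :=
        Measure.quasiMeasurePreserving_snd.ae (ae_restrict_mem measurableSet_Ioc)
      filter_upwards [hae] with p hp
      have h := hC (w, p.1) le_rfl (by simp) p.2 hp
      simp only [ofReal_re] at h
      simp only [Function.uncurry]
      rw [norm_mul, norm_mul, norm_exp_moment, ofReal_re]
      calc _ ≤ Real.exp (2 * Real.pi / β * k * p.1) * (K * (C *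
            Real.exp (-(|2 * Real.pi / β * k| + 1) * (|w.re| + |p.1|)))) := by
            gcongr
            exact hK p.2
        _ = K * C * Real.exp (2 * Real.pi / β * k * p.1 +
            -(|2 * Real.pi / β * k| + 1) * (|w.re| + |p.1|)) := by rw [Real.exp_add]; ring
        _ ≤ _ := by
            refine mul_le_mul_of_nonneg_left (Real.exp_le_exp.mpr ?_) (mul_nonneg hK0 hC0)
            have h1 : 2 * Real.pi / β * k * p.1 ≤ |2 * Real.pi / β * k| * |p.1| := by
              rw [← abs_mul]; exact le_abs_self _
            have h2 := mul_nonneg (abs_nonneg (2 * Real.pi / β * k)) (abs_nonneg w.re)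
            have h3 := abs_nonneg w.re
            linarith
  have hin : ∀ s : ℝ, ∫ x : ℝ, exp (2 * Real.pi / β * k * x) * (kerFn β ω s * F (w, x + d s)) =
      (kerFn β ω s * exp (-(2 * Real.pi * I * k * s))) *
        (exp (-(2 * Real.pi / β * k * (-ω.re / 2 : ℝ))) * moment β k fun z => F (w, z)) := by
    intro s
    have h := (hF.slice w).moment_shift β k (d s)
    have e : exp (-(2 * Real.pi / β * k * d s)) = exp (-(2 * Real.pi * I * k * s)) *
        exp (-(2 * Real.pi / β * k * (-ω.re / 2 : ℝ))) := by
      rw [← exp_add]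
      congr 1
      simp only [hd]
      field_simp
      ring
    rw [e] at h
    rw [mul_assoc, ← mul_assoc (exp (-(2 * Real.pi * I * k * s))), ← h, moment, ← integral_const_mul]
    congr 1
    funext x
    ring
  have e0 : moment β k (fun z => kerConv β ω F (w, z)) =
      ∫ x : ℝ, (∫ s in Set.Ioc (0 : ℝ) 1, exp (2 * Real.pi / β * k * x) *
        (kerFn β ω s * F (w, x + d s))) := by
    simp only [moment, kerConv, integral_const_mul, hd]
  rw [e0, hsw]
  simp only [hin]
  rw [integral_mul_const, integral_kerFn_mul_exp hβ hω, kerCoeff, exp_neg (_ * _ * (_ : ℂ))]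
  have := exp_ne_zero (2 * Real.pi / β * k * (-ω.re / 2 : ℝ))
  rw [exp_neg]
  field_simp

/-- A rapidly decaying function with vanishing integral along the second variable is a sum of
differences for the shifts by `βI` and by `ω`. -/
theorem exists_sub_add_sub {β : ℝ} (hβ : 0 < β) {ω : ℂ} (hω : ω.re < 0) {F : ℂ × ℂ → ℂ}
    (hF : Rapid2 F) (h0 : ∀ w, ∫ x : ℝ, F (w, x) = 0) :
    ∃ g h, Rapid2 g ∧ Rapid2 h ∧ ∀ w z,
      F (w, z) = (g (w, z + β * I) - g (w, z)) + (h (w, z + ω) - h (w, z)) := by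
  set h := kerConv β ω F with hh
  have hr : Rapid2 h := hF.kerConv hβ hω
  have hs : Rapid2 fun z => h (z.1, z.2 + ω) := by simpa using hr.shift 0 ω
  have hint : ∀ {G : ℂ × ℂ → ℂ}, Rapid2 G → ∀ w k, Integrable fun x : ℝ =>
      exp (2 * Real.pi / β * (k : ℤ) * x) * G (w, x) := fun hG w k => by
    simpa using ((hG.slice w).mul_exp (2 * Real.pi / β * k)).integrable 0
  -- Passing from `h` to `h(· + ω) - h` multiplies the `k`-th moment by `e^{-2πkω/β} - 1`. By
  -- construction of `h` this reproduces the moment of `F` for `k ≠ 0`, while for `k = 0` both sides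
  -- vanish, using `h0`.
  obtain ⟨g, hg, hgF⟩ := exists_sub_eq_of_moments hβ (hF.sub (hs.sub hr)) (fun w k => by
    have e : moment β k (fun z => F (w, z) - (h (w, z + ω) - h (w, z))) =
        moment β k (fun z => F (w, z)) - (moment β k (fun z => h (w, z + ω)) -
          moment β k fun z => h (w, z)) := by
      have i3 : Integrable fun x : ℝ => exp (2 * Real.pi / β * k * x) * h (w, x + ω) := hint hs w k
      simp only [moment, mul_sub]
      rw [← integral_sub i3 (hint hr w k)]
      exact integral_sub (hint hF w k) (i3.sub (hint hr w k))
    refine e.trans ?_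
    rw [(hr.slice w).moment_shift β k ω, hh, moment_kerConv hβ hω hF]
    rcases eq_or_ne k 0 with rfl | hk
    · have : moment β 0 (fun z => F (w, z)) = 0 := by simpa [moment] using h0 w
      simp [this]
    · have hne : exp (-(2 * Real.pi / β * k * ω)) - 1 ≠ 0 := by
        intro hz
        have h1 := congrArg norm (sub_eq_zero.mp hz)
        rw [show (-(2 * Real.pi / β * k * ω) : ℂ) = 2 * Real.pi / β * ((-k : ℤ) : ℂ) * ω by
          push_cast; ring, norm_exp_moment, norm_one, Real.exp_eq_one_iff] at h1
        have hk' : (k : ℝ) ≠ 0 := by exact_mod_cast hk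
        have : (2 * Real.pi / β * ((-k : ℤ) : ℝ) * ω.re) ≠ 0 := by
          push_cast
          exact mul_ne_zero (mul_ne_zero (by positivity) (neg_ne_zero.mpr hk')) hω.ne
        exact this h1
      generalize exp (-(2 * Real.pi / β * k * ω)) = q at hne ⊢
      field_simp
      ring)
  refine ⟨g, h, hg, hr, fun w z => ?_⟩
  rw [← hgF w z]
  ring

/-! ### Pointwise bounds from the mean value property -/

/-- The mean value property on a circle, with angles in `(-π, π)` to match the range of polar
coordinates. -/
lemma two_pi_mul_enorm_le {g : ℂ → ℂ} (hg : Differentiable ℂ g) (r : ℝ) :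
    ENNReal.ofReal (2 * Real.pi) * ‖g 0‖ₑ ≤
      ∫⁻ θ in Set.Ioo (-Real.pi) Real.pi, ‖g (r * (Real.cos θ + Real.sin θ * I))‖ₑ := by
  have h1 : Real.circleAverage g 0 r = g 0 := circleAverage_of_differentiable_on_off_countable
    Set.countable_empty hg.continuous.continuousOn (fun z _ => hg z)
  have h2 : ∫ θ in (-Real.pi)..Real.pi, g (circleMap 0 r θ) = (2 * Real.pi : ℝ) • g 0 := by
    have hp : Function.Periodic (fun θ => g (circleMap 0 r θ)) (2 * Real.pi) := fun θ => by
      simp only [periodic_circleMap 0 r θ]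
    have h3 := hp.intervalIntegral_add_eq (-Real.pi) 0
    rw [show -Real.pi + 2 * Real.pi = Real.pi by ring, zero_add] at h3
    rw [h3, ← h1, Real.circleAverage_def, smul_inv_smul₀ (by positivity)]
  rw [intervalIntegral.integral_of_le (by linarith [Real.pi_pos]), integral_Ioc_eq_integral_Ioo] at h2
  have h4 := enorm_integral_le_lintegral_enorm (μ := volume.restrict (Set.Ioo (-Real.pi) Real.pi))
    (fun θ : ℝ => g (circleMap 0 r θ))
  rw [h2, enorm_smul] at h4
  rw [show ENNReal.ofReal (2 * Real.pi) = ‖(2 * Real.pi : ℝ)‖ₑ by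
    rw [Real.enorm_eq_ofReal (by positivity)]]
  refine h4.trans (le_of_eq (lintegral_congr fun θ => ?_))
  congr 2
  rw [circleMap, zero_add, exp_mul_I, ofReal_cos, ofReal_sin]

/-- Integrating the circle inequality against `r dr` over `0 < r < 1` turns `2π` into `π` and, in
polar coordinates, circles into the unit disc. -/
lemma pi_mul_enorm_le_ball {g : ℂ → ℂ} (hg : Differentiable ℂ g) (z : ℂ) :
    ENNReal.ofReal Real.pi * ‖g z‖ₑ ≤ ∫⁻ w in Metric.ball z 1, ‖g w‖ₑ := by
  set u : ℂ → ℂ := fun w => g (w + z) with hu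
  have hud : Differentiable ℂ u := hg.comp (by fun_prop)
  have e1 : ∫⁻ w in Metric.ball z 1, ‖g w‖ₑ = ∫⁻ w, (Metric.ball (0 : ℂ) 1).indicator
      (fun w => ‖u w‖ₑ) w := by
    rw [← lintegral_indicator measurableSet_ball, ← lintegral_add_right_eq_self _ z]
    refine lintegral_congr fun w => ?_
    simp only [Set.indicator, Metric.mem_ball, hu, dist_eq_norm, add_sub_cancel_right, sub_zero]
  have hmeas : Measurable fun p : ℝ × ℝ => ENNReal.ofReal p.1 • (Metric.ball (0 : ℂ) 1).indicator
      (fun w => ‖u w‖ₑ) (p.1 * (Real.cos p.2 + Real.sin p.2 * I)) :=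
    (ENNReal.measurable_ofReal.comp measurable_fst).smul
      ((hud.continuous.measurable.enorm.indicator measurableSet_ball).comp
        (by fun_prop : Measurable fun p : ℝ × ℝ => (p.1 * (Real.cos p.2 + Real.sin p.2 * I) : ℂ)))
  rw [e1, ← Complex.lintegral_comp_polarCoord_symm, polarCoord_target, Measure.volume_eq_prod,
    ← Measure.prod_restrict]
  simp only [Complex.polarCoord_symm_apply]
  rw [lintegral_prod _ hmeas.aemeasurable]
  calc ENNReal.ofReal Real.pi * ‖g z‖ₑ
      = ∫⁻ r in Set.Ioo (0 : ℝ) 1, ENNReal.ofReal r * (ENNReal.ofReal (2 * Real.pi) * ‖u 0‖ₑ) := by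
        rw [lintegral_mul_const _ (by fun_prop), ← ofReal_integral_eq_lintegral_ofReal]
        · rw [← integral_Ioc_eq_integral_Ioo, ← intervalIntegral.integral_of_le zero_le_one,
            integral_id, ← mul_assoc, ← ENNReal.ofReal_mul (by norm_num)]
          simp only [hu, zero_add]
          congr 2
          ring
        · exact (continuous_id.integrableOn_Icc).mono_set Set.Ioo_subset_Icc_self
        · filter_upwards [ae_restrict_mem measurableSet_Ioo] with r hr using hr.1.le
    _ ≤ ∫⁻ r in Set.Ioo (0 : ℝ) 1, ∫⁻ θ in Set.Ioo (-Real.pi) Real.pi,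
        ENNReal.ofReal r * ‖u (r * (Real.cos θ + Real.sin θ * I))‖ₑ := by
        refine lintegral_mono fun r => ?_
        rw [lintegral_const_mul _ (by
          exact (hud.continuous.comp (f := fun θ : ℝ => (r * (Real.cos θ + Real.sin θ * I) : ℂ))
            (by fun_prop)).measurable.enorm)]
        exact mul_le_mul' le_rfl (two_pi_mul_enorm_le hud r)
    _ ≤ ∫⁻ r in Set.Ioi (0 : ℝ), ∫⁻ θ in Set.Ioo (-Real.pi) Real.pi, ENNReal.ofReal r •
        (Metric.ball (0 : ℂ) 1).indicator (fun w => ‖u w‖ₑ) (r * (Real.cos θ + Real.sin θ * I)) := by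
        refine le_trans (le_of_eq ?_) (lintegral_mono_set
          (Set.Ioo_subset_Ioi_self : Set.Ioo (0 : ℝ) 1 ⊆ Set.Ioi 0))
        refine setLIntegral_congr_fun measurableSet_Ioo fun r hr => lintegral_congr fun θ => ?_
        have h := Complex.norm_polarCoord_symm (r, θ)
        rw [Complex.polarCoord_symm_apply, abs_of_pos hr.1] at h
        rw [Set.indicator_of_mem, smul_eq_mul]
        rw [Metric.mem_ball, dist_zero_right]
        exact h.trans_lt hr.2

/-- The disc lies in a strip of half-width one, over which the integral factors by Tonelli into
integrals over horizontal lines, as needed to use the norms defining the domains. -/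
lemma setLIntegral_ball_le {u : ℂ → ℝ≥0∞} (hu : Measurable u) (z : ℂ) :
    ∫⁻ w in Metric.ball z 1, u w ≤
      ∫⁻ y in Set.Icc (z.im - 1) (z.im + 1), ∫⁻ x : ℝ, u (x + y * I) := by
  have h1 : Metric.ball z 1 ⊆ im ⁻¹' Set.Icc (z.im - 1) (z.im + 1) := by
    intro w hw
    have : |w.im - z.im| < 1 := (abs_im_le_norm (w - z)).trans_lt (by
      rwa [Metric.mem_ball, dist_eq_norm] at hw)
    rw [abs_lt] at this
    exact ⟨by linarith, by linarith⟩
  refine (lintegral_mono_set h1).trans (le_of_eq ?_)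
  have hm : MeasurableSet (im ⁻¹' Set.Icc (z.im - 1) (z.im + 1)) :=
    measurable_im measurableSet_Icc
  rw [← lintegral_indicator hm, ← Complex.volume_preserving_equiv_real_prod.symm.lintegral_comp
    (hu.indicator hm), Measure.volume_eq_prod, lintegral_prod_symm' (fun p : ℝ × ℝ =>
      (im ⁻¹' Set.Icc (z.im - 1) (z.im + 1)).indicator u (Complex.measurableEquivRealProd.symm p))
      ((hu.indicator hm).comp Complex.measurableEquivRealProd.symm.measurable), ← lintegral_indicator measurableSet_Icc]
  refine lintegral_congr fun y => ?_
  by_cases hy : y ∈ Set.Icc (z.im - 1) (z.im + 1)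
  · rw [Set.indicator_of_mem hy]
    refine lintegral_congr fun x => ?_
    rw [Set.indicator_of_mem]
    · congr 1
      simp [Complex.ext_iff, Complex.measurableEquivRealProd]
    · simpa [Complex.measurableEquivRealProd] using hy
  · rw [Set.indicator_of_notMem hy]
    refine (lintegral_congr fun x => ?_).trans lintegral_zero
    rw [Set.indicator_of_notMem]
    simpa [Complex.measurableEquivRealProd] using hy

/-- An entire function of two variables is bounded by its integrals over pairs of horizontal
lines. -/
lemma pi_sq_mul_enorm_le {F : ℂ × ℂ → ℂ} (hF : Differentiable ℂ F) (z : ℂ × ℂ) (B : ℝ≥0∞)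
    (hB : ∀ y₁ ∈ Set.Icc (z.1.im - 1) (z.1.im + 1), ∀ y₂ ∈ Set.Icc (z.2.im - 1) (z.2.im + 1),
      ∫⁻ x : ℝ × ℝ, ‖F (x.1 + y₁ * I, x.2 + y₂ * I)‖ₑ ≤ B) :
    ENNReal.ofReal Real.pi * (ENNReal.ofReal Real.pi * ‖F z‖ₑ) ≤ 4 * B := by
  have hFm : Measurable fun p : ℂ × ℂ => ‖F p‖ₑ := hF.continuous.measurable.enorm
  have hvol : ∀ t : ℝ, volume (Set.Icc (t - 1) (t + 1)) = 2 := by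
    intro t
    rw [Real.volume_Icc, show t + 1 - (t - 1) = 2 by ring]
    simp
  have hm : Measurable fun q : (ℝ × ℝ) × (ℝ × ℝ) =>
      ‖F ((q.1.1 : ℂ) + q.1.2 * I, (q.2.1 : ℂ) + q.2.2 * I)‖ₑ := hFm.comp (by fun_prop)
  calc ENNReal.ofReal Real.pi * (ENNReal.ofReal Real.pi * ‖F z‖ₑ)
      ≤ ENNReal.ofReal Real.pi * ∫⁻ w₁ in Metric.ball z.1 1, ‖F (w₁, z.2)‖ₑ :=
        mul_le_mul' le_rfl (pi_mul_enorm_le_ball (g := fun w => F (w, z.2))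
          (hF.comp (f := fun w : ℂ => (w, z.2)) (by fun_prop)) z.1)
    _ = ∫⁻ w₁ in Metric.ball z.1 1, ENNReal.ofReal Real.pi * ‖F (w₁, z.2)‖ₑ :=
        (lintegral_const_mul _ (hFm.comp (by fun_prop))).symm
    _ ≤ ∫⁻ w₁ in Metric.ball z.1 1, ∫⁻ y₂ in Set.Icc (z.2.im - 1) (z.2.im + 1), ∫⁻ x₂ : ℝ,
          ‖F (w₁, x₂ + y₂ * I)‖ₑ := by
        refine lintegral_mono fun w₁ => ?_
        exact (pi_mul_enorm_le_ball (g := fun w => F (w₁, w))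
          (hF.comp (f := fun w : ℂ => (w₁, w)) (by fun_prop)) z.2).trans
          (setLIntegral_ball_le (hFm.comp (by fun_prop)) z.2)
    _ ≤ ∫⁻ y₁ in Set.Icc (z.1.im - 1) (z.1.im + 1), ∫⁻ x₁ : ℝ,
          ∫⁻ y₂ in Set.Icc (z.2.im - 1) (z.2.im + 1), ∫⁻ x₂ : ℝ,
          ‖F (x₁ + y₁ * I, x₂ + y₂ * I)‖ₑ := by
        refine setLIntegral_ball_le (u := fun w₁ => ∫⁻ y₂ in Set.Icc (z.2.im - 1) (z.2.im + 1),
          ∫⁻ x₂ : ℝ, ‖F (w₁, x₂ + y₂ * I)‖ₑ) ?_ z.1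
        refine Measurable.lintegral_prod_right (f := fun (w₁ : ℂ) (y₂ : ℝ) => ∫⁻ x₂ : ℝ,
          ‖F (w₁, x₂ + y₂ * I)‖ₑ) ?_
        exact Measurable.lintegral_prod_right (f := fun (p : ℂ × ℝ) (x₂ : ℝ) =>
          ‖F (p.1, x₂ + p.2 * I)‖ₑ) (hFm.comp (by fun_prop))
    _ = ∫⁻ y₁ in Set.Icc (z.1.im - 1) (z.1.im + 1), ∫⁻ y₂ in Set.Icc (z.2.im - 1) (z.2.im + 1),
          ∫⁻ x : ℝ × ℝ, ‖F (x.1 + y₁ * I, x.2 + y₂ * I)‖ₑ := by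
        refine lintegral_congr fun y₁ => ?_
        rw [lintegral_lintegral_swap]
        · refine lintegral_congr fun y₂ => ?_
          rw [Measure.volume_eq_prod, lintegral_prod (fun x : ℝ × ℝ => ‖F (x.1 + y₁ * I, x.2 + y₂ * I)‖ₑ)
            (hFm.comp (by fun_prop)).aemeasurable]
        · refine Measurable.aemeasurable ?_
          exact Measurable.lintegral_prod_right (f := fun (p : ℝ × ℝ) (x₂ : ℝ) =>
            ‖F (p.1 + y₁ * I, x₂ + p.2 * I)‖ₑ) (hFm.comp (by fun_prop))
    _ ≤ ∫⁻ y₁ in Set.Icc (z.1.im - 1) (z.1.im + 1), ∫⁻ y₂ in Set.Icc (z.2.im - 1) (z.2.im + 1),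
          B := setLIntegral_mono measurable_const fun y₁ h₁ =>
            setLIntegral_mono measurable_const fun y₂ h₂ => hB y₁ h₁ y₂ h₂
    _ = 4 * B := by
        simp only [lintegral_const, Measure.restrict_apply MeasurableSet.univ, Set.univ_inter, hvol]
        rw [mul_assoc, mul_comm]
        norm_num

/-! ### The domains in terms of pointwise bounds -/

/-- The components of an element of `Fn2 N` as functions on `ℂ × ℂ`. -/
def comp2 {N : ℕ} (f : Fn2 N) (m₁ m₂ : ZMod N) (z : ℂ × ℂ) : ℂ := f z.1 m₁ z.2 m₂

/-- The square of `e^{a₁μ₁ + a₂μ₂} f` is entire, and its `L¹` norms over pairs of horizontal lines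
are the squared `L²` norms controlled by the domain. The mean value estimate for the square gives
the pointwise bound. -/
lemma norm_le_of_mem_Dbar2 {N : ℕ} {f : Fn2 N} (hf : f ∈ Dbar2 N) (a₁ a₂ R : ℝ) :
    ∃ C : ℝ, ∀ (z : ℂ × ℂ) (m₁ m₂ : ZMod N), |z.1.im| ≤ R → |z.2.im| ≤ R →
      ‖f z.1 m₁ z.2 m₂‖ ≤ C * Real.exp (-(a₁ * z.1.re + a₂ * z.2.re)) := by
  obtain ⟨C, hC⟩ := hf.2 a₁ a₂ (R + 1)
  -- From `π² |F| ≤ 4 C²` for the squared function `F`, together with `π² ≥ 1`.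
  refine ⟨2 * C, fun z m₁ m₂ h1 h2 => ?_⟩
  set F : ℂ × ℂ → ℂ := fun w => (exp (a₁ * w.1 + a₂ * w.2) * f w.1 m₁ w.2 m₂) ^ 2 with hF
  have hFd : Differentiable ℂ F :=
    ((by fun_prop : Differentiable ℂ fun w : ℂ × ℂ => exp (a₁ * w.1 + a₂ * w.2)).mul
      (hf.1 m₁ m₂)).pow 2
  have hn : ∀ x₁ y₁ x₂ y₂ : ℝ, ‖exp (a₁ * (x₁ + y₁ * I) + a₂ * (x₂ + y₂ * I))‖ =
      Real.exp (a₁ * x₁ + a₂ * x₂) := by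
    intro x₁ y₁ x₂ y₂
    rw [norm_exp]
    simp
  have hB := pi_sq_mul_enorm_le hFd z (C ^ 2 : ℝ≥0) (fun y₁ h₁ y₂ h₂ => by
    have h := hC y₁ y₂ (by rw [abs_le] at h1 ⊢; constructor <;> linarith [h₁.1, h₁.2])
      (by rw [abs_le] at h2 ⊢; constructor <;> linarith [h₂.1, h₂.2]) m₁ m₂
    rw [eLpNorm_eq_lintegral_rpow_enorm_toReal two_ne_zero ENNReal.ofNat_ne_top] at h
    simp only [ENNReal.toReal_ofNat, one_div] at h
    rw [ENNReal.rpow_inv_le_iff two_pos] at h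
    rw [ENNReal.coe_pow]
    refine le_trans (le_of_eq (lintegral_congr fun x => ?_)) (h.trans (le_of_eq ?_))
    · simp only [hF, line2]
      rw [enorm_pow, ← ENNReal.rpow_natCast]
      congr 1
      rw [enorm_mul, enorm_smul]
      congr 1
      rw [← ofReal_norm, ← ofReal_norm, hn, Real.norm_eq_abs, Real.abs_exp]
    · exact ENNReal.rpow_natCast _ 2)
  rw [← mul_assoc, ← ENNReal.ofReal_mul Real.pi_pos.le, ← ofReal_norm,
    ← ENNReal.ofReal_mul (by positivity), show (4 : ℝ≥0∞) * ((C ^ 2 : ℝ≥0) : ℝ≥0∞) =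
      ENNReal.ofReal (4 * (C : ℝ) ^ 2) by
    rw [← ENNReal.ofReal_coe_nnreal, NNReal.coe_pow, ENNReal.ofReal_mul (by norm_num)]
    congr 1
    norm_num, ENNReal.ofReal_le_ofReal_iff (by positivity), hF] at hB
  simp only [norm_pow, norm_mul] at hB
  have hn' : ‖exp (a₁ * z.1 + a₂ * z.2)‖ = Real.exp (a₁ * z.1.re + a₂ * z.2.re) := by
    have := hn z.1.re z.1.im z.2.re z.2.im
    rwa [re_add_im, re_add_im] at this
  rw [hn'] at hB
  set e := Real.exp (a₁ * z.1.re + a₂ * z.2.re) with he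
  have he0 : 0 < e := Real.exp_pos _
  have hle : (e * ‖f z.1 m₁ z.2 m₂‖) ^ 2 ≤ (2 * C) ^ 2 := by
    have h3 : 1 ≤ Real.pi * Real.pi := by nlinarith [Real.pi_gt_three]
    nlinarith [sq_nonneg (e * ‖f z.1 m₁ z.2 m₂‖)]
  have h4 := le_of_sq_le_sq hle
  rw [Real.exp_neg, ← div_eq_mul_inv, le_div_iff₀ he0, mul_comm]
  exact h4 (by positivity)

/-- The four sign choices `(±a, ±a)` of exponential weights give the decay in the four quadrants of
`(Re μ₁, Re μ₂)`. -/
lemma Rapid2.of_mem_Dbar2 {N : ℕ} {f : Fn2 N} (hf : f ∈ Dbar2 N) (m₁ m₂ : ZMod N) :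
    Rapid2 (comp2 f m₁ m₂) := by
  refine ⟨hf.1 m₁ m₂, fun a R => ?_⟩
  have h := fun s₁ s₂ : ℝ => norm_le_of_mem_Dbar2 hf s₁ s₂ R
  obtain ⟨C₁, h₁⟩ := h a a
  obtain ⟨C₂, h₂⟩ := h a (-a)
  obtain ⟨C₃, h₃⟩ := h (-a) a
  obtain ⟨C₄, h₄⟩ := h (-a) (-a)
  refine ⟨max (max C₁ C₂) (max C₃ C₄), fun z hz₁ hz₂ => ?_⟩
  have key : ∀ {C s₁ s₂ : ℝ}, C ≤ max (max C₁ C₂) (max C₃ C₄) →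
      ‖f z.1 m₁ z.2 m₂‖ ≤ C * Real.exp (-(s₁ * z.1.re + s₂ * z.2.re)) →
      s₁ * z.1.re + s₂ * z.2.re = a * (|z.1.re| + |z.2.re|) →
      ‖f z.1 m₁ z.2 m₂‖ ≤ max (max C₁ C₂) (max C₃ C₄) * Real.exp (-a * (|z.1.re| + |z.2.re|)) := by
    intro C s₁ s₂ hC hb he
    rw [he] at hb
    rw [neg_mul]
    exact hb.trans (mul_le_mul_of_nonneg_right hC (Real.exp_pos _).le)
  rcases le_total 0 z.1.re with p | p <;> rcases le_total 0 z.2.re with q | q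
  · exact key (by simp) (h₁ z m₁ m₂ hz₁ hz₂) (by rw [abs_of_nonneg p, abs_of_nonneg q]; ring)
  · exact key (by simp) (h₂ z m₁ m₂ hz₁ hz₂) (by rw [abs_of_nonneg p, abs_of_nonpos q]; ring)
  · exact key (by simp) (h₃ z m₁ m₂ hz₁ hz₂) (by rw [abs_of_nonpos p, abs_of_nonneg q]; ring)
  · exact key (by simp) (h₄ z m₁ m₂ hz₁ hz₂) (by rw [abs_of_nonpos p, abs_of_nonpos q]; ring)

lemma exists_uniform_bound {N : ℕ} [NeZero N] {f : Fn2 N} (hf : ∀ m₁ m₂, Rapid2 (comp2 f m₁ m₂))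
    (a R : ℝ) : ∃ C : ℝ, 0 ≤ C ∧ ∀ (z : ℂ × ℂ) (m₁ m₂ : ZMod N), |z.1.im| ≤ R → |z.2.im| ≤ R →
      ‖f z.1 m₁ z.2 m₂‖ ≤ C * Real.exp (-a * (|z.1.re| + |z.2.re|)) := by
  choose C hC using fun m₁ m₂ => (hf m₁ m₂).bound a R
  obtain ⟨K, hK0, hK⟩ := exists_norm_bound N fun m₁ m₂ => (C m₁ m₂ : ℂ)
  refine ⟨K, hK0, fun z m₁ m₂ h1 h2 => (hC m₁ m₂ z h1 h2).trans
    (mul_le_mul_of_nonneg_right ?_ (Real.exp_pos _).le)⟩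
  have := hK m₁ m₂
  rw [norm_real] at this
  exact (le_abs_self _).trans this

lemma memLp_exp_neg_abs :
    MemLp (fun x : ℝ × ℝ => Real.exp (-|x.1|) * Real.exp (-|x.2|)) 2 volume := by
  rw [memLp_two_iff_integrable_sq (by
    exact Continuous.aestronglyMeasurable (by fun_prop))]
  have h := integrable_exp_neg_abs.mul_prod integrable_exp_neg_abs
  refine h.mono' (Continuous.aestronglyMeasurable (by fun_prop))
    (Filter.Eventually.of_forall fun x => ?_)
  rw [Real.norm_of_nonneg (by positivity), mul_pow]
  have k : ∀ y : ℝ, Real.exp (-|y|) ^ 2 ≤ Real.exp (-|y|) := fun y => by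
    have h1 : Real.exp (-|y|) ≤ 1 := Real.exp_le_one_iff.mpr (neg_nonpos.mpr (abs_nonneg y))
    have h0 := Real.exp_pos (-|y|)
    nlinarith
  exact mul_le_mul (k _) (k _) (by positivity) (by positivity)

lemma mem_D2_of_rapid {N : ℕ} [NeZero N] {f : Fn2 N} (hf : ∀ m₁ m₂, Rapid2 (comp2 f m₁ m₂)) :
    f ∈ D2 N := by
  refine ⟨⟨fun m₁ m₂ => (hf m₁ m₂).diff, fun a₁ a₂ R => ?_⟩, fun η₁ η₂ a ha => ?_⟩
  · obtain ⟨C, hC0, hC⟩ := exists_uniform_bound hf (|a₁| + |a₂| + 1) R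
    have hfin : eLpNorm (fun x : ℝ × ℝ => C * (Real.exp (-|x.1|) * Real.exp (-|x.2|))) 2 volume < ⊤ :=
      (memLp_exp_neg_abs.const_mul C).2
    refine ⟨(eLpNorm (fun x : ℝ × ℝ => C * (Real.exp (-|x.1|) * Real.exp (-|x.2|))) 2
      volume).toNNReal, fun η₁ η₂ h₁ h₂ m₁ m₂ => ?_⟩
    rw [ENNReal.coe_toNNReal hfin.ne]
    refine eLpNorm_mono_real fun x => ?_
    have h := hC (x.1 + η₁ * I, x.2 + η₂ * I) m₁ m₂ (by simpa using h₁) (by simpa using h₂)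
    simp only [add_re, ofReal_re, mul_re, I_re, mul_zero, ofReal_im, I_im, mul_one, sub_self,
      add_zero] at h
    rw [line2, norm_smul, Real.norm_eq_abs, Real.abs_exp]
    calc _ ≤ Real.exp (a₁ * x.1 + a₂ * x.2) *
          (C * Real.exp (-(|a₁| + |a₂| + 1) * (|x.1| + |x.2|))) :=
          mul_le_mul_of_nonneg_left h (Real.exp_pos _).le
      _ = C * Real.exp (a₁ * x.1 + a₂ * x.2 + -(|a₁| + |a₂| + 1) * (|x.1| + |x.2|)) := by
          rw [Real.exp_add (a₁ * x.1 + a₂ * x.2)]; ring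
      _ ≤ C * Real.exp (-|x.1| + -|x.2|) := by
          refine mul_le_mul_of_nonneg_left (Real.exp_le_exp.mpr ?_) hC0
          have k1 : a₁ * x.1 ≤ |a₁| * |x.1| := by rw [← abs_mul]; exact le_abs_self _
          have k2 : a₂ * x.2 ≤ |a₂| * |x.2| := by rw [← abs_mul]; exact le_abs_self _
          have k3 := mul_nonneg (abs_nonneg a₁) (abs_nonneg x.2)
          have k4 := mul_nonneg (abs_nonneg a₂) (abs_nonneg x.1)
          linarith
      _ = _ := by rw [Real.exp_add]
  · obtain ⟨C, hC0, hC⟩ := exists_uniform_bound hf a (max |η₁| |η₂|)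
    refine ⟨C, fun x₁ x₂ m₁ m₂ => ?_⟩
    have h := hC (x₁ + η₁ * I, x₂ + η₂ * I) m₁ m₂ (by simp) (by simp)
    simp only [add_re, ofReal_re, mul_re, I_re, mul_zero, ofReal_im, I_im, mul_one, sub_self,
      add_zero] at h
    refine h.trans (mul_le_mul_of_nonneg_left (Real.exp_le_exp.mpr ?_) hC0)
    have hs : Real.sqrt (x₁ ^ 2 + x₂ ^ 2) ≤ |x₁| + |x₂| := by
      rw [Real.sqrt_le_left (by positivity)]
      nlinarith [sq_abs x₁, sq_abs x₂, mul_nonneg (abs_nonneg x₁) (abs_nonneg x₂)]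
    nlinarith

/-- With the trivial inclusion `D2_le_Dbar2` this makes the two domains equal, so statements about
forms on either of them can be proved on `D2`. -/
lemma Dbar2_le_D2 (N : ℕ) [NeZero N] : Dbar2 N ≤ D2 N :=
  fun _ hf => mem_D2_of_rapid fun m₁ m₂ => Rapid2.of_mem_Dbar2 hf m₁ m₂

lemma mem_D2_iff {N : ℕ} [NeZero N] {f : Fn2 N} :
    f ∈ D2 N ↔ ∀ m₁ m₂, Rapid2 (comp2 f m₁ m₂) :=
  ⟨fun hf m₁ m₂ => Rapid2.of_mem_Dbar2 hf.1 m₁ m₂, mem_D2_of_rapid⟩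

lemma Rapid1.of_mem_Dbar {N : ℕ} [NeZero N] {φ : Fn N ℂ} (hφ : φ ∈ Dbar N) (m : ZMod N) :
    Rapid1 fun μ => φ μ m := by
  by_cases h : ∃ μ₀, φ μ₀ m ≠ 0
  · obtain ⟨μ₀, h₀⟩ := h
    have h1 : Rapid2 (comp2 (tensorFn φ φ) m m) := Rapid2.of_mem_Dbar2 (tensorFn_mem N hφ hφ) m m
    have h2 := (h1.const_mul (φ μ₀ m)⁻¹).slice μ₀
    simpa [comp2, tensorFn, ← mul_assoc, inv_mul_cancel₀ h₀] using h2
  · push Not at h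
    simp only [h]
    exact ⟨differentiable_const 0, fun a R => ⟨0, fun z _ => by simp⟩⟩

section

/-! ### Shift invariant functionals -/

lemma Rapid2.integral_right {F : ℂ × ℂ → ℂ} (hF : Rapid2 F) :
    Rapid1 fun w => ∫ x : ℝ, F (w, x) := by
  constructor
  · have h := hF.differentiable_integral (κ := fun _ => 1) continuous_const (K := 1)
      (fun _ => by simp) 0
    have h2 := h.comp (f := fun w : ℂ => (w, (0 : ℂ))) (by fun_prop)
    have e : ((fun p : ℂ × ℂ => ∫ x : ℝ, 1 * F (p.1, p.2 + (x + 0))) ∘ fun w : ℂ => (w, (0 : ℂ))) =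
        fun w => ∫ x : ℝ, F (w, x) := by
      funext w
      simp
    rwa [e] at h2
  · intro a R
    obtain ⟨C, hC0, hC⟩ := hF.nonneg_bound (|a| + 1) (max R 0)
    refine ⟨C * ∫ x : ℝ, Real.exp (-|x|), fun w hw => ?_⟩
    rw [mul_assoc, ← integral_mul_const, ← integral_const_mul]
    refine norm_integral_le_of_norm_le ((integrable_exp_neg_abs.mul_const _).const_mul C)
      (Filter.Eventually.of_forall fun x => ?_)
    refine (hC (w, x) (hw.trans (le_max_left _ _)) (by simp)).trans ?_
    rw [← Real.exp_add]
    refine mul_le_mul_of_nonneg_left (Real.exp_le_exp.mpr ?_) hC0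
    simp only [ofReal_re]
    have h1 := mul_le_mul_of_nonneg_right (le_abs_self a) (abs_nonneg w.re)
    have h2 := mul_nonneg (abs_nonneg a) (abs_nonneg x)
    have h3 := abs_nonneg w.re
    linarith

lemma Rapid1.const_mul {g : ℂ → ℂ} (hg : Rapid1 g) (c : ℂ) : Rapid1 fun z => c * g z := by
  have h := (((Rapid1.gaussian.tensor hg).const_mul c)).slice 0
  simpa using h

lemma Rapid1.add {g h : ℂ → ℂ} (hg : Rapid1 g) (hh : Rapid1 h) : Rapid1 fun z => g z + h z := by
  have h := ((Rapid1.gaussian.tensor hg).add (Rapid1.gaussian.tensor hh)).slice 0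
  simpa using h

lemma Rapid1.zero : Rapid1 fun _ => 0 := by
  simpa using Rapid1.gaussian.const_mul 0

lemma Rapid1.sum {ι : Type*} (s : Finset ι) {g : ι → ℂ → ℂ} (hg : ∀ i, Rapid1 (g i)) :
    Rapid1 fun z => ∑ i ∈ s, g i z := by
  classical
  induction s using Finset.induction_on with
  | empty => simpa using Rapid1.zero
  | insert i s hi ih => simpa [Finset.sum_insert hi] using (hg i).add ih

variable {N : ℕ} [NeZero N]

lemma tensorFn_mem_D2 {φ ψ : Fn N ℂ} (hφ : ∀ m, Rapid1 fun μ => φ μ m)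
    (hψ : ∀ m, Rapid1 fun μ => ψ μ m) : tensorFn φ ψ ∈ D2 N :=
  mem_D2_iff.mpr fun m₁ m₂ => (hφ m₁).tensor (hψ m₂)

variable (N) in
/-- The Gaussian supported on the component `m = 0`, with total integral one. -/
def gaussFn : Fn N ℂ := fun μ m => if m = 0 then exp (-Real.pi * μ ^ 2) else 0

lemma rapid_gaussFn (m : ZMod N) : Rapid1 fun μ => gaussFn N μ m := by
  unfold gaussFn
  split_ifs
  · exact Rapid1.gaussian
  · exact Rapid1.zero

lemma integral_gaussFn_zero : ∫ x : ℝ, gaussFn N x 0 = 1 := by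
  have h := integral_gaussian_complex (b := Real.pi) (by simpa using Real.pi_pos)
  simp only [gaussFn, if_true]
  rw [h, div_self (by exact_mod_cast Real.pi_ne_zero), one_cpow]

/-- Sum over `m₂` and integral over real `μ₂`. -/
def avgRight (f : Fn2 N) : Fn N ℂ := fun μ m => ∑ j : ZMod N, ∫ x : ℝ, f μ m x j

lemma rapid_avgRight {f : Fn2 N} (hf : f ∈ D2 N) (m : ZMod N) :
    Rapid1 fun μ => avgRight f μ m :=
  Rapid1.sum _ fun j => (mem_D2_iff.mp hf m j).integral_right

/-- Sum over `m` and integral over real `μ`. -/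
def avg (φ : Fn N ℂ) : ℂ := ∑ j : ZMod N, ∫ x : ℝ, φ x j

lemma avg_gaussFn : avg (gaussFn N) = 1 := by
  rw [avg, Finset.sum_eq_single 0]
  · exact integral_gaussFn_zero
  · intro j _ hj
    simp [gaussFn, hj]
  · simp

/-- The sum over `m₁`, `m₂` of the integrals over `ℝ²`. -/
def totalInt (f : Fn2 N) : ℂ := avg (avgRight f)

/-! ### The quantum torus operators and shift invariance on `D2` -/

variable (N) in
/-- The action of `u_{α,β}` on the first pair of variables as an operator on `D2`. -/
def U1 (b : Circle) (t : Bool) (α β : ℤ) : Module.End ℂ (D2 N) :=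
  (uab1 N b t α β).restrict (uab1_mem_D2 N b t α β)

variable (N) in
/-- The action of `u_{α,β}` on the second pair of variables as an operator on `D2`. -/
def U2 (b : Circle) (t : Bool) (α β : ℤ) : Module.End ℂ (D2 N) :=
  (uab2 N b t α β).restrict (uab2_mem_D2 N b t α β)

lemma U1_coe (b : Circle) (t : Bool) (α β : ℤ) (f : D2 N) :
    (U1 N b t α β f : Fn2 N) = uab1 N b t α β f := rfl

lemma U2_coe (b : Circle) (t : Bool) (α β : ℤ) (f : D2 N) :
    (U2 N b t α β f : Fn2 N) = uab2 N b t α β f := rfl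

lemma U1_mul (b : Circle) (t : Bool) (α β γ δ : ℤ) : U1 N b t α β * U1 N b t γ δ =
    qPar N b t ^ (α * δ - β * γ) • U1 N b t (α + γ) (β + δ) := by
  refine LinearMap.ext fun f => Subtype.ext ?_
  exact congrArg (fun T : Module.End ℂ (Fn2 N) => T f) (uab_mul N b (V := Fn N ℂ) t α β γ δ)

lemma U2_mul (b : Circle) (t : Bool) (α β γ δ : ℤ) : U2 N b t α β * U2 N b t γ δ =
    qPar N b t ^ (α * δ - β * γ) • U2 N b t (α + γ) (β + δ) := by
  refine LinearMap.ext fun f => Subtype.ext ?_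
  have h := congrArg (slot2 N) (uab_mul N b (V := ℂ) t α β γ δ)
  rw [map_mul, map_smul] at h
  exact congrArg (fun T : Module.End ℂ (Fn2 N) => T f) h

lemma U1_zero (b : Circle) (t : Bool) : U1 N b t 0 0 = 1 := by
  refine LinearMap.ext fun f => Subtype.ext ?_
  exact congrArg (fun T : Module.End ℂ (Fn2 N) => T f) (uab_zero N b (V := Fn N ℂ) t)

lemma U2_zero (b : Circle) (t : Bool) : U2 N b t 0 0 = 1 := by
  refine LinearMap.ext fun f => Subtype.ext ?_
  have h := congrArg (slot2 N) (uab_zero N b (V := ℂ) t)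
  rw [map_one] at h
  exact congrArg (fun T : Module.End ℂ (Fn2 N) => T f) h

lemma U1_U2_comm (b : Circle) (t s : Bool) (α β γ δ : ℤ) :
    U1 N b t α β * U2 N b s γ δ = U2 N b s γ δ * U1 N b t α β := by
  refine LinearMap.ext fun f => Subtype.ext ?_
  simp only [Module.End.mul_apply, U1_coe, U2_coe]
  funext μ m
  simp only [uab1, uab2, slot2_apply, uab_apply, map_smul]

/-- Exchange of the two pairs of variables. -/
def swapD2 : Module.End ℂ (D2 N) where
  toFun f := ⟨fun μ₁ m₁ μ₂ m₂ => (f : Fn2 N) μ₂ m₂ μ₁ m₁,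
    mem_D2_iff.mpr fun m₁ m₂ => (mem_D2_iff.mp f.2 m₂ m₁).swap⟩
  map_add' _ _ := rfl
  map_smul' _ _ := rfl

lemma uab_shift_apply (b : Circle) {V : Type*} [AddCommGroup V] [Module ℂ V] (t : Bool) (α : ℤ)
    (f : Fn N V) (μ : ℂ) (m : ZMod N) :
    uab N b t α 0 f μ m = f (μ + α * (I * bPar b t)) (m - (α * sgn t : ℤ)) := by
  rw [uab_apply]
  simp

lemma swapD2_U2 (b : Circle) (t : Bool) (α : ℤ) (f : D2 N) :
    swapD2 (U2 N b t α 0 f) = U1 N b t α 0 (swapD2 f) := by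
  refine Subtype.ext ?_
  funext μ₁ m₁ μ₂ m₂
  have h1 : (U1 N b t α 0 (swapD2 f) : Fn2 N) μ₁ m₁ = (swapD2 f : Fn2 N) (μ₁ + α * (I * bPar b t))
      (m₁ - (α * sgn t : ℤ)) := uab_shift_apply b t α _ μ₁ m₁
  rw [h1]
  exact uab_shift_apply b t α _ μ₁ m₁

lemma comp_shift_of_one {A : ℤ → Module.End ℂ (D2 N)} (h0 : A 0 = 1)
    (hA : ∀ α γ, A α * A γ = A (α + γ)) {Φ : D2 N →ₗ[ℂ] ℂ} (h1 : ∀ f, Φ (A 1 f) = Φ f) (α : ℤ) :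
    ∀ f, Φ (A α f) = Φ f := by
  induction α using Int.induction_on with
  | zero => simp [h0]
  | succ n ih =>
    intro f
    rw [add_comm, ← hA, Module.End.mul_apply, h1, ih]
  | pred n ih =>
    intro f
    rw [← h1, ← Module.End.mul_apply, hA, show 1 + (-(n : ℤ) - 1) = -n by ring, ih]

lemma U2_shift_mul (b : Circle) (t : Bool) (α γ : ℤ) :
    U2 N b t α 0 * U2 N b t γ 0 = U2 N b t (α + γ) 0 := by
  rw [U2_mul]; simp

lemma U1_shift_mul (b : Circle) (t : Bool) (α γ : ℤ) :
    U1 N b t α 0 * U1 N b t γ 0 = U1 N b t (α + γ) 0 := by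
  rw [U1_mul]; simp

/-- Invariance under the shifts of the second pair of variables. -/
def ShiftInv2 (b : Circle) (Φ : D2 N →ₗ[ℂ] ℂ) : Prop :=
  ∀ (t : Bool) (α : ℤ) (f : D2 N), Φ (U2 N b t α 0 f) = Φ f

/-- Invariance under the shifts of the first pair of variables. -/
def ShiftInv1 (b : Circle) (Φ : D2 N →ₗ[ℂ] ℂ) : Prop :=
  ∀ (t : Bool) (α : ℤ) (f : D2 N), Φ (U1 N b t α 0 f) = Φ f

lemma coe_circle_add_inv (b : Circle) : (b : ℂ) + (b : ℂ)⁻¹ = (2 * (b : ℂ).re : ℝ) := by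
  rw [← Circle.coe_inv, Circle.coe_inv_eq_conj, add_conj]

/-- In `u ũ` the discrete shifts cancel and `μ₂` moves by `i(b + b⁻¹) = 2i Re b`; in `u^N` the
discrete shift is trivial modulo `N` and `μ₂` moves by `iNb`, whose real part `-N Im b` is negative.
Each component is therefore a sum of differences for these two shifts, and an invariant functional
kills them. -/
lemma ShiftInv2.eq_zero {b : Circle} (hre : 0 < (b : ℂ).re) (him : 0 < (b : ℂ).im)
    {Φ : D2 N →ₗ[ℂ] ℂ} (hΦ : ShiftInv2 b Φ) (f : D2 N)
    (hf : ∀ μ m₁ m₂, ∫ x : ℝ, (f : Fn2 N) μ m₁ x m₂ = 0) : Φ f = 0 := by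
  have hN : (0 : ℝ) < N := by exact_mod_cast Nat.pos_of_ne_zero (NeZero.ne N)
  have hω : ((N : ℂ) * (I * b)).re < 0 := by
    have : ((N : ℂ) * (I * b)).re = -(N * (b : ℂ).im) := by simp
    rw [this]
    exact neg_lt_zero.mpr (mul_pos hN him)
  choose g h hg hh hgh using fun m₁ m₂ => exists_sub_add_sub (β := 2 * (b : ℂ).re) (by positivity) hω
    (mem_D2_iff.mp f.2 m₁ m₂) (fun w => hf w m₁ m₂)
  set g' : D2 N := ⟨fun μ₁ m₁ μ₂ m₂ => g m₁ m₂ (μ₁, μ₂), mem_D2_iff.mpr hg⟩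
  set h' : D2 N := ⟨fun μ₁ m₁ μ₂ m₂ => h m₁ m₂ (μ₁, μ₂), mem_D2_iff.mpr hh⟩
  have key : f = (U2 N b false 1 0 (U2 N b true 1 0 g') - g') + (U2 N b false N 0 h' - h') := by
    refine Subtype.ext ?_
    funext μ₁ m₁ μ₂ m₂
    have e1 : (U2 N b false 1 0 (U2 N b true 1 0 g') : Fn2 N) μ₁ m₁ μ₂ m₂ =
        g m₁ m₂ (μ₁, μ₂ + (2 * (b : ℂ).re : ℝ) * I) := by
      refine (uab_shift_apply b false 1 _ μ₂ m₂).trans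
        ((uab_shift_apply b true 1 _ _ _).trans ?_)
      have k1 : m₂ - ((1 * sgn false : ℤ) : ZMod N) - ((1 * sgn true : ℤ) : ZMod N) = m₂ := by
        simp [sgn]
      have k2 : μ₂ + (1 : ℤ) * (I * bPar b false) + (1 : ℤ) * (I * bPar b true) =
          μ₂ + (2 * (b : ℂ).re : ℝ) * I := by
        rw [← coe_circle_add_inv]
        simp only [bPar]
        push_cast
        ring
      rw [k1, k2]
      rfl
    have e2 : (U2 N b false N 0 h' : Fn2 N) μ₁ m₁ μ₂ m₂ = h m₁ m₂ (μ₁, μ₂ + N * (I * b)) := by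
      refine (uab_shift_apply b false N _ μ₂ m₂).trans ?_
      simp only [h', sgn, bPar]
      push_cast
      simp
    have h3 := hgh m₁ m₂ μ₁ μ₂
    rw [← e1, ← e2] at h3
    exact h3
  rw [key, map_add, map_sub, map_sub, hΦ, hΦ, hΦ]
  simp

/-- Each component `m₂ = j` is moved to `m₂ = 0` by a power of `u`. There it has the same integral
over `μ₂` as its average times the normalised Gaussian, so the difference is annihilated. -/
lemma ShiftInv2.eq_tensor {b : Circle} (hre : 0 < (b : ℂ).re) (him : 0 < (b : ℂ).im)
    {Φ : D2 N →ₗ[ℂ] ℂ} (hΦ : ShiftInv2 b Φ) (f : D2 N) :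
    Φ f = Φ ⟨tensorFn (avgRight f) (gaussFn N),
      tensorFn_mem_D2 (rapid_avgRight f.2) rapid_gaussFn⟩ := by
  have hfj : ∀ j : ZMod N, (fun μ₁ m₁ μ₂ m₂ => if m₂ = j then (f : Fn2 N) μ₁ m₁ μ₂ m₂ else 0 :
      Fn2 N) ∈ D2 N := by
    intro j
    refine mem_D2_iff.mpr fun m₁ m₂ => ?_
    unfold comp2
    by_cases h : m₂ = j
    · simp only [h, if_true]
      exact mem_D2_iff.mp f.2 m₁ j
    · simpa [h] using (mem_D2_iff.mp f.2 m₁ j).const_mul 0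
  set fj : ZMod N → D2 N := fun j => ⟨_, hfj j⟩ with hfjdef
  set pj : ZMod N → Fn N ℂ := fun j μ m => ∫ x : ℝ, (f : Fn2 N) μ m x j with hpj
  have hpr : ∀ j m, Rapid1 fun μ => pj j μ m := fun j m => (mem_D2_iff.mp f.2 m j).integral_right
  set tj : ZMod N → D2 N := fun j => ⟨tensorFn (pj j) (gaussFn N),
    tensorFn_mem_D2 (hpr j) rapid_gaussFn⟩ with htj
  have e1 : f = ∑ j, fj j := by
    refine Subtype.ext ?_
    rw [AddSubmonoidClass.coe_finsetSum]
    funext μ₁ m₁ μ₂ m₂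
    simp [Finset.sum_apply, hfjdef]
  have e2 : (⟨tensorFn (avgRight f) (gaussFn N),
      tensorFn_mem_D2 (rapid_avgRight f.2) rapid_gaussFn⟩ : D2 N) = ∑ j, tj j := by
    refine Subtype.ext ?_
    rw [AddSubmonoidClass.coe_finsetSum]
    funext μ₁ m₁ μ₂ m₂
    simp [Finset.sum_apply, htj, tensorFn, avgRight, hpj, Finset.sum_mul]
  rw [e2]
  conv_lhs => rw [e1]
  rw [map_sum, map_sum]
  refine Finset.sum_congr rfl fun j _ => ?_
  -- The exponent `-j` evaluates the second discrete variable at `m₂ + j`, which carries the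
  -- component supported at `j` to `0`.
  rw [← hΦ false (-(j.val : ℤ)) (fj j), ← sub_eq_zero, ← map_sub]
  refine hΦ.eq_zero hre him _ fun μ m₁ m₂ => ?_
  have hval : ∀ x : ℂ, (U2 N b false (-(j.val : ℤ)) 0 (fj j) : Fn2 N) μ m₁ x m₂ =
      if m₂ = 0 then (f : Fn2 N) μ m₁ (x + (-(j.val : ℤ) : ℤ) * (I * b)) j else 0 := by
    intro x
    refine (uab_shift_apply b false (-(j.val : ℤ)) _ x m₂).trans ?_
    simp only [hfjdef, sgn, bPar, mul_one]
    have hj : m₂ - ((-(j.val : ℤ) : ℤ) : ZMod N) = m₂ + j := by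
      push_cast
      rw [ZMod.natCast_zmod_val, sub_neg_eq_add]
    rw [hj]
    by_cases h : m₂ = 0
    · simp [h]
    · simp [h]
  have hs : ∀ x : ℝ, ((U2 N b false (-(j.val : ℤ)) 0 (fj j) - tj j : D2 N) : Fn2 N) μ m₁ x m₂ =
      (if m₂ = 0 then (f : Fn2 N) μ m₁ (x + (-(j.val : ℤ) : ℤ) * (I * b)) j else 0) -
        pj j μ m₁ * gaussFn N x m₂ := fun x => by
    rw [← hval]
    rfl
  simp only [hs]
  by_cases h : m₂ = 0
  · have hr : Rapid1 fun x => (f : Fn2 N) μ m₁ x j := (mem_D2_iff.mp f.2 m₁ j).slice μ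
    have i2 : Integrable fun x : ℝ => pj j μ m₁ * gaussFn N x 0 := by
      simpa using ((rapid_gaussFn (N := N) 0).integrable 0).const_mul (pj j μ m₁)
    simp only [h, if_true]
    rw [integral_sub (hr.integrable _) i2, integral_const_mul, integral_gaussFn_zero, mul_one,
      hr.integral_shift, sub_eq_zero]
  · simp [h, gaussFn]

variable (N) in
/-- The tensor square of `gaussFn`. -/
def gaussD2 : D2 N := ⟨tensorFn (gaussFn N) (gaussFn N), tensorFn_mem_D2 rapid_gaussFn rapid_gaussFn⟩

/-- A functional invariant under all shifts is a multiple of the total integral; no continuity is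
needed. -/
theorem eq_totalInt_of_shiftInv {b : Circle} (hre : 0 < (b : ℂ).re) (him : 0 < (b : ℂ).im)
    {Φ : D2 N →ₗ[ℂ] ℂ} (h1 : ShiftInv1 b Φ) (h2 : ShiftInv2 b Φ) (f : D2 N) :
    Φ f = totalInt (f : Fn2 N) * Φ (gaussD2 N) := by
  -- Exchanging the variables turns invariance in the first pair into invariance in the second, so
  -- the same reduction applies twice and only the Gaussian square is left.
  have h3 : ShiftInv2 b (Φ.comp swapD2) := fun t α f => by
    simp only [LinearMap.comp_apply, swapD2_U2, h1 t α]
  rw [h2.eq_tensor hre him f]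
  set g : D2 N := ⟨tensorFn (gaussFn N) (avgRight f),
    tensorFn_mem_D2 rapid_gaussFn (rapid_avgRight f.2)⟩ with hg
  have e : (⟨tensorFn (avgRight f) (gaussFn N),
      tensorFn_mem_D2 (rapid_avgRight f.2) rapid_gaussFn⟩ : D2 N) = swapD2 g := by
    refine Subtype.ext ?_
    funext μ₁ m₁ μ₂ m₂
    exact mul_comm _ _
  rw [e]
  have h4 := h3.eq_tensor hre him g
  simp only [LinearMap.comp_apply] at h4
  rw [h4]
  have e2 : (⟨tensorFn (avgRight g) (gaussFn N),
      tensorFn_mem_D2 (rapid_avgRight g.2) rapid_gaussFn⟩ : D2 N) = totalInt (f : Fn2 N) • gaussD2 N := by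
    refine Subtype.ext ?_
    funext μ₁ m₁ μ₂ m₂
    have : avgRight (g : Fn2 N) μ₁ m₁ = totalInt (f : Fn2 N) * gaussFn N μ₁ m₁ := by
      simp only [hg, avgRight, tensorFn, integral_const_mul, ← Finset.mul_sum, totalInt, avg]
      rw [mul_comm]
    change avgRight (g : Fn2 N) μ₁ m₁ * gaussFn N μ₂ m₂ =
      totalInt (f : Fn2 N) * (gaussFn N μ₁ m₁ * gaussFn N μ₂ m₂)
    rw [this, mul_assoc]
  rw [e2, map_smul, map_smul, smul_eq_mul]
  congr 1
  congr 1
  refine Subtype.ext ?_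
  funext μ₁ m₁ μ₂ m₂
  exact mul_comm _ _

end

section

/-! ### The Gaussian kernel -/

variable (N : ℕ) [NeZero N] (b : Circle)

/-- The quadratic character `(-1)^{n²} e^{πin²/N}` of `ℤ/N`. -/
def gq (n : ZMod N) : ℂ := (-1) ^ (n.val ^ 2) * exp (Real.pi * I / N * (n.val : ℂ) ^ 2)

lemma natCast_ne_zero' : (N : ℂ) ≠ 0 := by exact_mod_cast NeZero.ne N

/-- Both factors combine into `exp (πi(N+1)k²/N)`, which depends only on `k` modulo `N` because
`N(N+1)` is even. The sign `(-1)^{n²}` is what makes the character well defined for odd `N`. -/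
lemma gq_intCast (k : ℤ) : gq N (k : ZMod N) = exp (Real.pi * I * (N + 1) / N * k ^ 2) := by
  have hN := natCast_ne_zero' N
  set v : ℕ := (k : ZMod N).val with hv
  have h1 : ((v : ℤ) : ZMod N) = (k : ZMod N) := by
    rw [hv]; push_cast; exact ZMod.natCast_zmod_val _
  obtain ⟨j, hj⟩ := (ZMod.intCast_eq_intCast_iff_dvd_sub _ _ N).mp h1
  have hk : (k : ℂ) = v + N * j := by
    have : k = v + N * j := by linarith
    rw [this]; push_cast; ring
  have e1 : ((-1 : ℂ)) ^ (v ^ 2) = exp (Real.pi * I * (v : ℂ) ^ 2) := by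
    rw [← exp_pi_mul_I, ← exp_nat_mul]
    congr 1
    push_cast
    ring
  rw [gq, ← hv, e1, ← exp_add, exp_eq_exp_iff_exists_int]
  obtain ⟨c, hc⟩ : Even ((N : ℤ) * (N + 1)) := Int.even_mul_succ_self N
  have hc' : (N : ℂ) * (N + 1) = c + c := by exact_mod_cast hc
  refine ⟨-((N + 1) * v * j + c * j ^ 2), ?_⟩
  rw [hk]
  field_simp
  push_cast
  linear_combination (-(N : ℂ) * j ^ 2) * hc'

/-- The polarisation of the quadratic character is the standard pairing: the surplus factor
`e^{2πimk}` is trivial on integers. -/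
lemma gq_add (m k : ZMod N) : gq N (m + k) = gq N m * gq N k * ZMod.stdAddChar (m * k) := by
  have hN := natCast_ne_zero' N
  obtain ⟨a, rfl⟩ := ZMod.intCast_surjective m
  obtain ⟨c, rfl⟩ := ZMod.intCast_surjective k
  rw [← Int.cast_add, ← Int.cast_mul, gq_intCast, gq_intCast, gq_intCast, ZMod.stdAddChar_coe,
    ← exp_add, ← exp_add, exp_eq_exp_iff_exists_int]
  refine ⟨a * c, ?_⟩
  push_cast
  field_simp
  ring

lemma gq_ne_zero (m : ZMod N) : gq N m ≠ 0 :=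
  mul_ne_zero (pow_ne_zero _ (by norm_num)) (exp_ne_zero _)

/-- The shift `Q = (i/2)(b + b⁻¹)`. -/
def qShift : ℂ := I / 2 * ((b : ℂ) + (b : ℂ)⁻¹)

/-- The integral kernel of the invariant bilinear form, up to normalisation. -/
def kerG : Fn2 N := fun μ₁ m₁ μ₂ m₂ =>
  exp (Real.pi * I / N * (μ₂ - μ₁ - qShift b) ^ 2) * (gq N (m₂ - m₁))⁻¹

lemma kerG_ne_zero (μ₁ : ℂ) (m₁ : ZMod N) (μ₂ : ℂ) (m₂ : ZMod N) : kerG N b μ₁ m₁ μ₂ m₂ ≠ 0 :=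
  mul_ne_zero (exp_ne_zero _) (inv_ne_zero (gq_ne_zero N _))

/-- For real `r` the real part of `irw²` is `-2r Re w Im w`, linear in `Re w` once `Im w` is
bounded. An oscillating Gaussian and its inverse thus preserve rapid decay in strips. -/
lemma Mild2.gauss (r : ℝ) (Q : ℂ) : Mild2 fun z => exp (r * I * (z.2 - z.1 - Q) ^ 2) := by
  refine ⟨by fun_prop, fun R => ⟨Real.exp (2 * |r| * |Q.re| * (2 * R + |Q.im|)),
    2 * |r| * (2 * R + |Q.im|), fun z h1 h2 => ?_⟩⟩
  rw [norm_exp, ← Real.exp_add, Real.exp_le_exp]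
  set w := z.2 - z.1 - Q with hw
  have e : (r * I * w ^ 2).re = -2 * r * (w.re * w.im) := by
    simp [pow_two]; ring
  have hre : |w.re| ≤ |z.1.re| + |z.2.re| + |Q.re| := by
    have q1 := abs_sub (z.2.re - z.1.re) Q.re
    have q2 := abs_sub z.2.re z.1.re
    simp only [hw, sub_re]
    linarith
  have him : |w.im| ≤ 2 * R + |Q.im| := by
    have q1 := abs_sub (z.2.im - z.1.im) Q.im
    have q2 := abs_sub z.2.im z.1.im
    simp only [hw, sub_im]
    linarith
  rw [e]
  calc -2 * r * (w.re * w.im) ≤ |-2 * r * (w.re * w.im)| := le_abs_self _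
    _ = 2 * |r| * (|w.re| * |w.im|) := by simp [abs_mul]
    _ ≤ 2 * |r| * ((|z.1.re| + |z.2.re| + |Q.re|) * (2 * R + |Q.im|)) := by
        gcongr
    _ = _ := by ring

lemma mild_kerG (m₁ m₂ : ZMod N) : Mild2 (comp2 (kerG N b) m₁ m₂) := by
  have h := (Mild2.gauss (Real.pi / N) (qShift b)).mul (Mild2.const (gq N (m₂ - m₁))⁻¹)
  convert h using 2
  simp only [comp2, kerG]
  push_cast
  congr 2
  ring

lemma mild_kerG_inv (m₁ m₂ : ZMod N) : Mild2 (comp2 (fun μ₁ m₁ μ₂ m₂ => (kerG N b μ₁ m₁ μ₂ m₂)⁻¹)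
    m₁ m₂) := by
  have h := (Mild2.gauss (-(Real.pi / N)) (qShift b)).mul (Mild2.const (gq N (m₂ - m₁)))
  convert h using 2
  simp only [comp2, kerG]
  rw [mul_inv, inv_inv, ← exp_neg]
  push_cast
  congr 2
  ring

/-- Multiplication by a function of moderate growth as an operator on `D2`. -/
def mulD2 {N : ℕ} [NeZero N] (A : Fn2 N) (hA : ∀ m₁ m₂, Mild2 (comp2 A m₁ m₂)) :
    Module.End ℂ (D2 N) where
  toFun f := ⟨fun μ₁ m₁ μ₂ m₂ => A μ₁ m₁ μ₂ m₂ * (f : Fn2 N) μ₁ m₁ μ₂ m₂,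
    mem_D2_iff.mpr fun m₁ m₂ => (mem_D2_iff.mp f.2 m₁ m₂).mul_mild (hA m₁ m₂)⟩
  map_add' f g := by
    refine Subtype.ext ?_
    funext μ₁ m₁ μ₂ m₂
    exact mul_add _ _ _
  map_smul' c f := by
    refine Subtype.ext ?_
    funext μ₁ m₁ μ₂ m₂
    exact mul_left_comm _ _ _

/-- Multiplication by the kernel. -/
def opG : Module.End ℂ (D2 N) := mulD2 (kerG N b) (mild_kerG N b)

/-- Multiplication by the inverse of the kernel. -/
def opGinv : Module.End ℂ (D2 N) := mulD2 _ (mild_kerG_inv N b)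

lemma opG_opGinv (f : D2 N) : opG N b (opGinv N b f) = f := by
  refine Subtype.ext ?_
  funext μ₁ m₁ μ₂ m₂
  exact mul_inv_cancel_left₀ (kerG_ne_zero N b _ _ _ _) _

lemma opGinv_opG (f : D2 N) : opGinv N b (opG N b f) = f := by
  refine Subtype.ext ?_
  funext μ₁ m₁ μ₂ m₂
  exact inv_mul_cancel_left₀ (kerG_ne_zero N b _ _ _ _) _

/-! ### Conjugation of the quantum torus by the kernel -/

/-- The operator `u_{α,β} ⊗ u_{γ,δ}` on `D2`. -/
def opW (t : Bool) (α β γ δ : ℤ) : Module.End ℂ (D2 N) := U1 N b t α β * U2 N b t γ δ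

lemma opW_mul (t : Bool) (α β γ δ α' β' γ' δ' : ℤ) : opW N b t α β γ δ * opW N b t α' β' γ' δ' =
    qPar N b t ^ (α * β' - β * α' + (γ * δ' - δ * γ')) •
      opW N b t (α + α') (β + β') (γ + γ') (δ + δ') := by
  have hq := qPar_ne_zero N b t
  have h : opW N b t α β γ δ * opW N b t α' β' γ' δ' =
      (U1 N b t α β * U1 N b t α' β') * (U2 N b t γ δ * U2 N b t γ' δ') := by
    simp only [opW, mul_assoc]
    rw [← mul_assoc (U2 N b t γ δ), ← U1_U2_comm, mul_assoc]
  rw [h, U1_mul, U2_mul, smul_mul_smul_comm, ← zpow_add₀ hq]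
  rfl

lemma opW_zero (t : Bool) : opW N b t 0 0 0 0 = 1 := by
  rw [opW, U1_zero, U2_zero, one_mul]

/-- Completing the square with `n = α - γ`. The cross terms are powers of `y₁` and `y₂⁻¹`; the
quadratic terms `n²b²` and `n²`, continuous and discrete, combine into `𝐪^{n²}`. The offset `Q` is
chosen so that, by `b b⁻¹ = 1`, the linear term is `𝐪^n`; the sign `(-1)^n` comes from `gq`. -/
lemma kerG_shift (t : Bool) (α γ : ℤ) (μ₁ : ℂ) (m₁ : ZMod N) (μ₂ : ℂ) (m₂ : ZMod N) :
    kerG N b μ₁ m₁ μ₂ m₂ = (-qPar N b t) ^ (α - γ) * qPar N b t ^ ((α - γ) ^ 2) *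
      (yVal N b t μ₁ m₁ ^ (α - γ) * yVal N b t μ₂ m₂ ^ (-(α - γ))) *
      kerG N b (μ₁ + α * (I * bPar b t)) (m₁ - (α * sgn t : ℤ))
        (μ₂ + γ * (I * bPar b t)) (m₂ - (γ * sgn t : ℤ)) := by
  have hN := natCast_ne_zero' N
  have hbb := bPar_mul_bPar b t
  have hQ : qShift b = I / 2 * (bPar b t + bPar b (!t)) := by
    cases t <;> simp [qShift, bPar, add_comm]
  obtain ⟨n, hn⟩ : ∃ n : ℤ, n = α - γ := ⟨_, rfl⟩
  obtain rfl : α = n + γ := by linarith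
  rw [← hn]
  have hm : m₂ - ((γ * sgn t : ℤ) : ZMod N) - (m₁ - (((n + γ) * sgn t : ℤ) : ZMod N)) =
      (m₂ - m₁) + ((n * sgn t : ℤ) : ZMod N) := by push_cast; ring
  have hs2 : ((sgn t : ℤ) : ℂ) ^ 2 = 1 := by cases t <;> simp [sgn]
  have hgq : gq N (m₂ - m₁ + ((n * sgn t : ℤ) : ZMod N)) = gq N (m₂ - m₁) *
      ((-1) ^ n * exp (Real.pi * I / N * n ^ 2)) *
      ZMod.stdAddChar ((sgn t : ZMod N) * (m₂ - m₁)) ^ n := by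
    rw [gq_add, gq_intCast]
    congr 1
    · congr 1
      have e1 : ((-1 : ℂ)) ^ n = exp (Real.pi * I * n ^ 2) := by
        have : ((-1 : ℂ)) ^ n = (-1) ^ (n ^ 2) := by
          rcases Int.even_or_odd n with h | h
          · rw [h.neg_one_zpow, (h.pow_of_ne_zero two_ne_zero).neg_one_zpow]
          · rw [h.neg_one_zpow, (h.pow).neg_one_zpow]
        rw [this, ← exp_pi_mul_I, ← exp_int_mul]
        congr 1
        push_cast
        ring
      rw [e1, ← exp_add]
      congr 1
      push_cast
      rw [mul_pow, hs2]
      field_simp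
    · rw [← AddChar.map_zsmul_eq_zpow]
      congr 1
      rw [zsmul_eq_mul]
      push_cast
      ring
  have hy : ∀ (μ : ℂ) (m : ZMod N) (k : ℤ), yVal N b t μ m ^ k =
      ZMod.stdAddChar (-((sgn t : ZMod N) * m)) ^ k * exp (k * (2 * Real.pi / N * bPar b t) * μ) :=
    fun μ m k => yVal_zpow N b t k μ m
  set ω : ZMod N → ℂ := fun m => ZMod.stdAddChar ((sgn t : ZMod N) * m) with hω
  have hω0 : ∀ m, ω m ≠ 0 := fun m => by
    simp only [hω]
    rw [ZMod.stdAddChar_apply]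
    exact Circle.coe_ne_zero _
  have hωs : ZMod.stdAddChar ((sgn t : ZMod N) * (m₂ - m₁)) = ω m₂ * (ω m₁)⁻¹ := by
    simp only [hω]
    rw [mul_sub, AddChar.map_sub_eq_div, div_eq_mul_inv]
  have hωn : ∀ m, (ZMod.stdAddChar (-((sgn t : ZMod N) * m)) : ℂ) = (ω m)⁻¹ := fun m =>
    AddChar.map_neg_eq_inv _ _
  rw [kerG, kerG, hm, hgq, hy, hy, hωs, hωn, hωn]
  have hx : exp (Real.pi * I / N * (μ₂ - μ₁ - qShift b) ^ 2) =
      exp (Real.pi * I / N * (1 + bPar b t ^ 2)) ^ n * exp (Real.pi * I / N * (1 + bPar b t ^ 2)) ^ (n ^ 2) *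
      (exp (n * (2 * Real.pi / N * bPar b t) * μ₁) * exp (((-n : ℤ) : ℂ) * (2 * Real.pi / N * bPar b t) * μ₂)) *
      exp (Real.pi * I / N * (μ₂ + γ * (I * bPar b t) - (μ₁ + ((n + γ : ℤ) : ℂ) * (I * bPar b t)) -
        qShift b) ^ 2) * (exp (Real.pi * I / N * n ^ 2))⁻¹ := by
    rw [← exp_int_mul, ← exp_int_mul, ← exp_neg, ← exp_add, ← exp_add, ← exp_add, ← exp_add, ← exp_add]
    congr 1
    rw [hQ]
    push_cast
    field_simp
    have hI : I ^ 2 = -1 := I_sq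
    have hI3 : I ^ 3 = -I := by rw [pow_succ, hI]; ring
    ring_nf
    simp only [hI, hI3]
    linear_combination (4 * I * n : ℂ) * hbb
  rw [hx]
  have h1 : ((-1 : ℂ)) ^ n ≠ 0 := zpow_ne_zero _ (by norm_num)
  have h2 := exp_ne_zero (Real.pi * I / N * (n : ℂ) ^ 2)
  have h3 := gq_ne_zero N (m₂ - m₁)
  have h4 := hω0 m₁
  have h5 := hω0 m₂
  have h6 : ((-qPar N b t) ^ n : ℂ) = (-1) ^ n * qPar N b t ^ n := by
    rw [← mul_zpow, neg_one_mul]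
  rw [h6]
  simp only [mul_zpow, inv_zpow, zpow_neg, qPar, inv_inv]
  field_simp

end

section

/-! ### Invariant forms and shift invariant functionals -/

variable (N : ℕ) [NeZero N] (b : Circle)

lemma opW_apply (t : Bool) (α β γ δ : ℤ) (f : D2 N) (μ₁ : ℂ) (m₁ : ZMod N) (μ₂ : ℂ)
    (m₂ : ZMod N) : (opW N b t α β γ δ f : Fn2 N) μ₁ m₁ μ₂ m₂ =
      (qPar N b t ^ (-(α * β)) * (qPar N b t ^ (2 * α) * yVal N b t μ₁ m₁) ^ β) *
      ((qPar N b t ^ (-(γ * δ)) * (qPar N b t ^ (2 * γ) * yVal N b t μ₂ m₂) ^ δ) *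
      (f : Fn2 N) (μ₁ + α * (I * bPar b t)) (m₁ - (α * sgn t : ℤ))
        (μ₂ + γ * (I * bPar b t)) (m₂ - (γ * sgn t : ℤ))) := by
  have h : (opW N b t α β γ δ f : Fn2 N) = uab N b t α β (uab2 N b t γ δ f) := rfl
  rw [h, uab_apply, yVal_shift, ← yVal_shift N b t γ μ₂]
  simp only [Pi.smul_apply, uab2, slot2_apply, uab_apply, smul_eq_mul]

/-- Conjugation by the kernel adds powers of `y₁` and `y₂⁻¹` to each relative shift. The prefactor
`(-𝐪)^{α-γ}` carries the signs responsible for the cancellations in the images of `F` and `E`. -/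
lemma opG_opW (t : Bool) (α β γ δ : ℤ) (f : D2 N) : opG N b (opW N b t α β γ δ f) =
    (-qPar N b t) ^ (α - γ) • opW N b t α (β + (α - γ)) γ (δ - (α - γ)) (opG N b f) := by
  have hq := qPar_ne_zero N b t
  refine Subtype.ext ?_
  funext μ₁ m₁ μ₂ m₂
  have h1 : (opG N b (opW N b t α β γ δ f) : Fn2 N) μ₁ m₁ μ₂ m₂ =
    kerG N b μ₁ m₁ μ₂ m₂ * (opW N b t α β γ δ f : Fn2 N) μ₁ m₁ μ₂ m₂ := rfl
  have h2 : ∀ (c : ℂ) (g : D2 N), (c • g : D2 N).1 μ₁ m₁ μ₂ m₂ = c * g.1 μ₁ m₁ μ₂ m₂ :=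
    fun _ _ => rfl
  have h3 : ∀ μ₁ m₁ μ₂ m₂, (opG N b f : Fn2 N) μ₁ m₁ μ₂ m₂ =
    kerG N b μ₁ m₁ μ₂ m₂ * (f : Fn2 N) μ₁ m₁ μ₂ m₂ := fun _ _ _ _ => rfl
  rw [h1, h2, opW_apply, opW_apply, h3, kerG_shift N b t α γ]
  have hy1 := yVal_ne_zero N b t μ₁ m₁
  have hy2 := yVal_ne_zero N b t μ₂ m₂
  generalize hG : kerG N b (μ₁ + α * (I * bPar b t)) (m₁ - (α * sgn t : ℤ))
        (μ₂ + γ * (I * bPar b t)) (m₂ - (γ * sgn t : ℤ)) = G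
  generalize (f : Fn2 N) (μ₁ + α * (I * bPar b t)) (m₁ - (α * sgn t : ℤ))
        (μ₂ + γ * (I * bPar b t)) (m₂ - (γ * sgn t : ℤ)) = v
  generalize yVal N b t μ₁ m₁ = x at *
  generalize yVal N b t μ₂ m₂ = y at *
  generalize qPar N b t = q at *
  generalize (-q) ^ (α - γ) = s
  simp only [mul_zpow, ← zpow_mul]
  have k : q ^ ((α - γ) ^ 2) * q ^ (-(α * β)) * q ^ (2 * α * β) * q ^ (-(γ * δ)) *
      q ^ (2 * γ * δ) = q ^ (-(α * (β + (α - γ)))) * q ^ (2 * α * (β + (α - γ))) *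
      q ^ (-(γ * (δ - (α - γ)))) * q ^ (2 * γ * (δ - (α - γ))) := by
    simp only [← zpow_add₀ hq]
    congr 1
    ring
  have kx : x ^ (β + (α - γ)) = x ^ β * x ^ (α - γ) := zpow_add₀ hy1 _ _
  have ky : y ^ (δ - (α - γ)) = y ^ δ * y ^ (-(α - γ)) := by
    rw [← zpow_add₀ hy2, sub_eq_add_neg]
  rw [kx, ky]
  linear_combination (s * x ^ β * x ^ (α - γ) * y ^ δ * y ^ (-(α - γ)) * G * v) * k

variable (lam₁ lam₂ : ℂˣ)

/-- The coefficient of `F`. -/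
def coefF (t : Bool) : ℂ := -(I * qHalf N b t ^ sgn t / (qPar N b t - (qPar N b t)⁻¹))

/-- The coefficient of `E`. -/
def coefE (t : Bool) : ℂ := -(I * qHalf N b t ^ (-sgn t) / (qPar N b t - (qPar N b t)⁻¹))

lemma repD2_K (t : Bool) :
    repD2 N b lam₁ lam₂ (comulQ N b (gen N b t .K)) = opW N b t (-1) 0 (-1) 0 := by
  refine LinearMap.ext fun f => Subtype.ext ?_
  have h : tensorRep N b lam₁ lam₂ (comulQ N b (gen N b t .K)) =
      uab1 N b t (-1) 0 * uab2 N b t (-1) 0 := by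
    rw [comulQ, liftQ_gen, comulGen, tensorRep_tmul, rep, liftQ_gen, rep, liftQ_gen]
    rfl
  exact congrArg (fun T : Module.End ℂ (Fn2 N) => T f) h

lemma repD2_Kinv (t : Bool) :
    repD2 N b lam₁ lam₂ (comulQ N b (gen N b t .Kinv)) = opW N b t 1 0 1 0 := by
  refine LinearMap.ext fun f => Subtype.ext ?_
  have h : tensorRep N b lam₁ lam₂ (comulQ N b (gen N b t .Kinv)) =
      uab1 N b t 1 0 * uab2 N b t 1 0 := by
    rw [comulQ, liftQ_gen, comulGen, tensorRep_tmul, rep, liftQ_gen, rep, liftQ_gen]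
    rfl
  exact congrArg (fun T : Module.End ℂ (Fn2 N) => T f) h

lemma repD2_F (t : Bool) :
    repD2 N b lam₁ lam₂ (comulQ N b (gen N b t .F)) =
      coefF N b t • (opW N b t 0 1 0 0 + opW N b t 1 0 0 1) := by
  refine LinearMap.ext fun f => Subtype.ext ?_
  have h : tensorRep N b lam₁ lam₂ (comulQ N b (gen N b t .F)) =
      coefF N b t • (uab1 N b t 0 1 * uab2 N b t 0 0 + uab1 N b t 1 0 * uab2 N b t 0 1) := by
    rw [comulQ, liftQ_gen, comulGen, map_add, tensorRep_tmul, tensorRep_tmul, map_one, map_one,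
      rep, liftQ_gen, rep, liftQ_gen, liftQ_gen]
    simp only [repGen, map_smul, mul_one, uab1, uab2, uab_zero, map_one]
    rw [smul_add, mul_smul_comm]
    rfl
  exact congrArg (fun T : Module.End ℂ (Fn2 N) => T f) h

lemma repD2_E (t : Bool) :
    repD2 N b lam₁ lam₂ (comulQ N b (gen N b t .E)) =
      coefE N b t • (lamPar lam₁ t • opW N b t 0 (-1) (-1) 0 + opW N b t 1 (-1) (-1) 0 +
        opW N b t (-1) (-1) (-1) 0 + (lamPar lam₂ t • opW N b t 0 0 0 (-1) +
        opW N b t 0 0 1 (-1) + opW N b t 0 0 (-1) (-1))) := by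
  refine LinearMap.ext fun f => Subtype.ext ?_
  have h : tensorRep N b lam₁ lam₂ (comulQ N b (gen N b t .E)) =
      coefE N b t • (lamPar lam₁ t • (uab1 N b t 0 (-1) * uab2 N b t (-1) 0) +
        uab1 N b t 1 (-1) * uab2 N b t (-1) 0 + uab1 N b t (-1) (-1) * uab2 N b t (-1) 0 +
        (lamPar lam₂ t • (uab1 N b t 0 0 * uab2 N b t 0 (-1)) +
        uab1 N b t 0 0 * uab2 N b t 1 (-1) + uab1 N b t 0 0 * uab2 N b t (-1) (-1))) := by
    rw [comulQ, liftQ_gen, comulGen, map_add, tensorRep_tmul, tensorRep_tmul, map_one,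
      rep, liftQ_gen, rep, liftQ_gen, liftQ_gen]
    simp only [repGen, map_smul, map_add, one_mul, uab1, uab2, uab_zero, smul_add, smul_mul_assoc,
      add_mul]
    rfl
  exact congrArg (fun T : Module.End ℂ (Fn2 N) => T f) h

/-! ### Invariance on generators, before and after conjugation by the kernel -/

variable {N b lam₁ lam₂}

/-- Coproduct, counit and representation are algebra homomorphisms, so the elements for which
invariance holds on all `f` are closed under sums and products. -/
lemma isInvariant_of_gen {Φ : D2 N →ₗ[ℂ] ℂ}
    (h : ∀ t g f, Φ (repD2 N b lam₁ lam₂ (comulQ N b (gen N b t g)) f) = counitGen g * Φ f) :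
    IsInvariant (repD2 N b lam₁ lam₂) Φ := by
  intro ξ
  obtain ⟨x, rfl⟩ := RingQuot.mkAlgHom_surjective ℂ (Rel N b) ξ
  induction x using FreeAlgebra.induction with
  | grade0 r =>
    intro f
    have e : repD2 N b lam₁ lam₂ (comulQ N b (RingQuot.mkAlgHom ℂ (Rel N b)
        (algebraMap ℂ _ r))) f = r • f := by
      refine Subtype.ext ?_
      change tensorRep N b lam₁ lam₂ (comulQ N b (RingQuot.mkAlgHom ℂ (Rel N b)
        (algebraMap ℂ _ r))) f = r • (f : Fn2 N)
      simp only [AlgHom.commutes, Module.algebraMap_end_apply]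
    rw [e, map_smul]
    simp only [AlgHom.commutes, smul_eq_mul]
    rfl
  | grade1 p =>
    intro f
    refine (h p.1 p.2 f).trans ?_
    congr 1
    have e : counitQ N b (QLorentz.gen N b p.1 p.2) = counitGen p.2 := by rw [counitQ, liftQ_gen]
    exact e.symm
  | mul x y hx hy =>
    intro f
    have e : repD2 N b lam₁ lam₂ (comulQ N b (RingQuot.mkAlgHom ℂ (Rel N b) (x * y))) f =
        repD2 N b lam₁ lam₂ (comulQ N b (RingQuot.mkAlgHom ℂ (Rel N b) x))
          (repD2 N b lam₁ lam₂ (comulQ N b (RingQuot.mkAlgHom ℂ (Rel N b) y)) f) := by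
      refine Subtype.ext ?_
      change tensorRep N b lam₁ lam₂ (comulQ N b (RingQuot.mkAlgHom ℂ (Rel N b) (x * y))) f =
        tensorRep N b lam₁ lam₂ _ (tensorRep N b lam₁ lam₂ _ (f : Fn2 N))
      rw [map_mul, map_mul, map_mul]
      rfl
    rw [e, hx, hy, map_mul, map_mul, mul_assoc]
  | add x y hx hy =>
    intro f
    have e : repD2 N b lam₁ lam₂ (comulQ N b (RingQuot.mkAlgHom ℂ (Rel N b) (x + y))) f =
        repD2 N b lam₁ lam₂ (comulQ N b (RingQuot.mkAlgHom ℂ (Rel N b) x)) f +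
          repD2 N b lam₁ lam₂ (comulQ N b (RingQuot.mkAlgHom ℂ (Rel N b) y)) f := by
      refine Subtype.ext ?_
      change tensorRep N b lam₁ lam₂ (comulQ N b (RingQuot.mkAlgHom ℂ (Rel N b) (x + y))) f =
        tensorRep N b lam₁ lam₂ _ f + tensorRep N b lam₁ lam₂ _ (f : Fn2 N)
      rw [map_add, map_add, map_add]
      rfl
    rw [e, map_add, hx, hy, map_add, map_add, add_mul]

lemma IsInvariant.gen {Φ : D2 N →ₗ[ℂ] ℂ} (h : IsInvariant (repD2 N b lam₁ lam₂) Φ)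
    (t : Bool) (g : Gen) (f : D2 N) :
    Φ (repD2 N b lam₁ lam₂ (comulQ N b (QLorentz.gen N b t g)) f) = counitGen g * Φ f := by
  rw [h, counitQ, liftQ_gen]

/-- A shift invariant functional sees only the multiplication part of `u_{α,β} ⊗ u_{γ,δ}`; the power
of `𝐪` comes from moving the shifts to the left. -/
lemma opW_shift_apply {Φ : D2 N →ₗ[ℂ] ℂ} (h1 : ShiftInv1 b Φ) (h2 : ShiftInv2 b Φ)
    (t : Bool) (α β γ δ : ℤ) (f : D2 N) :
    Φ (opW N b t α β γ δ f) = qPar N b t ^ (-(α * β + γ * δ)) * Φ (opW N b t 0 β 0 δ f) := by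
  have hq := qPar_ne_zero N b t
  have h := congrArg (fun T : Module.End ℂ (D2 N) => Φ (T f)) (opW_mul N b t α 0 γ 0 0 β 0 δ)
  have e : Φ ((opW N b t α 0 γ 0 * opW N b t 0 β 0 δ) f) = Φ (opW N b t 0 β 0 δ f) := by
    have : (opW N b t α 0 γ 0 * opW N b t 0 β 0 δ) f =
      U1 N b t α 0 (U2 N b t γ 0 (opW N b t 0 β 0 δ f)) := rfl
    rw [this, h1, h2]
  simp only [e, LinearMap.smul_apply, map_smul, smul_eq_mul, add_zero, zero_add, zero_mul,
    sub_zero] at h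
  rw [h, zpow_neg, inv_mul_cancel_left₀ (zpow_ne_zero _ hq)]

/-- The value of a functional `Φ₁ ∘ G`, with `Φ₁` shift invariant, on the image of `E`. -/
lemma apply_repD2_E {Φ : D2 N →ₗ[ℂ] ℂ} (h1 : ShiftInv1 b Φ) (h2 : ShiftInv2 b Φ)
    (t : Bool) (f : D2 N) :
    Φ (opG N b (repD2 N b lam₁ lam₂ (comulQ N b (gen N b t .E)) f)) =
      coefE N b t * ((lamPar lam₂ t - lamPar lam₁ t) * Φ (opW N b t 0 0 0 (-1) (opG N b f))) := by
  have hq := qPar_ne_zero N b t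
  simp only [repD2_E, LinearMap.smul_apply, LinearMap.add_apply, map_smul, map_add, opG_opW,
    smul_eq_mul]
  norm_num
  left
  -- After the shifts are stripped, the four terms without `λ` are `±𝐪⁻¹` times the values at `y₁
  -- y₂⁻²` and at `y₁⁻¹`, each occurring once with either sign. The two terms with `λ` are both
  -- multiples of the value at `y₂⁻¹`.
  rw [opW_shift_apply h1 h2 t 0 0 (-1) (-1), opW_shift_apply h1 h2 t 1 1 (-1) (-2),
    opW_shift_apply h1 h2 t (-1) (-1) (-1) 0, opW_shift_apply h1 h2 t 0 (-1) 1 0,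
    opW_shift_apply h1 h2 t 0 1 (-1) (-2)]
  norm_num
  field_simp
  ring

/-- Conjugation turns the second term of `ΔF` into `-𝐪 u_{1,1} ⊗ 1 = -u₁ y₁`, leaving `(1 - u₁) y₁`
up to the coefficient. No invariance of `Φ` enters, so the identity can be used in both directions.
-/
lemma apply_repD2_F {Φ : D2 N →ₗ[ℂ] ℂ} (t : Bool) (f : D2 N) :
    Φ (opG N b (repD2 N b lam₁ lam₂ (comulQ N b (gen N b t .F)) f)) =
      coefF N b t * (Φ (opW N b t 0 1 0 0 (opG N b f)) -
        Φ (U1 N b t 1 0 (opW N b t 0 1 0 0 (opG N b f)))) := by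
  have hq := qPar_ne_zero N b t
  have h : U1 N b t 1 0 (opW N b t 0 1 0 0 (opG N b f)) =
      qPar N b t • opW N b t 1 1 0 0 (opG N b f) := by
    have := congrArg (fun T : Module.End ℂ (D2 N) => T (opG N b f))
      (opW_mul N b t 1 0 0 0 0 1 0 0)
    simpa [opW, U2_zero] using this
  rw [h]
  simp only [repD2_F, LinearMap.smul_apply, LinearMap.add_apply, map_smul, map_add, opG_opW,
    smul_eq_mul]
  norm_num
  left
  ring

theorem isInvariant_comp_opG {Φ : D2 N →ₗ[ℂ] ℂ} (h1 : ShiftInv1 b Φ) (h2 : ShiftInv2 b Φ)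
    (hlam : ∀ t, lamPar lam₁ t = lamPar lam₂ t) :
    IsInvariant (repD2 N b lam₁ lam₂) (Φ.comp (opG N b)) := by
  refine isInvariant_of_gen fun t g f => ?_
  cases g with
  | E => simp [apply_repD2_E h1 h2, hlam, counitGen]
  | F => simp [apply_repD2_F, counitGen, h1 t]
  | K =>
    have e : opG N b (opW N b t (-1) 0 (-1) 0 f) = U1 N b t (-1) 0 (U2 N b t (-1) 0 (opG N b f)) := by
      rw [opG_opW]; simp [opW]
    simp only [repD2_K, LinearMap.comp_apply, e, h1 t, h2 t, counitGen, one_mul]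
  | Kinv =>
    have e : opG N b (opW N b t 1 0 1 0 f) = U1 N b t 1 0 (U2 N b t 1 0 (opG N b f)) := by
      rw [opG_opW]; simp [opW]
    simp only [repD2_Kinv, LinearMap.comp_apply, e, h1 t, h2 t, counitGen, one_mul]

/-- Otherwise `𝐪² = 1` and `|𝐪| = 1`, whereas `|𝐪| = e^{-π Im(b^{±2})/N}` and `Im b^{±2} = ±2 Re b
Im b` is nonzero. -/
lemma qPar_sub_inv_ne_zero (hre : 0 < (b : ℂ).re) (him : 0 < (b : ℂ).im) (t : Bool) :
    qPar N b t - (qPar N b t)⁻¹ ≠ 0 := by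
  have hN := natCast_ne_zero' N
  have hN' : (N : ℝ) ≠ 0 := by exact_mod_cast hN
  intro h
  have hq := qPar_ne_zero N b t
  have h1 : qPar N b t * qPar N b t = 1 := by
    rw [sub_eq_zero] at h
    conv_lhs => rw [h]
    rw [inv_mul_eq_one₀ (a := qPar N b t) (b := (qPar N b t)⁻¹) hq] at *
    simpa using h
  have him2 : (bPar b t ^ 2).im ≠ 0 := by
    cases t with
    | false =>
      have : (bPar b false ^ 2).im = 2 * ((b : ℂ).re * (b : ℂ).im) := by
        simp [bPar, pow_two]; ring
      rw [this]
      positivity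
    | true =>
      have : (bPar b true ^ 2).im = -(2 * ((b : ℂ).re * (b : ℂ).im)) := by
        rw [bPar, ← Circle.coe_inv, Circle.coe_inv_eq_conj]
        simp [pow_two]; ring
      rw [this]
      exact neg_ne_zero.mpr (by positivity)
  have h2 : ‖qPar N b t‖ = 1 := by
    have := congrArg norm h1
    rw [norm_mul, norm_one] at this
    nlinarith [norm_nonneg (qPar N b t)]
  rw [qPar, norm_exp, Real.exp_eq_one_iff] at h2
  have h3 : (Real.pi * I / N * (1 + bPar b t ^ 2) : ℂ).re = -(Real.pi / N) * (bPar b t ^ 2).im := by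
    have : (Real.pi * I / N * (1 + bPar b t ^ 2) : ℂ) =
        ((Real.pi / N : ℝ) : ℂ) * (I * (1 + bPar b t ^ 2)) := by push_cast; ring
    rw [this, re_ofReal_mul]
    simp
  rw [h3] at h2
  exact mul_ne_zero (neg_ne_zero.mpr (div_ne_zero Real.pi_ne_zero hN')) him2 h2

lemma coefE_ne_zero (hre : 0 < (b : ℂ).re) (him : 0 < (b : ℂ).im) (t : Bool) : coefE N b t ≠ 0 :=
  neg_ne_zero.mpr (div_ne_zero (mul_ne_zero I_ne_zero (zpow_ne_zero _ (qHalf_ne_zero N b t)))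
    (qPar_sub_inv_ne_zero hre him t))

lemma coefF_ne_zero (hre : 0 < (b : ℂ).re) (him : 0 < (b : ℂ).im) (t : Bool) : coefF N b t ≠ 0 :=
  neg_ne_zero.mpr (div_ne_zero (mul_ne_zero I_ne_zero (zpow_ne_zero _ (qHalf_ne_zero N b t)))
    (qPar_sub_inv_ne_zero hre him t))

/-- Invariance under `F` and `K⁻¹` of `Φ₁ ∘ G` is invariance of `Φ₁` under all shifts. -/
theorem IsInvariant.shiftInv (hre : 0 < (b : ℂ).re) (him : 0 < (b : ℂ).im) {Φ : D2 N →ₗ[ℂ] ℂ}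
    (h : IsInvariant (repD2 N b lam₁ lam₂) Φ) :
    ShiftInv1 b (Φ.comp (opGinv N b)) ∧ ShiftInv2 b (Φ.comp (opGinv N b)) := by
  have hG : ∀ f, Φ f = (Φ.comp (opGinv N b)) (opG N b f) := fun f => by
    rw [LinearMap.comp_apply, opGinv_opG]
  set Φ₁ := Φ.comp (opGinv N b)
  have a1 : ∀ t f, Φ₁ (U1 N b t 1 0 f) = Φ₁ f := by
    intro t f
    -- Since `y₁` is invertible, an arbitrary `f` is reached by testing `F` on the vector
    -- corresponding to `y₁⁻¹ f`.
    have h3 := h.gen t .F (opGinv N b (opW N b t 0 (-1) 0 0 f))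
    rw [hG, apply_repD2_F, opG_opGinv] at h3
    have e : opW N b t 0 1 0 0 (opW N b t 0 (-1) 0 0 f) = f := by
      rw [← Module.End.mul_apply, opW_mul]
      norm_num [opW_zero]
    rw [e, counitGen, zero_mul] at h3
    have h4 := (mul_eq_zero.mp h3).resolve_left (coefF_ne_zero hre him t)
    exact (sub_eq_zero.mp h4).symm
  have h1 : ShiftInv1 b Φ₁ := fun t =>
    comp_shift_of_one (A := fun α => U1 N b t α 0) (U1_zero b t) (U1_shift_mul b t) (a1 t)
  refine ⟨h1, fun t => comp_shift_of_one (A := fun α => U2 N b t α 0) (U2_zero b t)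
    (U2_shift_mul b t) fun f => ?_⟩
  have h3 := h.gen t .Kinv (opGinv N b f)
  have e : opG N b (opW N b t 1 0 1 0 (opGinv N b f)) = U1 N b t 1 0 (U2 N b t 1 0 f) := by
    rw [opG_opW, opG_opGinv]; simp [opW]
  rw [hG, hG (opGinv N b f), repD2_Kinv, e, h1 t, opG_opGinv, counitGen, one_mul] at h3
  exact h3

lemma eq_or_eq_inv_of_lamPar (h : lamPar lam₁ false = lamPar lam₂ false) :
    lam₁ = lam₂ ∨ lam₁ = lam₂⁻¹ := by
  have h1 := lam₁.ne_zero
  have h2 := lam₂.ne_zero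
  simp only [lamPar] at h
  have h3 : ((lam₁ : ℂ) - lam₂) * ((lam₁ : ℂ) * lam₂ - 1) = 0 := by
    field_simp at h
    linear_combination h
  rcases mul_eq_zero.mp h3 with h4 | h4
  · exact Or.inl (Units.ext (sub_eq_zero.mp h4))
  · refine Or.inr (eq_inv_of_mul_eq_one_left (Units.ext ?_))
    simpa using sub_eq_zero.mp h4

lemma lamPar_eq (h : lam₁ = lam₂ ∨ lam₁ = lam₂⁻¹) (t : Bool) : lamPar lam₁ t = lamPar lam₂ t := by
  rcases h with rfl | rfl
  · rfl
  · cases t <;> simp [lamPar, add_comm]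

/-- If `λ₁ + λ₁⁻¹` and `λ₂ + λ₂⁻¹` differ, invariance under `E` forces `Φ₁ ∘ y₂⁻¹ = 0`, hence `Φ =
0` because `y₂` is invertible. The untilded copy alone suffices here. -/
theorem IsInvariant.eq_or_eq_inv (hre : 0 < (b : ℂ).re) (him : 0 < (b : ℂ).im)
    {Φ : D2 N →ₗ[ℂ] ℂ} (h : IsInvariant (repD2 N b lam₁ lam₂) Φ) (h0 : Φ ≠ 0) :
    lam₁ = lam₂ ∨ lam₁ = lam₂⁻¹ := by
  obtain ⟨h1, h2⟩ := h.shiftInv hre him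
  refine eq_or_eq_inv_of_lamPar ?_
  by_contra hne
  refine h0 (LinearMap.ext fun f => ?_)
  have h3 := h.gen false .E (opGinv N b (opW N b false 0 0 0 1 (opG N b f)))
  have hG : ∀ f, Φ f = (Φ.comp (opGinv N b)) (opG N b f) := fun f => by
    rw [LinearMap.comp_apply, opGinv_opG]
  have e : opW N b false 0 0 0 (-1) (opW N b false 0 0 0 1 (opG N b f)) = opG N b f := by
    rw [← Module.End.mul_apply, opW_mul]
    norm_num [opW_zero]
  rw [hG, apply_repD2_E h1 h2, opG_opGinv, e, ← hG, counitGen, zero_mul] at h3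
  have h4 := (mul_eq_zero.mp h3).resolve_left (coefE_ne_zero hre him false)
  exact (mul_eq_zero.mp h4).resolve_left (sub_ne_zero.mpr (Ne.symm hne))

end

/-! ### The total integral as a shift invariant functional -/

section TotalIntegral

variable {N : ℕ} [NeZero N]

lemma avg_add {φ ψ : Fn N ℂ} (hφ : ∀ m, Rapid1 fun μ => φ μ m) (hψ : ∀ m, Rapid1 fun μ => ψ μ m) :
    avg (φ + ψ) = avg φ + avg ψ := by
  simp only [avg, ← Finset.sum_add_distrib]
  refine Finset.sum_congr rfl fun j _ => ?_
  have h1 : Integrable fun x : ℝ => φ x j := by simpa using (hφ j).integrable 0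
  have h2 : Integrable fun x : ℝ => ψ x j := by simpa using (hψ j).integrable 0
  exact integral_add h1 h2

lemma avg_smul (c : ℂ) (φ : Fn N ℂ) : avg (c • φ) = c * avg φ := by
  simp only [avg, Finset.mul_sum]
  exact Finset.sum_congr rfl fun j _ => integral_const_mul c fun x : ℝ => φ x j

lemma avg_shift {φ : Fn N ℂ} (hφ : ∀ m, Rapid1 fun μ => φ μ m) (d : ℂ) (s : ZMod N) :
    avg (fun μ m => φ (μ + d) (m - s)) = avg φ := by
  simp only [avg]
  rw [← (Equiv.subRight s).sum_comp fun j => ∫ x : ℝ, φ x j]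
  exact Finset.sum_congr rfl fun j _ => (hφ _).integral_shift d

lemma rapid_of_mem_D2 {f : Fn2 N} (hf : f ∈ D2 N) (μ : ℂ) (m j : ZMod N) :
    Rapid1 fun x => f μ m x j := (mem_D2_iff.mp hf m j).slice μ

variable (N) in
/-- The sum of the integrals over all components as a linear functional on `D2`. -/
def intD2 : D2 N →ₗ[ℂ] ℂ where
  toFun f := totalInt (f : Fn2 N)
  map_add' f g := by
    have e : avgRight ((f + g : D2 N) : Fn2 N) = avgRight (f : Fn2 N) + avgRight (g : Fn2 N) := by
      funext μ m
      exact avg_add (rapid_of_mem_D2 f.2 μ m) (rapid_of_mem_D2 g.2 μ m)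
    rw [totalInt, e, avg_add (rapid_avgRight f.2) (rapid_avgRight g.2)]
    rfl
  map_smul' c f := by
    have e : avgRight ((c • f : D2 N) : Fn2 N) = c • avgRight (f : Fn2 N) := by
      funext μ m
      exact avg_smul c _
    rw [totalInt, e, avg_smul]
    rfl

lemma intD2_apply (f : D2 N) : intD2 N f = totalInt (f : Fn2 N) := rfl

lemma shiftInv1_intD2 (b : Circle) : ShiftInv1 b (intD2 N) := by
  intro t α f
  rw [intD2_apply, intD2_apply, totalInt, totalInt,
    ← avg_shift (rapid_avgRight f.2) (α * (I * bPar b t)) ((α * sgn t : ℤ) : ZMod N)]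
  congr 1
  funext μ m
  have h : (U1 N b t α 0 f : Fn2 N) μ m =
      (f : Fn2 N) (μ + α * (I * bPar b t)) (m - (α * sgn t : ℤ)) := uab_shift_apply b t α _ μ m
  simp only [avgRight, h]

lemma shiftInv2_intD2 (b : Circle) : ShiftInv2 b (intD2 N) := by
  intro t α f
  rw [intD2_apply, intD2_apply, totalInt, totalInt]
  congr 1
  funext μ m
  have h : (U2 N b t α 0 f : Fn2 N) μ m = fun μ' m' =>
      (f : Fn2 N) μ m (μ' + α * (I * bPar b t)) (m' - (α * sgn t : ℤ)) := by
    funext μ' m'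
    exact uab_shift_apply b t α _ μ' m'
  change avg ((U2 N b t α 0 f : Fn2 N) μ m) = avg ((f : Fn2 N) μ m)
  rw [h]
  exact avg_shift (rapid_of_mem_D2 f.2 μ m) _ _

lemma intD2_gaussD2 : intD2 N (gaussD2 N) = 1 := by
  have e : avgRight (gaussD2 N : Fn2 N) = gaussFn N := by
    funext μ m
    have : avgRight (gaussD2 N : Fn2 N) μ m = avg (gaussFn N μ m • gaussFn N) := rfl
    rw [this, avg_smul, avg_gaussFn, mul_one]
  rw [intD2_apply, totalInt, e, avg_gaussFn]

end TotalIntegral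

/-! ### The invariant form and its continuity -/

section Form

variable (N : ℕ) [NeZero N] (b : Circle)

/-- The invariant form on `Dbar2`, up to normalisation. -/
def formDbar2 : Dbar2 N →ₗ[ℂ] ℂ :=
  ((intD2 N).comp (opG N b)).comp (Submodule.inclusion (Dbar2_le_D2 N))

variable {N b} in
lemma IsInvariant.comp_inclusion {lam₁ lam₂ : ℂˣ} {Φ : D2 N →ₗ[ℂ] ℂ}
    (h : IsInvariant (repD2 N b lam₁ lam₂) Φ) :
    IsInvariant (repDbar2 N b lam₁ lam₂) (Φ.comp (Submodule.inclusion (Dbar2_le_D2 N))) :=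
  fun ξ f => h ξ (Submodule.inclusion (Dbar2_le_D2 N) f)

variable {N b} in
lemma IsInvariant.restrict {lam₁ lam₂ : ℂˣ} {Ψ : Dbar2 N →ₗ[ℂ] ℂ}
    (h : IsInvariant (repDbar2 N b lam₁ lam₂) Ψ) :
    IsInvariant (repD2 N b lam₁ lam₂) (Ψ.comp (Submodule.inclusion (D2_le_Dbar2 N))) :=
  fun ξ f => h ξ (Submodule.inclusion (D2_le_Dbar2 N) f)

lemma norm_stdAddChar (m : ZMod N) : ‖(ZMod.stdAddChar m : ℂ)‖ = 1 := by
  rw [ZMod.stdAddChar_apply]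
  exact Circle.norm_coe _

lemma norm_gq (n : ZMod N) : ‖gq N n‖ = 1 := by
  rw [gq, norm_mul, norm_pow, norm_neg, norm_one, one_pow, one_mul, norm_exp,
    Real.exp_eq_one_iff]
  have : (Real.pi * I / N * (n.val : ℂ) ^ 2) = ((Real.pi / N * (n.val : ℝ) ^ 2 : ℝ) : ℂ) * I := by
    push_cast; ring
  rw [this, re_ofReal_mul, I_re, mul_zero]

lemma qShift_eq : qShift b = ((b : ℂ).re : ℝ) * I := by
  rw [qShift, coe_circle_add_inv]
  push_cast
  ring

/-- On real arguments only the cross term with `Q = i Re b` contributes to the modulus. The growth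
rate `2π Re b / N` is also that of `|y|`, which allows the kernel to be dominated by integer powers
of `y₁` and `y₂`. -/
lemma norm_kerG_ofReal (x₁ : ℝ) (m₁ : ZMod N) (x₂ : ℝ) (m₂ : ZMod N) :
    ‖kerG N b x₁ m₁ x₂ m₂‖ = Real.exp (2 * Real.pi * (b : ℂ).re / N * (x₂ - x₁)) := by
  rw [kerG, norm_mul, norm_inv, norm_gq, inv_one, mul_one, norm_exp, qShift_eq]
  congr 1
  have : Real.pi * I / N * (x₂ - x₁ - ((b : ℂ).re : ℝ) * I) ^ 2 =
      ((Real.pi / N : ℝ) : ℂ) * (I * (((x₂ - x₁ : ℝ) : ℂ) - ((b : ℂ).re : ℝ) * I) ^ 2) := by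
    push_cast; ring
  rw [this, re_ofReal_mul]
  simp [pow_two]
  ring

lemma norm_yVal_zpow_ofReal (β : ℤ) (x : ℝ) (m : ZMod N) :
    ‖yVal N b false x m ^ β‖ = Real.exp (2 * Real.pi * (b : ℂ).re / N * (β * x)) := by
  rw [yVal_zpow, norm_mul, norm_zpow, norm_stdAddChar, one_zpow, one_mul, norm_exp]
  congr 1
  have : (β * (2 * Real.pi / N * bPar b false) * x : ℂ) =
      ((β * (2 * Real.pi / N) * x : ℝ) : ℂ) * (b : ℂ) := by
    simp only [bPar]; push_cast; ring
  rw [this, re_ofReal_mul]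
  ring

/-! ### Bounding the form by finitely many Fréchet seminorms -/

lemma integral_norm_mul_norm_le {α : Type*} [MeasurableSpace α] {μ : Measure α} {f g : α → ℂ}
    (hf : MemLp f 2 μ) (hg : MemLp g 2 μ) :
    ∫ x, ‖f x‖ * ‖g x‖ ∂μ ≤ ‖hf.toLp f‖ * ‖hg.toLp g‖ := by
  have h2 : ENNReal.ofReal 2 = 2 := by simp
  have h := integral_mul_norm_le_Lp_mul_Lq (μ := μ) (f := f) (g := g) Real.HolderConjugate.two_two
    (by rwa [h2]) (by rwa [h2])
  have hn : ∀ {f : α → ℂ} (hf : MemLp f 2 μ), ‖hf.toLp f‖ = (∫ x, ‖f x‖ ^ (2 : ℝ) ∂μ) ^ (1 / 2 : ℝ) := by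
    intro f hf
    rw [Lp.norm_toLp, hf.eLpNorm_eq_integral_rpow_norm (by norm_num) (by norm_num),
      ENNReal.toReal_ofReal (Real.rpow_nonneg (integral_nonneg fun x => by positivity) _)]
    norm_num
  rwa [hn, hn]

lemma exp_abs_le (x : ℝ) : Real.exp |x| ≤ Real.exp x + Real.exp (-x) := by
  rcases abs_cases x with h | h <;> rw [h.1]
  · linarith [Real.exp_pos (-x)]
  · linarith [Real.exp_pos x]

/-- The operator `y₁^β₁ y₂^β₂` on `Dbar2`. -/
def opY (p : ℤ × ℤ) : Module.End ℂ (Dbar2 N) :=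
  ((uab1 N b false 0 p.1).restrict (uab1_mem_Dbar2 N b false 0 p.1)) ∘ₗ
      ((uab2 N b false 0 p.2).restrict (uab2_mem_Dbar2 N b false 0 p.2))

lemma norm_opY (p : ℤ × ℤ) (f : Dbar2 N) (x₁ : ℝ) (m₁ : ZMod N) (x₂ : ℝ) (m₂ : ZMod N) :
    ‖(opY N b p f : Fn2 N) x₁ m₁ x₂ m₂‖ =
      Real.exp (2 * Real.pi * (b : ℂ).re / N * (p.1 * x₁ + p.2 * x₂)) *
        ‖(f : Fn2 N) x₁ m₁ x₂ m₂‖ := by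
  have h : (opY N b p f : Fn2 N) = uab N b false 0 p.1 (uab2 N b false 0 p.2 f) := rfl
  rw [h, uab_apply]
  simp only [Pi.smul_apply, uab2, slot2_apply, uab_apply, smul_eq_mul]
  simp only [Int.cast_zero, zero_mul, neg_zero, zpow_zero, one_mul, add_zero, sub_zero, norm_mul,
    norm_yVal_zpow_ofReal]
  rw [mul_add, Real.exp_add]
  ring

lemma frechetSeminorm_zero (p : ℤ × ℤ) (f : Dbar2 N) :
    frechetSeminorm N b ((0, p.1), (0, p.2)) f = ‖toL2 N (opY N b p f)‖ := rfl

/-- The exponents `-1 ± n`, `1 ± n` used to bound the invariant form. -/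
def expo (n : ℕ) (s : Bool × Bool) : ℤ × ℤ := (-1 + sgn s.1 * n, 1 + sgn s.2 * n)

/-- The exponents `-1` and `1` reproduce the modulus of the kernel. The four choices of `±n` sum to
a product of terms `e^{Anx} + e^{-Anx}`, `A = 2π Re b / N`, which dominates `e^{|x₁| + |x₂|}` as
soon as `An ≥ 1`; this pays for the square integrable weight required by Cauchy–Schwarz. -/
lemma norm_kerG_mul_le {n : ℕ} (hn : 1 ≤ 2 * Real.pi * (b : ℂ).re / N * n) (f : Dbar2 N)
    (x : ℝ × ℝ) (m₁ m₂ : ZMod N) :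
    ‖kerG N b x.1 m₁ x.2 m₂ * (f : Fn2 N) x.1 m₁ x.2 m₂‖ ≤ ∑ s : Bool × Bool,
      (Real.exp (-|x.1|) * Real.exp (-|x.2|)) *
        ‖(opY N b (expo n s) f : Fn2 N) x.1 m₁ x.2 m₂‖ := by
  obtain ⟨x₁, x₂⟩ := x
  set A := 2 * Real.pi * (b : ℂ).re / N with hA
  have key : ∀ y : ℝ, Real.exp |y| ≤ Real.exp (A * n * y) + Real.exp (-(A * n * y)) := by
    intro y
    refine le_trans (Real.exp_le_exp.mpr ?_) (exp_abs_le _)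
    rw [abs_mul]
    exact le_mul_of_one_le_left (abs_nonneg y) (hn.trans (le_abs_self _))
  rw [← Finset.mul_sum, norm_mul, norm_kerG_ofReal]
  simp only [norm_opY, ← Finset.sum_mul, ← hA]
  set v := ‖(f : Fn2 N) x₁ m₁ x₂ m₂‖
  have hs : ∑ s : Bool × Bool, Real.exp (A * ((expo n s).1 * x₁ + (expo n s).2 * x₂)) =
      Real.exp (A * (x₂ - x₁)) * ((Real.exp (A * n * x₁) + Real.exp (-(A * n * x₁))) *
        (Real.exp (A * n * x₂) + Real.exp (-(A * n * x₂)))) := by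
    simp only [add_mul, mul_add, ← Real.exp_add, Fintype.sum_prod_type, Fintype.sum_bool, expo, sgn]
    push_cast
    ring_nf
  rw [hs]
  have h1 : 1 ≤ Real.exp (-|x₁|) * Real.exp (-|x₂|) *
      ((Real.exp (A * n * x₁) + Real.exp (-(A * n * x₁))) *
        (Real.exp (A * n * x₂) + Real.exp (-(A * n * x₂)))) := by
    calc (1 : ℝ) = Real.exp (-|x₁|) * Real.exp (-|x₂|) * (Real.exp |x₁| * Real.exp |x₂|) := by
          simp only [← Real.exp_add]; ring_nf; simp
      _ ≤ _ := by
          have := key x₁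
          have := key x₂
          gcongr
  calc Real.exp (A * (x₂ - x₁)) * v = 1 * (Real.exp (A * (x₂ - x₁)) * v) := by ring
    _ ≤ _ * (Real.exp (A * (x₂ - x₁)) * v) := mul_le_mul_of_nonneg_right h1 (by positivity)
    _ = _ := by ring

/-- The weight function as a complex valued square integrable function. -/
lemma memLp_weight : MemLp (fun x : ℝ × ℝ => ((Real.exp (-|x.1|) * Real.exp (-|x.2|) : ℝ) : ℂ)) 2
    volume := memLp_exp_neg_abs.ofReal

lemma norm_toL2_component_le (f : Dbar2 N) (m₁ m₂ : ZMod N) :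
    ‖(memLp_of_mem_Dbar2 N f.2 m₁ m₂).toLp _‖ ≤ ‖toL2 N f‖ :=
  PiLp.norm_apply_le (toL2 N f) (m₁, m₂)

lemma norm_integral_kerG_le {n : ℕ} (hn : 1 ≤ 2 * Real.pi * (b : ℂ).re / N * n) (f : Dbar2 N)
    (m₁ m₂ : ZMod N) :
    Integrable (fun x : ℝ × ℝ => kerG N b x.1 m₁ x.2 m₂ * (f : Fn2 N) x.1 m₁ x.2 m₂) ∧
    ‖∫ x : ℝ × ℝ, kerG N b x.1 m₁ x.2 m₂ * (f : Fn2 N) x.1 m₁ x.2 m₂‖ ≤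
      ∑ s : Bool × Bool, ‖memLp_weight.toLp _‖ * ‖toL2 N (opY N b (expo n s) f)‖ := by
  have hm : ∀ s, MemLp (fun x : ℝ × ℝ => (opY N b (expo n s) f : Fn2 N) x.1 m₁ x.2 m₂) 2 volume :=
    fun s => memLp_of_mem_Dbar2 N (opY N b (expo n s) f).2 m₁ m₂
  have hw : ∀ x : ℝ × ℝ, ‖((Real.exp (-|x.1|) * Real.exp (-|x.2|) : ℝ) : ℂ)‖ =
      Real.exp (-|x.1|) * Real.exp (-|x.2|) := fun x => by
    rw [norm_real, Real.norm_of_nonneg (by positivity)]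
  have hi : ∀ s, Integrable fun x : ℝ × ℝ => (Real.exp (-|x.1|) * Real.exp (-|x.2|)) *
      ‖(opY N b (expo n s) f : Fn2 N) x.1 m₁ x.2 m₂‖ := fun s =>
    memLp_exp_neg_abs.integrable_mul (hm s).norm
  have hb := fun x => norm_kerG_mul_le N b hn f x m₁ m₂
  have hc : Continuous fun x : ℝ × ℝ => kerG N b x.1 m₁ x.2 m₂ * (f : Fn2 N) x.1 m₁ x.2 m₂ := by
    have h1 := ((mild_kerG N b m₁ m₂).diff.mul (f.2.1 m₁ m₂)).continuous
    exact h1.comp (f := fun x : ℝ × ℝ => ((x.1, x.2) : ℂ × ℂ)) (by fun_prop)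
  have hS : Integrable fun x : ℝ × ℝ => ∑ s : Bool × Bool, (Real.exp (-|x.1|) * Real.exp (-|x.2|)) *
      ‖(opY N b (expo n s) f : Fn2 N) x.1 m₁ x.2 m₂‖ := integrable_finsetSum _ fun s _ => hi s
  refine ⟨hS.mono' hc.aestronglyMeasurable (Filter.Eventually.of_forall hb), ?_⟩
  refine (norm_integral_le_of_norm_le hS (Filter.Eventually.of_forall hb)).trans ?_
  rw [integral_finsetSum _ fun s _ => hi s]
  refine Finset.sum_le_sum fun s _ => ?_
  have h1 := integral_norm_mul_norm_le memLp_weight (hm s)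
  simp only [hw] at h1
  exact h1.trans (mul_le_mul_of_nonneg_left (norm_toL2_component_le N _ m₁ m₂) (norm_nonneg _))

lemma exists_expo (hre : 0 < (b : ℂ).re) : ∃ n : ℕ, 1 ≤ 2 * Real.pi * (b : ℂ).re / N * n := by
  have hN : (0 : ℝ) < N := by exact_mod_cast Nat.pos_of_ne_zero (NeZero.ne N)
  obtain ⟨n, hn⟩ := exists_nat_ge (2 * Real.pi * (b : ℂ).re / N)⁻¹
  refine ⟨n, ?_⟩
  have hA : 0 < 2 * Real.pi * (b : ℂ).re / N := by positivity
  calc 1 = 2 * Real.pi * (b : ℂ).re / N * (2 * Real.pi * (b : ℂ).re / N)⁻¹ :=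
        (mul_inv_cancel₀ hA.ne').symm
    _ ≤ _ := by gcongr

lemma formDbar2_eq (hre : 0 < (b : ℂ).re) (f : Dbar2 N) : formDbar2 N b f =
    ∑ m₁ : ZMod N, ∑ m₂ : ZMod N, ∫ x : ℝ × ℝ,
      kerG N b x.1 m₁ x.2 m₂ * (f : Fn2 N) x.1 m₁ x.2 m₂ := by
  obtain ⟨n, hn⟩ := exists_expo N b hre
  have hi := fun m₁ m₂ => (norm_integral_kerG_le N b hn f m₁ m₂).1
  have h0 : formDbar2 N b f = ∑ m₁ : ZMod N, ∫ x₁ : ℝ, ∑ m₂ : ZMod N, ∫ x₂ : ℝ,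
      kerG N b x₁ m₁ x₂ m₂ * (f : Fn2 N) x₁ m₁ x₂ m₂ := rfl
  rw [h0]
  refine Finset.sum_congr rfl fun m₁ _ => ?_
  rw [integral_finsetSum _ fun m₂ _ => (hi m₁ m₂).integral_prod_left]
  exact Finset.sum_congr rfl fun m₂ _ => (integral_prod _ (hi m₁ m₂)).symm

lemma norm_formDbar2_le (hre : 0 < (b : ℂ).re) {n : ℕ}
    (hn : 1 ≤ 2 * Real.pi * (b : ℂ).re / N * n) (f : Dbar2 N) : ‖formDbar2 N b f‖ ≤
      (N * (N * (4 * ‖memLp_weight.toLp _‖))) * (Finset.univ.image fun s : Bool × Bool =>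
        (((0, (expo n s).1), (0, (expo n s).2)) : (ℤ × ℤ) × (ℤ × ℤ))).sup (frechetSeminorm N b) f := by
  set S := (Finset.univ.image fun s : Bool × Bool =>
        (((0, (expo n s).1), (0, (expo n s).2)) : (ℤ × ℤ) × (ℤ × ℤ))) with hS
  have h1 : ∀ s : Bool × Bool, ‖toL2 N (opY N b (expo n s) f)‖ ≤ S.sup (frechetSeminorm N b) f := by
    intro s
    have hs : (((0, (expo n s).1), (0, (expo n s).2)) : (ℤ × ℤ) × (ℤ × ℤ)) ∈ S :=
      Finset.mem_image_of_mem _ (Finset.mem_univ s)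
    rw [← frechetSeminorm_zero]
    exact Seminorm.le_finset_sup_apply hs
  rw [formDbar2_eq N b hre]
  have h2 : ∀ m₁ m₂ : ZMod N, ‖∫ x : ℝ × ℝ, kerG N b x.1 m₁ x.2 m₂ * (f : Fn2 N) x.1 m₁ x.2 m₂‖ ≤
      4 * ‖memLp_weight.toLp _‖ * S.sup (frechetSeminorm N b) f := by
    intro m₁ m₂
    refine (norm_integral_kerG_le N b hn f m₁ m₂).2.trans ?_
    calc _ ≤ ∑ s : Bool × Bool, ‖memLp_weight.toLp _‖ * S.sup (frechetSeminorm N b) f :=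
          Finset.sum_le_sum fun s _ => mul_le_mul_of_nonneg_left (h1 s) (norm_nonneg _)
      _ = _ := by
          rw [Finset.sum_const, nsmul_eq_mul]
          simp only [Finset.card_univ, Fintype.card_prod, Fintype.card_bool]
          push_cast
          ring
  calc _ ≤ ∑ m₁ : ZMod N, ∑ m₂ : ZMod N, 4 * ‖memLp_weight.toLp _‖ * S.sup (frechetSeminorm N b) f :=
        norm_sum_le_of_le _ fun m₁ _ => norm_sum_le_of_le _ fun m₂ _ => h2 m₁ m₂
    _ = _ := by
        simp only [Finset.sum_const, nsmul_eq_mul, Finset.card_univ, ZMod.card]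
        ring

theorem continuous_formDbar2 (hre : 0 < (b : ℂ).re) {Ψ : Dbar2 N →ₗ[ℂ] ℂ} {c : ℂ}
    (hΨ : ∀ f, Ψ f = c * formDbar2 N b f) : Continuous[frechetTopology N b, inferInstance] Ψ := by
  obtain ⟨n, hn⟩ := exists_expo N b hre
  let _ : TopologicalSpace (Dbar2 N) := frechetTopology N b
  have hp : WithSeminorms (frechetSeminorm N b) := ⟨rfl⟩
  refine WithSeminorms.continuous_normedSpace_rng ℂ hp Ψ ⟨Finset.univ.image fun s : Bool × Bool =>
      (((0, (expo n s).1), (0, (expo n s).2)) : (ℤ × ℤ) × (ℤ × ℤ)),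
    Real.toNNReal (‖c‖ * (N * (N * (4 * ‖memLp_weight.toLp _‖)))), fun f => ?_⟩
  have h := norm_formDbar2_le N b hre hn f
  rw [Seminorm.comp_apply, coe_normSeminorm, hΨ, norm_mul, _root_.smul_apply, NNReal.smul_def,
    Real.coe_toNNReal _ (by positivity), smul_eq_mul, mul_assoc]
  exact mul_le_mul_of_nonneg_left h (norm_nonneg c)

end Form

/-! ### The Gaussian multiplier in Fourier space -/

section Gaussian

variable {θ : ℂ → ℂ} {r : ℝ}

/-- The Fourier integral `∫ e^{-2irνx} θ(x) dx`. -/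
def fourierR (r : ℝ) (θ : ℂ → ℂ) (ν : ℝ) : ℂ := ∫ x : ℝ, exp (-(2 * r * I * ν) * x) * θ x

lemma norm_exp_ofReal_mul_I_mul (y : ℝ) (w : ℂ) (hw : w = (y : ℂ) * I) : ‖exp w‖ = 1 := by
  rw [hw, norm_exp_ofReal_mul_I]

lemma Rapid1.integrable_self (hθ : Rapid1 θ) : Integrable fun x : ℝ => θ x := by
  simpa using hθ.integrable 0

lemma norm_exp_fourier (r ν x : ℝ) : ‖exp (-(2 * r * I * ν) * x)‖ = 1 :=
  norm_exp_ofReal_mul_I_mul (-(2 * r * ν * x)) _ (by push_cast; ring)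

lemma Rapid1.continuous_fourierR (hθ : Rapid1 θ) : Continuous (fourierR r θ) := by
  refine continuous_of_dominated (bound := fun x : ℝ => ‖θ x‖) (fun ν => ?_) (fun ν => ?_)
    hθ.integrable_self.norm ?_
  · exact ((hθ.mul_exp (-(2 * r * I * ν))).integrable_self).aestronglyMeasurable
  · refine Filter.Eventually.of_forall fun x => ?_
    rw [norm_mul, norm_exp_fourier, one_mul]
  · exact Filter.Eventually.of_forall fun x => by fun_prop

/-- Moving the contour to `Im x = s` gains the factor `e^{2rνs}`; a suitable sign of `s` gives
exponential decay of the transform in each direction. -/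
lemma Rapid1.fourierR_le (hθ : Rapid1 θ) (s ν : ℝ) :
    ‖fourierR r θ ν‖ ≤ Real.exp (2 * r * ν * s) * ∫ x : ℝ, ‖θ (x + s * I)‖ := by
  rw [fourierR, ← (hθ.mul_exp (-(2 * r * I * ν))).integral_shift (s * I), ← integral_const_mul]
  refine norm_integral_le_of_norm_le ((hθ.integrable (s * I)).norm.const_mul _)
    (Filter.Eventually.of_forall fun x => ?_)
  rw [norm_mul, norm_exp]
  have : (-(2 * r * I * ν) * (x + s * I) : ℂ) =
      ((2 * r * ν * s : ℝ) : ℂ) - ((2 * r * ν * x : ℝ) : ℂ) * I := by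
    push_cast
    linear_combination (-(2 * r * ν * s : ℂ)) * I_sq
  rw [this, sub_re, ofReal_re, re_ofReal_mul, I_re, mul_zero, sub_zero]

lemma Rapid1.integrable_fourierR (hθ : Rapid1 θ) (hr : 0 < r) : Integrable (fourierR r θ) := by
  set A := ∫ x : ℝ, ‖θ (x + (1 : ℝ) * I)‖ with hA
  set B := ∫ x : ℝ, ‖θ (x + (-1 : ℝ) * I)‖ with hB
  have hA0 : 0 ≤ A := integral_nonneg fun _ => norm_nonneg _
  have hB0 : 0 ≤ B := integral_nonneg fun _ => norm_nonneg _
  have h1 : Integrable fun ν : ℝ => (A + B) * Real.exp (-|2 * r * ν|) :=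
    (integrable_exp_neg_abs.comp_mul_left' (g := fun y : ℝ => Real.exp (-|y|))
      (R := 2 * r) (by positivity)).const_mul _
  refine h1.mono' hθ.continuous_fourierR.aestronglyMeasurable (Filter.Eventually.of_forall fun ν => ?_)
  rcases abs_cases (2 * r * ν) with h | h <;> rw [h.1]
  · refine (hθ.fourierR_le (-1) ν).trans ?_
    rw [← hB, mul_comm, mul_neg_one]
    gcongr
    linarith
  · refine (hθ.fourierR_le 1 ν).trans ?_
    rw [← hA, mul_comm, mul_one, neg_neg]
    gcongr
    linarith

/-- For `ε > 0` the double integral converges absolutely, so Fubini applies and the inner integral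
is an ordinary Gaussian one. -/
lemma Rapid1.gaussian_regularized (hθ : Rapid1 θ) (μ : ℝ) {ε : ℝ} (hε : 0 < ε) :
    ∫ ν : ℝ, exp (2 * r * I * (μ * ν)) * exp (-((r * I + ε) * ν ^ 2)) * fourierR r θ ν =
      (Real.pi / (r * I + ε)) ^ (1 / 2 : ℂ) *
        ∫ x : ℝ, exp (-((r : ℂ) ^ 2 * (μ - x) ^ 2 / (r * I + ε))) * θ x := by
  have hre : (-(r * I + ε : ℂ)).re < 0 := by simpa using hε
  have hbne : (r * I + ε : ℂ) ≠ 0 := fun h => by rw [h] at hre; simp at hre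
  set K : ℝ → ℝ → ℂ := fun ν x =>
    exp (-(r * I + ε) * ν ^ 2 + 2 * r * I * (μ - x) * ν + 0) * θ x with hK
  have hn : ∀ ν x : ℝ, ‖K ν x‖ = Real.exp (-ε * ν ^ 2) * ‖θ x‖ := by
    intro ν x
    rw [hK, norm_mul, norm_exp]
    congr 2
    have : (-(r * I + ε) * ν ^ 2 + 2 * r * I * (μ - x) * ν + 0 : ℂ) =
        ((-ε * ν ^ 2 : ℝ) : ℂ) + ((-r * ν ^ 2 + 2 * r * (μ - x) * ν : ℝ) : ℂ) * I := by
      push_cast; ring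
    rw [this, add_re, ofReal_re, re_ofReal_mul, I_re, mul_zero, add_zero]
  have hint : Integrable (Function.uncurry K) (volume.prod volume) := by
    have h := (integrable_exp_neg_mul_sq hε).mul_prod hθ.integrable_self.norm
    refine h.mono' ?_ (Filter.Eventually.of_forall fun p => (hn p.1 p.2).le)
    have hc : Continuous θ := hθ.diff.continuous
    refine Continuous.aestronglyMeasurable ?_
    unfold Function.uncurry
    fun_prop
  have e1 : ∀ ν : ℝ, exp (2 * r * I * (μ * ν)) * exp (-((r * I + ε) * ν ^ 2)) * fourierR r θ ν =
      ∫ x : ℝ, K ν x := by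
    intro ν
    rw [fourierR, ← integral_const_mul]
    congr 1
    funext x
    rw [hK, ← mul_assoc, ← exp_add, ← exp_add]
    congr 2
    ring
  simp only [e1]
  rw [integral_integral_swap hint, ← integral_const_mul]
  congr 1
  funext x
  rw [hK, integral_mul_const, integral_cexp_quadratic hre, neg_neg, ← mul_assoc]
  congr 3
  have hI : I ^ 2 = -1 := I_sq
  field_simp
  rw [hI]
  ring

/-- The limit `ε → 0⁺` of the regularised identity, by dominated convergence on both sides: on the
left the Fourier transform is integrable, on the right `Re (1/(ri + ε)) ≥ 0` bounds the Gaussian by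
one. -/
lemma Rapid1.gaussian_transform (hθ : Rapid1 θ) (hr : 0 < r) (μ : ℝ) :
    ∫ ν : ℝ, exp (2 * r * I * (μ * ν)) * exp (-(r * I * ν ^ 2)) * fourierR r θ ν =
      (Real.pi / (r * I)) ^ (1 / 2 : ℂ) * ∫ x : ℝ, exp (r * I * (μ - x) ^ 2) * θ x := by
  have hrI : (r * I : ℂ) ≠ 0 := mul_ne_zero (by exact_mod_cast hr.ne') I_ne_zero
  have hc0 : Filter.Tendsto (fun ε : ℝ => (r * I + ε : ℂ)) (𝓝[>] 0) (𝓝 (r * I)) := by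
    have : Continuous fun ε : ℝ => (r * I + ε : ℂ) := by fun_prop
    simpa using (this.tendsto 0).mono_left nhdsWithin_le_nhds
  have lim1 : Filter.Tendsto (fun ε : ℝ => ∫ ν : ℝ,
      exp (2 * r * I * (μ * ν)) * exp (-((r * I + ε) * ν ^ 2)) * fourierR r θ ν) (𝓝[>] 0)
      (𝓝 (∫ ν : ℝ, exp (2 * r * I * (μ * ν)) * exp (-(r * I * ν ^ 2)) * fourierR r θ ν)) := by
    have hcF := hθ.continuous_fourierR (r := r)
    refine tendsto_integral_filter_of_dominated_convergence (fun ν => ‖fourierR r θ ν‖)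
      (Filter.Eventually.of_forall fun ε => ?_) ?_ (hθ.integrable_fourierR hr).norm
      (Filter.Eventually.of_forall fun ν => ?_)
    · exact Continuous.aestronglyMeasurable (by fun_prop)
    · filter_upwards [self_mem_nhdsWithin] with ε hε
      refine Filter.Eventually.of_forall fun ν => ?_
      rw [norm_mul, norm_mul, norm_exp_ofReal_mul_I_mul (2 * r * (μ * ν)) _ (by push_cast; ring),
        one_mul, norm_exp]
      have : (-((r * I + ε) * ν ^ 2) : ℂ) =
          ((-ε * ν ^ 2 : ℝ) : ℂ) + ((-r * ν ^ 2 : ℝ) : ℂ) * I := by push_cast; ring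
      rw [this, add_re, ofReal_re, re_ofReal_mul, I_re, mul_zero, add_zero]
      refine mul_le_of_le_one_left (norm_nonneg _) (Real.exp_le_one_iff.mpr ?_)
      have := mul_nonneg (le_of_lt (Set.mem_Ioi.mp hε)) (sq_nonneg ν)
      linarith
    · refine Filter.Tendsto.mul_const _ (Filter.Tendsto.const_mul _ ?_)
      exact ((hc0.mul_const _).neg).cexp
  have lim2 : Filter.Tendsto (fun ε : ℝ => (Real.pi / (r * I + ε)) ^ (1 / 2 : ℂ) *
        ∫ x : ℝ, exp (-((r : ℂ) ^ 2 * (μ - x) ^ 2 / (r * I + ε))) * θ x) (𝓝[>] 0)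
      (𝓝 ((Real.pi / (r * I)) ^ (1 / 2 : ℂ) * ∫ x : ℝ, exp (r * I * (μ - x) ^ 2) * θ x)) := by
    refine Filter.Tendsto.mul ?_ ?_
    -- The limiting base lies on the negative imaginary axis, away from the branch cut, so the
    -- square root is continuous there.
    · have hslit : (Real.pi / (r * I) : ℂ) ∈ slitPlane := by
        refine Or.inr ?_
        have : (Real.pi / (r * I) : ℂ) = ((-(Real.pi / r) : ℝ) : ℂ) * I := by
          push_cast
          field_simp
          rw [I_sq]
          ring
        rw [this, im_ofReal_mul, I_im, mul_one]
        exact neg_ne_zero.mpr (div_ne_zero Real.pi_ne_zero hr.ne')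
      exact (Filter.Tendsto.div tendsto_const_nhds hc0 hrI).cpow tendsto_const_nhds hslit
    · have hcθ : Continuous θ := hθ.diff.continuous
      refine tendsto_integral_filter_of_dominated_convergence (fun x : ℝ => ‖θ x‖)
        (Filter.Eventually.of_forall fun ε => ?_) ?_ hθ.integrable_self.norm
        (Filter.Eventually.of_forall fun x => ?_)
      · exact Continuous.aestronglyMeasurable (by fun_prop)
      · filter_upwards [self_mem_nhdsWithin] with ε hε
        refine Filter.Eventually.of_forall fun x => ?_
        rw [norm_mul, norm_exp]
        refine mul_le_of_le_one_left (norm_nonneg _) (Real.exp_le_one_iff.mpr ?_)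
        have : (-((r : ℂ) ^ 2 * (μ - x) ^ 2 / (r * I + ε))) =
            ((-(r ^ 2 * (μ - x) ^ 2) : ℝ) : ℂ) * (r * I + ε)⁻¹ := by push_cast; ring
        rw [this, re_ofReal_mul, inv_re]
        have h1 : (r * I + ε : ℂ).re = ε := by simp
        rw [h1]
        have h2 : 0 ≤ r ^ 2 * (μ - x) ^ 2 * (ε / normSq (r * I + ε)) :=
          mul_nonneg (by positivity) (div_nonneg (le_of_lt (Set.mem_Ioi.mp hε)) (normSq_nonneg _))
        linarith
      · refine Filter.Tendsto.mul_const _ ?_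
        have h := ((tendsto_const_nhds (x := (r : ℂ) ^ 2 * (μ - x) ^ 2)).div hc0 hrI).neg.cexp
        have e : (-((r : ℂ) ^ 2 * (μ - x) ^ 2 / (r * I))) = r * I * (μ - x) ^ 2 := by
          field_simp
          rw [I_sq]
          ring
        rwa [e] at h
  refine tendsto_nhds_unique (lim1.congr' ?_) lim2
  filter_upwards [self_mem_nhdsWithin] with ε hε
  exact hθ.gaussian_regularized μ hε

lemma Rapid1.integrable_gaussian_fourierR (hθ : Rapid1 θ) (hr : 0 < r) (μ : ℝ) :
    Integrable fun ν : ℝ =>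
      exp (2 * r * I * (μ * ν)) * exp (-(r * I * ν ^ 2)) * fourierR r θ ν := by
  have hcF := hθ.continuous_fourierR (r := r)
  refine (hθ.integrable_fourierR hr).norm.mono' (Continuous.aestronglyMeasurable (by fun_prop))
    (Filter.Eventually.of_forall fun ν => le_of_eq ?_)
  rw [norm_mul, norm_mul, norm_exp_ofReal_mul_I_mul (2 * r * (μ * ν)) _ (by push_cast; ring),
    norm_exp_ofReal_mul_I_mul (-(r * ν ^ 2)) _ (by push_cast; ring), one_mul, one_mul]

lemma Rapid1.mul_gauss (hθ : Rapid1 θ) (r : ℝ) (w Q : ℂ) :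
    Rapid1 fun z => exp (r * I * (w - z - Q) ^ 2) * θ z := by
  have h := (((hθ.tensor Rapid1.gaussian).mul_mild (Mild2.gauss r Q)).slice_left w).const_mul
    (exp (-Real.pi * w ^ 2))⁻¹
  refine cast (congrArg Rapid1 ?_) h
  funext z
  have := exp_ne_zero (-Real.pi * w ^ 2)
  field_simp

end Gaussian

/-! ### The integral kernel of `V⁻¹` -/

section Kernel

variable (N : ℕ) [NeZero N] (b : Circle)

/-- The quadratic Gauss sum. -/
def gaussSum : ℂ := ∑ n : ZMod N, gq N n

lemma gq_neg (k : ZMod N) : gq N (-k) = gq N k := by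
  obtain ⟨a, rfl⟩ := ZMod.intCast_surjective k
  rw [← Int.cast_neg, gq_intCast, gq_intCast]
  push_cast
  rw [neg_sq]

/-- Completing the square with `gq_add`, then translating the summation variable: the discrete
counterpart of the Gaussian Fourier transform. -/
lemma sum_gq_mul (k : ZMod N) :
    ∑ n : ZMod N, gq N n * ZMod.stdAddChar (k * n) = gaussSum N * (gq N k)⁻¹ := by
  have h := gq_ne_zero N k
  rw [gaussSum, ← Equiv.sum_comp (Equiv.addRight k) (gq N), Finset.sum_mul]
  refine Finset.sum_congr rfl fun n _ => ?_
  rw [Equiv.coe_addRight, gq_add, mul_comm k n]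
  field_simp

/-- If it vanished, all Fourier coefficients of `gq` would vanish, while by orthogonality of
characters their sum is `N * gq N 0`. -/
lemma gaussSum_ne_zero : gaussSum N ≠ 0 := by
  intro h0
  have h1 : ∑ k : ZMod N, ∑ n : ZMod N, gq N n * ZMod.stdAddChar (k * n) = 0 := by
    refine Finset.sum_eq_zero fun k _ => ?_
    rw [sum_gq_mul, h0, zero_mul]
  rw [Finset.sum_comm] at h1
  simp only [← Finset.mul_sum, AddChar.sum_mulShift _ (ZMod.isPrimitive_stdAddChar N)] at h1
  simp only [Nat.cast_ite, Nat.cast_zero, mul_ite, mul_zero, Finset.sum_ite_eq', Finset.mem_univ,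
    if_true, ZMod.card] at h1
  exact mul_ne_zero (gq_ne_zero N 0) (natCast_ne_zero' N) h1

/-- The normalisation constant of the invariant form. -/
def normConst : ℂ :=
  1 / (N : ℂ) ^ 2 * (gaussSum N * (Real.pi / ((Real.pi / N : ℝ) * I)) ^ (1 / 2 : ℂ))

lemma normConst_ne_zero : normConst N ≠ 0 := by
  have hN := natCast_ne_zero' N
  have hpi : (Real.pi : ℂ) ≠ 0 := by exact_mod_cast Real.pi_ne_zero
  refine mul_ne_zero (one_div_ne_zero (pow_ne_zero 2 hN)) (mul_ne_zero (gaussSum_ne_zero N) ?_)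
  rw [Ne, cpow_eq_zero_iff, not_and_or]
  left
  push_cast
  exact div_ne_zero hpi (mul_ne_zero (div_ne_zero hpi hN) I_ne_zero)

/-- The operator `𝒯` is multiplication in Fourier space by a Gaussian in `ν` and a quadratic
character in `n`. Its kernel is therefore a Gaussian in `μ - x` times the inverse character of `m₁ -
m`, with the Gauss sum and the Gaussian constant collected in `normConst`. The translation `σ₁⁻¹` is
moved from `φ` to the kernel by a contour shift, which produces `Q`. -/
lemma VInv_eq {φ : Fn N ℂ} (hφ : ∀ m, Rapid1 fun μ => φ μ m) (μ : ℝ) (m : ZMod N) :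
    VInv N b φ μ m =
      normConst N * ∑ m₁ : ZMod N, ∫ x : ℝ, kerG N b x m₁ μ m * φ x m₁ := by
  have hN := natCast_ne_zero' N
  set r : ℝ := Real.pi / N with hrdef
  have hr : 0 < r := div_pos Real.pi_pos (by exact_mod_cast Nat.pos_of_ne_zero (NeZero.ne N))
  have hrc : (r : ℂ) = Real.pi / N := by rw [hrdef]; push_cast; rfl
  set θ : ZMod N → ℂ → ℂ := fun m₁ z => φ (z - qShift b) m₁ with hθdef
  have hθ : ∀ m₁, Rapid1 (θ m₁) := fun m₁ => by
    have h := ((Rapid1.gaussian.tensor (hφ m₁)).shift 0 (-qShift b)).slice 0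
    simpa [hθdef, sub_eq_add_neg] using h
  set T : ZMod N → ℝ → ℂ := fun m₁ ν =>
    exp (2 * r * I * (μ * ν)) * exp (-(r * I * ν ^ 2)) * fourierR r (θ m₁) ν with hT
  have hTi : ∀ m₁, Integrable (T m₁) := fun m₁ => (hθ m₁).integrable_gaussian_fourierR hr μ
  have hJ : ∀ m₁, ∫ ν : ℝ, T m₁ ν = (Real.pi / ((Real.pi / N : ℝ) * I)) ^ (1 / 2 : ℂ) *
      ∫ x : ℝ, exp (r * I * (μ - x - qShift b) ^ 2) * φ x m₁ := by
    intro m₁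
    rw [(hθ m₁).gaussian_transform hr μ]
    congr 1
    rw [← ((hφ m₁).mul_gauss r μ (qShift b)).integral_shift (-qShift b)]
    congr 1
    funext x
    simp only [hθdef, ← sub_eq_add_neg]
    congr 2
    ring
  have h1 : ∀ n : ZMod N, (∫ ν : ℝ,
      exp (2 * Real.pi * I / N * (μ * ν)) * ZMod.stdAddChar (-(m * n)) *
      ((-1) ^ (n.val ^ 2) * exp (Real.pi * I / N * (-(ν : ℂ) ^ 2 + (n.val : ℂ) ^ 2))) *
      ∑ m₁ : ZMod N, ∫ μ₁ : ℝ,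
        exp (-(2 * Real.pi * I / N) * (μ₁ * ν)) * ZMod.stdAddChar (m₁ * n) * shiftInv b φ μ₁ m₁) =
      ∑ m₁ : ZMod N, gq N n * ZMod.stdAddChar ((m₁ - m) * n) * ∫ ν : ℝ, T m₁ ν := by
    intro n
    simp only [← integral_const_mul]
    rw [← integral_finsetSum _ fun m₁ _ => (hTi m₁).const_mul _]
    congr 1
    funext ν
    rw [Finset.mul_sum]
    refine Finset.sum_congr rfl fun m₁ _ => ?_
    have e1 : (∫ μ₁ : ℝ, exp (-(2 * Real.pi * I / N) * (μ₁ * ν)) * ZMod.stdAddChar (m₁ * n) *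
        shiftInv b φ μ₁ m₁) = ZMod.stdAddChar (m₁ * n) * fourierR r (θ m₁) ν := by
      rw [fourierR, ← integral_const_mul]
      congr 1
      funext x
      have : -(2 * Real.pi * I / N) * (x * ν) = (-(2 * r * I * ν) * x : ℂ) := by
        rw [hrc]; ring
      rw [this, mul_comm (exp _), mul_assoc]
      rfl
    have e2 : (ZMod.stdAddChar ((m₁ - m) * n) : ℂ) =
        ZMod.stdAddChar (-(m * n)) * ZMod.stdAddChar (m₁ * n) := by
      rw [← AddChar.map_add_eq_mul]
      congr 1
      ring
    have e3 : exp (Real.pi * I / N * (-(ν : ℂ) ^ 2 + (n.val : ℂ) ^ 2)) =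
        exp (-(r * I * ν ^ 2)) * exp (Real.pi * I / N * (n.val : ℂ) ^ 2) := by
      rw [← exp_add, hrc]
      congr 1
      ring
    have e4 : 2 * Real.pi * I / N * (μ * ν) = (2 * r * I * (μ * ν) : ℂ) := by rw [hrc]; ring
    rw [e1, e2, e3, e4, hT, gq]
    ring
  rw [VInv, opT]
  simp only [h1]
  rw [Finset.sum_comm]
  simp only [← Finset.sum_mul, sum_gq_mul, hJ]
  rw [normConst, mul_assoc (1 / (N : ℂ) ^ 2)]
  congr 1
  rw [Finset.mul_sum]
  refine Finset.sum_congr rfl fun m₁ _ => ?_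
  -- The sum over `n` gives the character at `m₁ - m` and the kernel has it at `m - m₁`; they agree
  -- because `gq` is even.
  have e5 : (∫ x : ℝ, kerG N b x m₁ μ m * φ x m₁) = (gq N (m₁ - m))⁻¹ *
      ∫ x : ℝ, exp (r * I * (μ - x - qShift b) ^ 2) * φ x m₁ := by
    rw [← integral_const_mul]
    congr 1
    funext x
    rw [kerG, ← gq_neg, neg_sub, hrc, mul_comm (exp _), mul_assoc]
    congr 4
    ring
  rw [e5]
  ring

/-- On elementary tensors the invariant form is `⟨conj (V⁻¹ φ) | ψ⟩`. -/
theorem psiForm_eq (hre : 0 < (b : ℂ).re) {φ ψ : Fn N ℂ} (hφ : φ ∈ Dbar N) (hψ : ψ ∈ Dbar N) :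
    psiForm N b φ ψ = normConst N * formDbar2 N b ⟨tensorFn φ ψ, tensorFn_mem N hφ hψ⟩ := by
  obtain ⟨n, hn⟩ := exists_expo N b hre
  have hi := fun m₁ m₂ => (norm_integral_kerG_le N b hn
    ⟨tensorFn φ ψ, tensorFn_mem N hφ hψ⟩ m₁ m₂).1
  rw [formDbar2_eq N b hre, Finset.sum_comm, psiForm, innerH, Finset.mul_sum]
  refine Finset.sum_congr rfl fun m₂ _ => ?_
  simp only [conj_conj, VInv_eq N b (Rapid1.of_mem_Dbar hφ), mul_assoc, integral_const_mul]
  congr 1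
  have e : ∀ m₁, (∫ x : ℝ × ℝ, kerG N b x.1 m₁ x.2 m₂ * tensorFn φ ψ x.1 m₁ x.2 m₂) =
      ∫ y : ℝ, ∫ x : ℝ, kerG N b x m₁ y m₂ * tensorFn φ ψ x m₁ y m₂ :=
    fun m₁ => integral_prod_symm _ (hi m₁ m₂)
  simp only [e]
  rw [← integral_finsetSum _ fun m₁ _ => (hi m₁ m₂).integral_prod_right]
  congr 1
  funext y
  rw [Finset.sum_mul]
  refine Finset.sum_congr rfl fun m₁ _ => ?_
  rw [← integral_mul_const]
  simp only [tensorFn, mul_assoc]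

end Kernel

end QLorentz

end

/-! ### The main theorem -/

theorem mainTheorem1 (N : ℕ) [NeZero N] (b : Circle)
    (hre : 0 < (b : ℂ).re) (him : 0 < (b : ℂ).im) (lam₁ lam₂ : ℂˣ) :
    ((∃ Ψ : QLorentz.D2 N →ₗ[ℂ] ℂ,
        Ψ ≠ 0 ∧ QLorentz.IsInvariant (QLorentz.repD2 N b lam₁ lam₂) Ψ) →
      lam₁ = lam₂ ∨ lam₁ = lam₂⁻¹) ∧
    ((∃ Ψ : QLorentz.Dbar2 N →ₗ[ℂ] ℂ,
        Ψ ≠ 0 ∧ QLorentz.IsInvariant (QLorentz.repDbar2 N b lam₁ lam₂) Ψ) →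
      lam₁ = lam₂ ∨ lam₁ = lam₂⁻¹) ∧
    (lam₁ = lam₂ ∨ lam₁ = lam₂⁻¹ →
      ∃ Ψ : QLorentz.Dbar2 N →ₗ[ℂ] ℂ,
        Continuous[QLorentz.frechetTopology N b, inferInstance] Ψ ∧
        QLorentz.IsInvariant (QLorentz.repDbar2 N b lam₁ lam₂) Ψ ∧
        (∀ (φ ψ : QLorentz.Fn N ℂ) (hφ : φ ∈ QLorentz.Dbar N) (hψ : ψ ∈ QLorentz.Dbar N),
          Ψ ⟨QLorentz.tensorFn φ ψ, QLorentz.tensorFn_mem N hφ hψ⟩ =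
            QLorentz.psiForm N b φ ψ) ∧
        Ψ.comp (Submodule.inclusion (QLorentz.D2_le_Dbar2 N)) ≠ 0 ∧
        ∀ Φ : QLorentz.D2 N →ₗ[ℂ] ℂ,
          QLorentz.IsInvariant (QLorentz.repD2 N b lam₁ lam₂) Φ →
          ∃ c : ℂ, Φ = c • Ψ.comp (Submodule.inclusion (QLorentz.D2_le_Dbar2 N))) := by
  refine ⟨fun ⟨Ψ, h0, hΨ⟩ => hΨ.eq_or_eq_inv hre him h0, fun ⟨Ψ, h0, hΨ⟩ => ?_, fun hlam => ?_⟩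
  -- A functional on `Dbar2` is determined by its restriction to `D2`, because the two spaces
  -- coincide; a nonzero form therefore restricts to a nonzero form.
  · refine hΨ.restrict.eq_or_eq_inv hre him fun h => h0 (LinearMap.ext fun f => ?_)
    exact LinearMap.congr_fun h (Submodule.inclusion (QLorentz.Dbar2_le_D2 N) f)
  have hc := QLorentz.normConst_ne_zero N
  have hinv := QLorentz.isInvariant_comp_opG (N := N) (QLorentz.shiftInv1_intD2 b)
    (QLorentz.shiftInv2_intD2 b) (QLorentz.lamPar_eq hlam)
  refine ⟨QLorentz.normConst N • QLorentz.formDbar2 N b,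
    QLorentz.continuous_formDbar2 N b hre fun f => rfl, fun ξ f => ?_,
    fun φ ψ hφ hψ => (QLorentz.psiForm_eq N b hre hφ hψ).symm, fun h => ?_, fun Φ hΦ => ?_⟩
  · have h := hinv.comp_inclusion ξ f
    change QLorentz.normConst N * QLorentz.formDbar2 N b _ = _ * (QLorentz.normConst N * _)
    rw [mul_left_comm]
    exact congrArg _ h
  -- The test vector is the inverse kernel times the Gaussian square, on which the form takes the
  -- value `normConst N`.
  · have h1 := LinearMap.congr_fun h (QLorentz.opGinv N b (QLorentz.gaussD2 N))
    have h2 : QLorentz.normConst N * QLorentz.intD2 N (QLorentz.opG N b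
        (QLorentz.opGinv N b (QLorentz.gaussD2 N))) = 0 := h1
    rw [QLorentz.opG_opGinv, QLorentz.intD2_gaussD2, mul_one] at h2
    exact hc h2
  · obtain ⟨h1, h2⟩ := hΦ.shiftInv hre him
    -- The constant is the value of `Φ` on that test vector, divided by the value of the normalised
    -- form there.
    refine ⟨(QLorentz.normConst N)⁻¹ * Φ (QLorentz.opGinv N b (QLorentz.gaussD2 N)),
      LinearMap.ext fun f => ?_⟩
    have h3 := QLorentz.eq_totalInt_of_shiftInv hre him h1 h2 (QLorentz.opG N b f)
    rw [LinearMap.comp_apply, LinearMap.comp_apply, QLorentz.opGinv_opG] at h3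
    rw [h3]
    change _ = _ * (QLorentz.normConst N * QLorentz.totalInt (QLorentz.opG N b f : QLorentz.Fn2 N))
    field_simp
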